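/- **Setting.** For each $n\ge 1$ consider the Markovian X model: two customer classes and two service pools with $m^n_1,m^n_2$ servers; class-$i$ customers arrive at rate $\lambda^n_i>0$, a waiting class-$i$ customer abandons at rate $\theta_i>0$, and a class-$i$ customer in service in pool $j$ is served at rate $\mu_{i,j}>0$ (all exponential and independent). $Q^n_i$ is the class-$i$ queue length and $Z^n_{i,j}$ the number of class-$i$ customers in service in pool $j$. An arriving class-$i$ customer enters service in pool $i$ if a server there is idle and joins queue $i$ otherwise. With ratio parameters $r_{1,2}\ge r_{2,1}>0$ (rational) and thresholds $k^n_{1,2},k^n_{2,1}>0$ put $$D^n_{1,2}=Q^n_1-k^n_{1,2}-r_{1,2}Q^n_2,\qquad D^n_{2,1}=r_{2,1}Q^n_2-k^n_{2,1}-Q^n_1 .$$ A newly available pool-2 server takes a class-1 customer if $D^n_{1,2}>0$ and $Z^n_{2,1}=0$; a newly available pool-1 server takes a class-2 customer if $D^n_{2,1}>0$ and $Z^n_{1,2}=0$ (states just before the service completion); otherwise the server takes a customer from its own queue, or idles if that queue is empty. Thus $X^n_6=(Q^n_1,Q^n_2,Z^n_{1,1},Z^n_{1,2},Z^n_{2,1},Z^n_{2,2})$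 is a continuous-time Markov chain, on the states in which no pool-$i$ server idles while $Q_i>0$. **Assumptions.** As $n\to\infty$: $\lambda^n_i/n\to\lambda_i\in(0,\infty)$ and $m^n_i/n\to m_i\in(0,\infty)$; for some $c_n>0$ with $c_n/n\to0$ and $c_n/\sqrt n\to\infty$, $k^n_{i,j}/c_n\to k_{i,j}>0$ for $(i,j)=(1,2),(2,1)$. With $q^a_i=(\lambda_i-\mu_{i,i}m_i)^+/\theta_i$ and $s^a_2=(m_2-\lambda_2/\mu_{2,2})^+$: $\theta_1q^a_1>\mu_{1,2}s^a_2$ and $q^a_1>r_{1,2}q^a_2$. For $\gamma=(q_1,q_2,z_{1,2})\in\mathbb S=[0,\infty)^2\times[0,m_2]$ let $\sigma(\gamma)=\mu_{1,2}z_{1,2}+\mu_{2,2}(m_2-z_{1,2})$ and $$\delta_+(\gamma)=r_{1,2}(\theta_2q_2-\lambda_2)+\lambda_1-\mu_{1,1}m_1-\sigma(\gamma)-\theta_1q_1,$$ $$\delta_-(\gamma)=r_{1,2}(\sigma(\gamma)+\theta_2q_2-\lambda_2)+\lambda_1-\mu_{1,1}m_1-\theta_1q_1,$$ $$\mathbb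 S^+=\{\gamma\in\mathbb S:q_1>r_{1,2}q_2\},\quad \mathbb A=\{\gamma\in\mathbb S:q_1=r_{1,2}q_2,\ \delta_->0>\delta_+\},\quad \mathbb A^+=\{\gamma\in\mathbb S:q_1=r_{1,2}q_2,\ \delta_+\ge0\}.$$ Initially, for each $n\ge 1$, almost surely $Z^n_{2,1}(0)=0$ and $Q^n_i(0)>a_n$ $(i=1,2)$, where $a_n/c_n\to a\in(0,\infty]$; moreover $n^{-1}(Q^n_1(0),Q^n_2(0),Z^n_{1,2}(0))\Rightarrow x(0)$ for a deterministic $x(0)=(q_1(0),q_2(0),z_{1,2}(0))\in\mathbb A\cup\mathbb A^+\cup\mathbb S^+$, and $D^n_{1,2}(0)\Rightarrow L$ for a proper random variable $L$ if $x(0)\in\mathbb A\cup\mathbb A^+$. **Notation.** $\bar X^n_3=n^{-1}(Q^n_1,Q^n_2,Z^n_{1,2})$, $\bar\lambda^n_i=\lambda^n_i/n$, $\bar m^n_i=m^n_i/n$, and $\mathcal T^n_0=\inf\{t>0:Z^n_{2,1}(t)>0\text{ or }Q^n_1(t)=0\text{ or }Q^n_2(t)=0\}$. The process $\bar X^n=(\bar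 Q^n_1,\bar Q^n_2,\bar Z^n_{1,2})$ is given by the integral representation, started at $\bar X^n_3(0)$, $$\bar Z^n_{1,2}(t)=\bar Z^n_{1,2}(0)+\mu_{2,2}\int_0^t1_{\{D^n_{1,2}(s)>0\}}(\bar m^n_2-\bar Z^n_{1,2}(s))\,ds-\mu_{1,2}\int_0^t1_{\{D^n_{1,2}(s)\le0\}}\bar Z^n_{1,2}(s)\,ds,$$ $$\bar Q^n_1(t)=\bar Q^n_1(0)+\bar\lambda^n_1t-\mu_{1,1}\bar m^n_1t-\mu_{1,2}\int_0^t1_{\{D^n_{1,2}(s)>0\}}\bar Z^n_{1,2}(s)\,ds-\mu_{2,2}\int_0^t1_{\{D^n_{1,2}(s)>0\}}(\bar m^n_2-\bar Z^n_{1,2}(s))\,ds-\theta_1\int_0^t\bar Q^n_1(s)\,ds,$$ $$\bar Q^n_2(t)=\bar Q^n_2(0)+\bar\lambda^n_2t-\mu_{2,2}\int_0^t1_{\{D^n_{1,2}(s)\le0\}}(\bar m^n_2-\bar Z^n_{1,2}(s))\,ds-\mu_{1,2}\int_0^t1_{\{D^n_{1,2}(s)\le0\}}\bar Z^n_{1,2}(s)\,ds-\theta_2\int_0^t\bar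 Q^n_2(s)\,ds,$$ where $D^n_{1,2}$ is the queue difference of the chain. The representation may be read in two ways: the integrands on the right are the components of $\bar X^n_3$, or the display is a system of integral equations for $\bar X^n$ (which has a continuous solution). The claims below hold for both. **Theorem 5.4.** Under these assumptions: 1. If $q_1(0)>0$, or if $\lambda_1+\lambda_2>\mu_{1,1}m_1+\sigma(x(0))$, then there is $\tau>0$ such that $\sup_{0\le t\le\tau}Z^n_{2,1}(t)\Rightarrow0$, $P(\mathcal T^n_0>\tau)\to1$, and $$d_{J_1}(\bar X^n_3,\bar X^n)\Rightarrow0\quad\text{in }\mathcal D([0,\tau],\mathbb R^3)\text{ as }n\to\infty,$$ with $d_{J_1}$ the Skorohod $J_1$ metric. 2. For every $x(0)\in\mathbb A\cup\mathbb A^+\cup\mathbb S^+$ and every $\tau>0$ with $P(\mathcal T^n_0>\tau)\to1$, one has $d_{J_1}(\bar X^n_3,\bar X^n)\Rightarrow0$ in $\mathcal D([0,\tau],\mathbb R^3)$. -/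

import Mathlib

open MeasureTheory Filter Topology Set
open scoped NNReal ENNReal

noncomputable section

namespace XModel

/-- Parameters that do not change with the scale `n`: `mu i j` is the rate at which a pool-`j` server
serves a class-`i` customer, `theta i` the abandonment rate of class `i`, `r12` and `r21` are the
queue-ratio parameters of the control. -/
structure Rates where
  mu11 : ℝ
  mu12 : ℝ
  mu21 : ℝ
  mu22 : ℝ
  theta1 : ℝ
  theta2 : ℝ
  r12 : ℝ
  r21 : ℝ

/-- Parameters of the `n`-th system: arrival rates, numbers of servers, thresholds. -/
structure Scale where
  lam1 : ℝ
  lam2 : ℝ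
  m1 : ℕ
  m2 : ℕ
  k12 : ℝ
  k21 : ℝ

/-- Limits of the arrival rates and of the numbers of servers, both divided by `n`. -/
structure Limits where
  lam1 : ℝ
  lam2 : ℝ
  m1 : ℝ
  m2 : ℝ

/-- State of the X model: the queue lengths `q i` and the numbers `z i j` of class-`i` customers in
service in pool `j`. -/
@[ext] structure State where
  q1 : ℕ
  q2 : ℕ
  z11 : ℕ
  z12 : ℕ
  z21 : ℕ
  z22 : ℕ

instance : MeasurableSpace State := ⊤

/-! ### The continuous-time Markov chain under the FQR-T control -/

/-- No pool has more busy servers than it has servers, and no server of pool `i` idles while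
customers of class `i` wait. -/
def stateSpace (S : Scale) : Set State :=
  {x | x.z11 + x.z21 ≤ S.m1 ∧ x.z12 + x.z22 ≤ S.m2 ∧
    (0 < x.q1 → x.z11 + x.z21 = S.m1) ∧ (0 < x.q2 → x.z12 + x.z22 = S.m2)}

/-- The queue difference `D₁₂ = Q₁ - k₁₂ - r₁₂ Q₂`. -/
def diff12 (R : Rates) (S : Scale) (x : State) : ℝ := x.q1 - S.k12 - R.r12 * x.q2

/-- The queue difference `D₂₁ = r₂₁ Q₂ - k₂₁ - Q₁`. -/
def diff21 (R : Rates) (S : Scale) (x : State) : ℝ := R.r21 * x.q2 - S.k21 - x.q1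

/-- An arriving class-1 customer enters service in pool 1 if a server there is idle, and joins queue 1
otherwise. -/
def arrive1 (S : Scale) (x : State) : State :=
  if x.z11 + x.z21 < S.m1 then { x with z11 := x.z11 + 1 } else { x with q1 := x.q1 + 1 }

def arrive2 (S : Scale) (x : State) : State :=
  if x.z12 + x.z22 < S.m2 then { x with z22 := x.z22 + 1 } else { x with q2 := x.q2 + 1 }

/-- Next customer of a pool-1 server that just became available. The state right before the service
completion is `x`, and `y` is `x` without the customer whose service is completed. The server takes a
class-2 customer if `D₂₁ > 0` and `Z₁₂ = 0`; otherwise it takes a customer from its own queue, or idles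
if that queue is empty. -/
def assign1 (R : Rates) (S : Scale) (x y : State) : State :=
  if 0 < diff21 R S x ∧ x.z12 = 0 ∧ 0 < x.q2 then { y with q2 := y.q2 - 1, z21 := y.z21 + 1 }
  else if 0 < x.q1 then { y with q1 := y.q1 - 1, z11 := y.z11 + 1 }
  else y

/-- Next customer of a pool-2 server that just became available. The server takes a class-1 customer if
`D₁₂ > 0` and `Z₂₁ = 0`; otherwise it takes a customer from its own queue, or idles if that queue is
empty. -/
def assign2 (R : Rates) (S : Scale) (x y : State) : State :=
  if 0 < diff12 R S x ∧ x.z21 = 0 ∧ 0 < x.q1 then { y with q1 := y.q1 - 1, z12 := y.z12 + 1 }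
  else if 0 < x.q2 then { y with q2 := y.q2 - 1, z22 := y.z22 + 1 }
  else y

/-- The generator of the Markov chain. The eight terms are the arrivals, the abandonments and the
service completions; a transition that needs a nonzero coordinate has rate zero where it vanishes. -/
def generator (R : Rates) (S : Scale) (f : State → ℝ) (x : State) : ℝ :=
  S.lam1 * (f (arrive1 S x) - f x)
  + S.lam2 * (f (arrive2 S x) - f x)
  + R.theta1 * x.q1 * (f { x with q1 := x.q1 - 1 } - f x)
  + R.theta2 * x.q2 * (f { x with q2 := x.q2 - 1 } - f x)
  + R.mu11 * x.z11 * (f (assign1 R S x { x with z11 := x.z11 - 1 }) - f x)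
  + R.mu21 * x.z21 * (f (assign1 R S x { x with z21 := x.z21 - 1 }) - f x)
  + R.mu12 * x.z12 * (f (assign2 R S x { x with z12 := x.z12 - 1 }) - f x)
  + R.mu22 * x.z22 * (f (assign2 R S x { x with z22 := x.z22 - 1 }) - f x)

/-- `X` is a continuous-time Markov chain on the state space with the generator above: its paths are
right-continuous step functions with finitely many jumps in finite time (right-continuous with left
limits for the discrete topology), and it solves the martingale problem of the generator on the
finitely supported functions, relative to the filtration `𝓕`. -/
structure IsChain {Ω : Type*} {mΩ : MeasurableSpace Ω} (R : Rates) (S : Scale)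
    (𝓕 : Filtration ℝ≥0 mΩ) (P : Measure Ω) (X : ℝ≥0 → Ω → State) : Prop where
  mem_stateSpace : ∀ t ω, X t ω ∈ stateSpace S
  adapted : ∀ t, Measurable[𝓕 t] (X t)
  right_continuous : ∀ ω t, ∀ᶠ s in 𝓝[>] t, X s ω = X t ω
  left_limit : ∀ ω t, 0 < t → ∃ x, ∀ᶠ s in 𝓝[<] t, X s ω = x
  martingale : ∀ f : State → ℝ, (Function.support f).Finite →
    Martingale (fun (t : ℝ≥0) ω ↦
      f (X t ω) - ∫ s in (0 : ℝ)..t, generator R S f (X s.toNNReal ω)) 𝓕 P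

/-! ### Regions of fluid states `γ = (q₁, q₂, z₁₂)`, and the overload condition -/

/-- Total service rate of a full pool 2, `μ₁₂ z₁₂ + μ₂₂ (m₂ - z₁₂)`. -/
def pool2Rate (R : Rates) (l : Limits) (γ : Fin 3 → ℝ) : ℝ :=
  R.mu12 * γ 2 + R.mu22 * (l.m2 - γ 2)

/-- The drift `δ₊` of the fast-time-scale process in the region where it is positive: jumps `+1`, `+r`,
`-1`, `-r` at rates `λ₁`, `θ₂ q₂`, `μ₁₁ m₁ + μ₁₂ z₁₂ + μ₂₂ (m₂ - z₁₂) + θ₁ q₁`, `λ₂`. -/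
def driftPos (R : Rates) (l : Limits) (γ : Fin 3 → ℝ) : ℝ :=
  R.r12 * (R.theta2 * γ 1 - l.lam2)
    + (l.lam1 - (R.mu11 * l.m1 + pool2Rate R l γ + R.theta1 * γ 0))

/-- The drift `δ₋` in the region where the fast-time-scale process is at most zero: jumps `+1`, `+r`,
`-1`, `-r` at rates `λ₁`, `μ₁₂ z₁₂ + μ₂₂ (m₂ - z₁₂) + θ₂ q₂`, `μ₁₁ m₁ + θ₁ q₁`, `λ₂`. -/
def driftNeg (R : Rates) (l : Limits) (γ : Fin 3 → ℝ) : ℝ :=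
  R.r12 * (pool2Rate R l γ + R.theta2 * γ 1 - l.lam2)
    + (l.lam1 - (R.mu11 * l.m1 + R.theta1 * γ 0))

/-- The fluid state space `[0, ∞) × [0, ∞) × [0, m₂]`. -/
def fluidSpace (l : Limits) : Set (Fin 3 → ℝ) := {γ | 0 ≤ γ 0 ∧ 0 ≤ γ 1 ∧ 0 ≤ γ 2 ∧ γ 2 ≤ l.m2}

def regionS0 (R : Rates) (l : Limits) : Set (Fin 3 → ℝ) :=
  {γ | γ ∈ fluidSpace l ∧ γ 0 - R.r12 * γ 1 = 0}

def regionSPos (R : Rates) (l : Limits) : Set (Fin 3 → ℝ) :=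
  {γ | γ ∈ fluidSpace l ∧ 0 < γ 0 - R.r12 * γ 1}

/-- The states where the fast-time-scale process is positive recurrent. -/
def regionA (R : Rates) (l : Limits) : Set (Fin 3 → ℝ) :=
  {γ | γ ∈ regionS0 R l ∧ 0 < driftNeg R l γ ∧ driftPos R l γ < 0}

def regionAPos (R : Rates) (l : Limits) : Set (Fin 3 → ℝ) :=
  {γ | γ ∈ regionS0 R l ∧ 0 ≤ driftPos R l γ}

/-- `q₁ᵃ`, the stationary fluid queue of class 1 without sharing. -/
def qAlone1 (R : Rates) (l : Limits) : ℝ := max (l.lam1 - R.mu11 * l.m1) 0 / R.theta1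

def qAlone2 (R : Rates) (l : Limits) : ℝ := max (l.lam2 - R.mu22 * l.m2) 0 / R.theta2

/-- `s₂ᵃ`, the stationary fluid idleness of pool 2 without sharing. -/
def sAlone2 (R : Rates) (l : Limits) : ℝ := max (l.m2 - l.lam2 / R.mu22) 0

/-! ### Fluid-scaled processes -/

/-- The fluid-scaled three-dimensional state `(Q₁, Q₂, Z₁₂) / n`. -/
def scaled (n : ℕ) (x : State) : Fin 3 → ℝ :=
  ![(x.q1 : ℝ) / n, (x.q2 : ℝ) / n, (x.z12 : ℝ) / n]

/-- The indicators `1{D₁₂(s) > 0}` and `1{D₁₂(s) ≤ 0}` along a path `p` of the chain. -/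
def indPos (R : Rates) (S : Scale) (p : ℝ≥0 → State) (s : ℝ≥0) : ℝ :=
  if 0 < diff12 R S (p s) then 1 else 0

def indNonpos (R : Rates) (S : Scale) (p : ℝ≥0 → State) (s : ℝ≥0) : ℝ :=
  if diff12 R S (p s) ≤ 0 then 1 else 0

/-- The right-hand side of the simplified integral representation. The initial value and the indicators
come from the path `p` of the chain; the function `y = (y₀, y₁, y₂)` stands under the integrals in the
place of `(Q₁, Q₂, Z₁₂) / n`. -/
def integralMap (R : Rates) (S : Scale) (n : ℕ) (p : ℝ≥0 → State) (y : ℝ≥0 → Fin 3 → ℝ)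
    (t : ℝ≥0) : Fin 3 → ℝ :=
  ![scaled n (p 0) 0 + S.lam1 / n * t - R.mu11 * (S.m1 / n) * t
      - R.mu12 * (∫ s in (0 : ℝ)..t, indPos R S p s.toNNReal * y s.toNNReal 2)
      - R.mu22 * (∫ s in (0 : ℝ)..t, indPos R S p s.toNNReal * (S.m2 / n - y s.toNNReal 2))
      - R.theta1 * ∫ s in (0 : ℝ)..t, y s.toNNReal 0,
    scaled n (p 0) 1 + S.lam2 / n * t
      - R.mu22 * (∫ s in (0 : ℝ)..t, indNonpos R S p s.toNNReal * (S.m2 / n - y s.toNNReal 2))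
      - R.mu12 * (∫ s in (0 : ℝ)..t, indNonpos R S p s.toNNReal * y s.toNNReal 2)
      - R.theta2 * ∫ s in (0 : ℝ)..t, y s.toNNReal 1,
    scaled n (p 0) 2
      + R.mu22 * (∫ s in (0 : ℝ)..t, indPos R S p s.toNNReal * (S.m2 / n - y s.toNNReal 2))
      - R.mu12 * ∫ s in (0 : ℝ)..t, indNonpos R S p s.toNNReal * y s.toNNReal 2]

/-- `y` solves on `[0, τ]` the system of integral equations in which `y` itself stands under the
integrals. -/
def SolvesOn (R : Rates) (S : Scale) (n : ℕ) (p : ℝ≥0 → State) (τ : ℝ≥0)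
    (y : ℝ≥0 → Fin 3 → ℝ) : Prop :=
  ContinuousOn y (Icc 0 τ) ∧ ∀ t ∈ Icc 0 τ, y t = integralMap R S n p y t

/-- The Skorohod `J₁` distance on `[0, τ]`: the infimum over the increasing homeomorphisms `e` of `[0, τ]`
of `max (sup |e t - t|) (sup ‖x (e t) - y t‖)`. -/
def dJ1 (τ : ℝ≥0) (x y : ℝ≥0 → Fin 3 → ℝ) : ℝ≥0∞ :=
  ⨅ e : Icc (0 : ℝ≥0) τ ≃o Icc (0 : ℝ≥0) τ,
    max (⨆ t : Icc (0 : ℝ≥0) τ, edist (e t) t) (⨆ t : Icc (0 : ℝ≥0) τ, edist (x (e t)) (y t))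

/-- The first time `t > 0` at which `Z₂₁ > 0`, `Q₁ = 0` or `Q₂ = 0`. -/
def exitTime (p : ℝ≥0 → State) : ℝ≥0∞ :=
  sInf {a | ∃ t : ℝ≥0, 0 < t ∧ (0 < (p t).z21 ∨ (p t).q1 = 0 ∨ (p t).q2 = 0) ∧ a = (t : ℝ≥0∞)}

section Sequences

variable {Ω : ℕ → Type*} [mΩ : ∀ n, MeasurableSpace (Ω n)]

/-- `d_J1(Yⁿ, Wⁿ) → 0` in probability on `[0, τ]`. -/
def TendstoJ1 (P : ∀ n, Measure (Ω n)) (τ : ℝ≥0) (Y W : ∀ n, ℝ≥0 → Ω n → Fin 3 → ℝ) : Prop :=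
  ∀ ε : ℝ, 0 < ε → Tendsto (fun n ↦
    P n {ω | ENNReal.ofReal ε ≤ dJ1 τ (fun t ↦ Y n t ω) (fun t ↦ W n t ω)}) atTop (𝓝 0)

/-- `sup_{t ≤ τ} Z₂₁ⁿ(t) → 0` in probability (no scaling). -/
def NoOppositeSharing (P : ∀ n, Measure (Ω n)) (X : ∀ n, ℝ≥0 → Ω n → State) (τ : ℝ≥0) : Prop :=
  ∀ ε : ℝ, 0 < ε → Tendsto (fun n ↦
    P n {ω | ENNReal.ofReal ε ≤ ⨆ t ∈ Icc 0 τ, ((X n t ω).z21 : ℝ≥0∞)}) atTop (𝓝 0)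

/-- `P(T₀ⁿ > τ) → 1`: up to time `τ` there is no sharing in the opposite direction, and both queues stay
positive, with probability tending to one. -/
def ExitsAfter (P : ∀ n, Measure (Ω n)) (X : ∀ n, ℝ≥0 → Ω n → State) (τ : ℝ≥0) : Prop :=
  Tendsto (fun n ↦ P n {ω | (τ : ℝ≥0∞) < exitTime (fun t ↦ X n t ω)}) atTop (𝓝 1)

/-- On `[0, τ]` the fluid-scaled process `(Q₁, Q₂, Z₁₂) / n` is asymptotically equivalent to the
simplified integral representation, both when the scaled process itself stands under the integrals and
when the representation is read as a system of integral equations; that system is solvable. -/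
def AsymptoticallyEquivalent (R : Rates) (S : ℕ → Scale) (P : ∀ n, Measure (Ω n))
    (X : ∀ n, ℝ≥0 → Ω n → State) (τ : ℝ≥0) : Prop :=
  TendstoJ1 P τ (fun n t ω ↦ scaled n (X n t ω))
    (fun n t ω ↦ integralMap R (S n) n (fun s ↦ X n s ω) (fun s ↦ scaled n (X n s ω)) t) ∧
  (∀ n, 1 ≤ n → ∀ ω, ∃ y, SolvesOn R (S n) n (fun s ↦ X n s ω) τ y) ∧
  ∀ Y : ∀ n, ℝ≥0 → Ω n → Fin 3 → ℝ,
    (∀ n, 1 ≤ n → ∀ᵐ ω ∂(P n), SolvesOn R (S n) n (fun s ↦ X n s ω) τ (fun t ↦ Y n t ω)) →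
    TendstoJ1 P τ (fun n t ω ↦ scaled n (X n t ω)) Y

end Sequences

end XModel

end

/-! Call a state good if `Z₂₁ = 0` and both queues are positive. In good states both pools are full,
and `(Q₁, Q₂, Z₁₂)` has exactly the drift of the integral representation. The remainder is a
martingale with quadratic variation of order `n`, so it is uniformly `o(n)`. Hence on `{T₀ⁿ > τ}`
the scaled chain is uniformly close to the representation with the chain itself under the integrals.
The integrand is Lipschitz in the fluid variable, uniformly over the values of the indicators, and
the indicators are those of the same path on both sides; so Grönwall's inequality carries the
closeness over to the solutions of the system, and no averaging is needed. This is part 2,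
`Regime.asymptoticallyEquivalent`.

The martingale problem is given only for finitely supported functions, so functions are first cut
off at a total queue of order `n` (`trunc`). The second moment formula `IsChain.integral_comp_sq`
and `maximal_inequality` bound the compensated process. Applied to a constant, the cut-off function
bounds the total queue (`Regime.exists_containment`); applied to the coordinates, it yields
`Regime.vanishing_comp_coord`.

For part 1 a `τ > 0` with `P(T₀ⁿ > τ) → 1` is needed. Let `T ≤ τ` be the first time in a state that
is not good. For small `τ` the fluid state stays near `x(0)` up to `T`. If `Q₁ > r₁₂ Q₂` before `T`,
then `D₂₁ < 0` because `r₂₁ ≤ r₁₂`, and `Z₂₁` cannot jump at `T`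
(`IsChain.measure_z21_pos_eq_zero`). So it suffices that `Q₁ > r₁₂ Q₂` up to `T` and `Q₂(T) > 0`
(`Regime.exists_exitsAfter`).

Both come from `excursion_bound`: a process with nonnegative drift below a level falls under it by
no more than its fluctuations. These are bounded by a small multiple of `cₙ`, much larger than `√n`,
while thresholds and initial queues are at least of order `cₙ`. In `𝕊⁺` the order of the queues is
clear on the fluid scale. On `q₁ = r₁₂ q₂` one has `δ₋ > 0`, which pushes `D₁₂` up whenever it is
not positive. If `q₂(0) = 0`, queue 2 survives because it grows at a rate near `λ₂ n` whenever `D₁₂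
> 0`; on the boundary, growth of the total queue makes `D₁₂ > 0` whenever `Q₂` is too small. -/

noncomputable section

namespace XModel

section

/-! ### Step paths and right-continuous functions -/

/-- A path that is right-continuous with left limits for the discrete topology. -/
structure IsStepPath {α : Type*} (q : ℝ → α) : Prop where
  right : ∀ s, ∀ᶠ u in 𝓝[>] s, q u = q s
  left : ∀ s, ∃ x, ∀ᶠ u in 𝓝[<] s, q u = x

lemma IsStepPath.comp {α β : Type*} {q : ℝ → α} (h : IsStepPath q) (g : α → β) :
    IsStepPath (fun s ↦ g (q s)) where
  right s := (h.right s).mono fun u hu ↦ by rw [hu]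
  left s := by
    obtain ⟨x, hx⟩ := h.left s
    exact ⟨g x, hx.mono fun u hu ↦ by rw [hu]⟩

/-- Near each point the path takes at most two values, the left limit and the current value;
compactness does the rest. -/
lemma IsStepPath.finite_image {α : Type*} {q : ℝ → α} (h : IsStepPath q) (a b : ℝ) :
    (q '' Icc a b).Finite := by
  refine isCompact_Icc.induction_on (p := fun s ↦ (q '' s).Finite) (by simp)
    (fun s t hst ht ↦ ht.subset (image_mono hst))
    (fun s t hs ht ↦ by rw [image_union]; exact hs.union ht) fun s _ ↦ ?_
  obtain ⟨x, hx⟩ := h.left s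
  have h1 := eventually_nhdsWithin_iff.1 (h.right s)
  have h2 := eventually_nhdsWithin_iff.1 hx
  refine ⟨{u | (u ∈ Ioi s → q u = q s) ∧ (u ∈ Iio s → q u = x)},
    mem_nhdsWithin_of_mem_nhds (h1.and h2), (Set.toFinite {q s, x}).subset ?_⟩
  rintro _ ⟨u, ⟨hu1, hu2⟩, rfl⟩
  rcases lt_trichotomy u s with hu | rfl | hu
  · simp [hu2 hu]
  · simp
  · simp [hu1 hu]

/-- The `+ 1` puts the grid point strictly to the right of `s`, where right-continuity controls the
path. -/
lemma tendsto_floor_add_one_div {a : ℕ → ℝ} (ha : ∀ k, 0 < a k) (hlim : Tendsto a atTop atTop)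
    (s : ℝ) : Tendsto (fun k ↦ ((⌊a k * s⌋ : ℝ) + 1) / a k) atTop (𝓝[>] s) := by
  have hlt : ∀ k, s < ((⌊a k * s⌋ : ℝ) + 1) / a k := fun k ↦ by
    have := Int.lt_floor_add_one (a k * s)
    rw [lt_div_iff₀ (ha k)]; linarith
  rw [tendsto_nhdsWithin_iff]
  refine ⟨?_, Eventually.of_forall hlt⟩
  have h3 : Tendsto (fun k ↦ s + (a k)⁻¹) atTop (𝓝 (s + 0)) :=
    tendsto_const_nhds.add (tendsto_inv_atTop_zero.comp hlim)
  rw [add_zero] at h3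
  refine tendsto_of_tendsto_of_tendsto_of_le_of_le tendsto_const_nhds h3 (fun k ↦ (hlt k).le) ?_
  intro k
  have hk := ha k
  have := Int.floor_le (a k * s)
  have h4 : s + (a k)⁻¹ = (a k * s + 1) / a k := by field_simp
  show _ ≤ s + (a k)⁻¹
  rw [h4]
  exact div_le_div_of_nonneg_right (by linarith) hk.le

/-- A process with right-continuous paths is jointly measurable. -/
lemma measurable_uncurry_of_right {Ω : Type*} [MeasurableSpace Ω] {u : ℝ → Ω → ℝ}
    (hm : ∀ s, Measurable (u s))
    (hr : ∀ ω s, ContinuousWithinAt (fun r ↦ u r ω) (Ioi s) s) :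
    Measurable (fun z : ℝ × Ω ↦ u z.1 z.2) := by
  have key : ∀ k : ℕ, Measurable
      (fun z : ℝ × Ω ↦ u (((⌊((k : ℝ) + 1) * z.1⌋ : ℝ) + 1) / ((k : ℝ) + 1)) z.2) := by
    intro k
    have h1 : Measurable (fun w : ℤ × Ω ↦ u (((w.1 : ℝ) + 1) / ((k : ℝ) + 1)) w.2) :=
      measurable_from_prod_countable_right
        fun j ↦ hm (((j : ℝ) + 1) / ((k : ℝ) + 1))
    have h2 : Measurable (fun z : ℝ × Ω ↦ ((⌊((k : ℝ) + 1) * z.1⌋ : ℤ), z.2)) := by fun_prop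
    exact h1.comp h2
  refine measurable_of_tendsto_metrizable key ?_
  rw [tendsto_pi_nhds]
  rintro ⟨s, ω⟩
  exact (hr ω s).tendsto.comp (tendsto_floor_add_one_div (a := fun k : ℕ ↦ (k : ℝ) + 1)
    (fun k ↦ by positivity)
    (tendsto_atTop_add_const_right _ _ tendsto_natCast_atTop_atTop) s)

/-- Measurable, locally bounded, right-continuous functions. -/
structure RightRegular (f : ℝ → ℝ) : Prop where
  meas : Measurable f
  bdd : ∀ a b, ∃ C, ∀ x ∈ Icc a b, |f x| ≤ C
  right : ∀ x, ContinuousWithinAt f (Ioi x) x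

namespace RightRegular

lemma of_continuous {f : ℝ → ℝ} (h : Continuous f) : RightRegular f where
  meas := h.measurable
  bdd _ _ := isCompact_Icc.exists_bound_of_continuousOn h.continuousOn
  right _ := h.continuousWithinAt

lemma const (c : ℝ) : RightRegular (fun _ ↦ c) := of_continuous continuous_const

lemma of_step {f : ℝ → ℝ} (h : IsStepPath f) : RightRegular f where
  meas := by
    have := measurable_uncurry_of_right (Ω := Unit) (u := fun s _ ↦ f s)
      (fun _ ↦ measurable_const)
      (fun _ x ↦ tendsto_const_nhds.congr' ((h.right x).mono fun u hu ↦ hu.symm))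
    exact this.comp (measurable_id.prodMk (measurable_const (a := ())))
  bdd a b := by
    obtain ⟨C, hC⟩ := ((h.comp fun x ↦ |x|).finite_image a b).bddAbove
    exact ⟨C, fun x hx ↦ hC ⟨x, hx, rfl⟩⟩
  right x := tendsto_const_nhds.congr' ((h.right x).mono fun u hu ↦ hu.symm)

lemma add {f g : ℝ → ℝ} (hf : RightRegular f) (hg : RightRegular g) :
    RightRegular (fun x ↦ f x + g x) where
  meas := hf.meas.add hg.meas
  bdd a b := by
    obtain ⟨C, hC⟩ := hf.bdd a b
    obtain ⟨D, hD⟩ := hg.bdd a b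
    exact ⟨C + D, fun x hx ↦ (abs_add_le _ _).trans (add_le_add (hC x hx) (hD x hx))⟩
  right x := (hf.right x).add (hg.right x)

lemma mul {f g : ℝ → ℝ} (hf : RightRegular f) (hg : RightRegular g) :
    RightRegular (fun x ↦ f x * g x) where
  meas := hf.meas.mul hg.meas
  bdd a b := by
    obtain ⟨C, hC⟩ := hf.bdd a b
    obtain ⟨D, hD⟩ := hg.bdd a b
    refine ⟨C * D, fun x hx ↦ ?_⟩
    rw [abs_mul]
    exact mul_le_mul (hC x hx) (hD x hx) (abs_nonneg _) ((abs_nonneg _).trans (hC x hx))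
  right x := (hf.right x).mul (hg.right x)

lemma neg {f : ℝ → ℝ} (hf : RightRegular f) : RightRegular (fun x ↦ -f x) := by
  simpa using (const (-1)).mul hf

lemma sub {f g : ℝ → ℝ} (hf : RightRegular f) (hg : RightRegular g) :
    RightRegular (fun x ↦ f x - g x) := by
  simpa [sub_eq_add_neg] using hf.add hg.neg

lemma intervalIntegrable {f : ℝ → ℝ} (hf : RightRegular f) (a b : ℝ) :
    IntervalIntegrable f volume a b := by
  rw [intervalIntegrable_iff]
  obtain ⟨C, hC⟩ := hf.bdd (min a b) (max a b)
  refine Measure.integrableOn_of_bounded (M := C) (by simp) hf.meas.aestronglyMeasurable ?_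
  refine (ae_restrict_iff' measurableSet_uIoc).2 (Eventually.of_forall fun x hx ↦ ?_)
  exact hC x (Ioc_subset_Icc_self hx)

/-- At a jump only the right derivative exists. It is enough for the fundamental theorem of
calculus, which is applied below with right derivatives. -/
lemma hasDerivWithinAt {f : ℝ → ℝ} (hf : RightRegular f) (a x : ℝ) :
    HasDerivWithinAt (fun u ↦ ∫ s in a..u, f s) (f x) (Ici x) x :=
  intervalIntegral.integral_hasDerivWithinAt_right (hf.intervalIntegrable a x)
    hf.meas.stronglyMeasurable.stronglyMeasurableAtFilter (hf.right x)

lemma continuous_integral {f : ℝ → ℝ} (hf : RightRegular f) (a : ℝ) :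
    Continuous (fun u ↦ ∫ s in a..u, f s) :=
  intervalIntegral.continuous_primitive hf.intervalIntegrable a

/-- `∫₀ᵗ f(s) (∫₀ˢ f) ds = (∫₀ᵗ f)² / 2`. -/
lemma integral_mul_primitive {f : ℝ → ℝ} (hf : RightRegular f) (t : ℝ) :
    ∫ s in (0 : ℝ)..t, (∫ u in (0 : ℝ)..s, f u) * f s = (∫ s in (0 : ℝ)..t, f s) ^ 2 / 2 := by
  have hc := hf.continuous_integral 0
  have h := intervalIntegral.integral_eq_sub_of_hasDeriv_right (a := 0) (b := t)
    (f := fun s ↦ (∫ u in (0 : ℝ)..s, f u) ^ 2 / 2)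
    (f' := fun s ↦ (∫ u in (0 : ℝ)..s, f u) * f s) (by fun_prop) ?_
    (((of_continuous hc).mul hf).intervalIntegrable 0 t)
  · rw [h]; simp
  · intro x _
    have := (((hf.hasDerivWithinAt 0 x).mono Ioi_subset_Ici_self).pow 2).div_const 2
    convert! this using 1
    simp; ring

/-- Scalar linear equations with right-continuous coefficients are solvable. -/
lemma exists_linear_solution {a b : ℝ → ℝ} (ha : RightRegular a) (hb : RightRegular b) (y₀ : ℝ) :
    ∃ y : ℝ → ℝ, Continuous y ∧ ∀ t, y t = y₀ + ∫ s in (0 : ℝ)..t, (b s - a s * y s) := by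
  set A : ℝ → ℝ := fun t ↦ ∫ s in (0 : ℝ)..t, a s with hA
  have hAc : Continuous A := ha.continuous_integral 0
  have hexp : RightRegular (fun s ↦ Real.exp (A s) * b s) :=
    (of_continuous (Real.continuous_exp.comp hAc)).mul hb
  set I : ℝ → ℝ := fun t ↦ ∫ s in (0 : ℝ)..t, Real.exp (A s) * b s with hI
  have hIc : Continuous I := hexp.continuous_integral 0
  have hyc : Continuous (fun t ↦ Real.exp (-A t) * (y₀ + I t)) := by fun_prop
  refine ⟨fun t ↦ Real.exp (-A t) * (y₀ + I t), hyc, fun t ↦ ?_⟩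
  have h := intervalIntegral.integral_eq_sub_of_hasDeriv_right (a := 0) (b := t)
    (f := fun t ↦ Real.exp (-A t) * (y₀ + I t))
    (f' := fun s ↦ b s - a s * (Real.exp (-A s) * (y₀ + I s))) hyc.continuousOn ?_
    ((hb.sub (ha.mul (of_continuous hyc))).intervalIntegrable 0 t)
  · rw [h]; simp [hA, hI]
  · intro x _
    have h1 := ((ha.hasDerivWithinAt 0 x).mono Ioi_subset_Ici_self).neg.exp
    have h2 := ((hexp.hasDerivWithinAt 0 x).mono Ioi_subset_Ici_self).const_add y₀
    convert! h1.mul h2 using 1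
    have : Real.exp (-A x) * (Real.exp (A x) * b x) = b x := by
      rw [← mul_assoc, ← Real.exp_add]; simp
    simp only [Pi.neg_apply]
    rw [this]
    ring

end RightRegular

/-! ### Two deterministic path inequalities -/

/-- Grönwall's inequality in integral form. -/
lemma gronwall_integral {u : ℝ → ℝ} (hu : Continuous u) {C ε T : ℝ} (hC : 0 < C) (hε : 0 ≤ ε)
    (h : ∀ t ∈ Icc 0 T, u t ≤ ∫ s in (0 : ℝ)..t, C * (ε + u s)) :
    ∀ t ∈ Icc 0 T, u t ≤ ε * Real.exp (C * T) := by
  intro t ht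
  have hd : ∀ x, HasDerivAt (fun t ↦ ∫ s in (0 : ℝ)..t, C * (ε + u s)) (C * (ε + u x)) x :=
    fun x ↦ ((by fun_prop : Continuous fun s ↦ C * (ε + u s))).integral_hasStrictDerivAt 0 x
      |>.hasDerivAt
  -- The differential inequality is used for the right-hand side of `h`, which is differentiable
  -- although `u` is only continuous. It gives the bound `ε (exp (C t) - 1)`.
  have h1 := le_gronwallBound_of_liminf_deriv_right_le (a := 0) (b := T) (δ := 0) (K := C)
    (ε := C * ε) (f := fun t ↦ ∫ s in (0 : ℝ)..t, C * (ε + u s)) (f' := fun x ↦ C * (ε + u x))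
    (fun x _ ↦ (hd x).continuousAt.continuousWithinAt)
    (fun x _ r hr ↦ (hd x).hasDerivWithinAt.liminf_right_slope_le hr) (by simp)
    (fun x hx ↦ by nlinarith [h x ⟨hx.1, hx.2.le⟩]) t ht
  have h2 := (h t ht).trans h1
  rw [gronwallBound_of_K_ne_0 hC.ne', mul_div_cancel_left₀ _ hC.ne', sub_zero] at h2
  have h3 : Real.exp (C * t) ≤ Real.exp (C * T) := by
    apply Real.exp_le_exp.2
    nlinarith [ht.2]
  simp only [zero_mul, zero_add] at h2
  nlinarith

lemma integral_nonneg_of_Ioo {b : ℝ → ℝ} {x y : ℝ} (hxy : x ≤ y) (h : ∀ s ∈ Ioo x y, 0 ≤ b s) :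
    0 ≤ ∫ s in x..y, b s := by
  rw [intervalIntegral.integral_of_le hxy, integral_Ioc_eq_integral_Ioo]
  exact setIntegral_nonneg measurableSet_Ioo h

/-- If `g` moves, up to an error `ε`, with a drift that is nonnegative as long as `g < 0`, then `g` does
not fall much below its initial value and zero. -/
lemma excursion_bound {g b : ℝ → ℝ} {T ε c : ℝ} (hb : ∀ x y, IntervalIntegrable b volume x y)
    (hg : ∀ t ∈ Icc 0 T, |g t - g 0 - ∫ s in (0 : ℝ)..t, b s| ≤ ε)
    (hsign : ∀ s ∈ Ico 0 T, g s < 0 → 0 ≤ b s) (hc : 0 ≤ c) (h0 : -c ≤ g 0) :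
    ∀ t ∈ Icc 0 T, -c - 2 * ε ≤ g t := by
  intro t ht
  have hε : 0 ≤ ε := (abs_nonneg _).trans (hg t ht)
  by_cases hgt : 0 ≤ g t
  · linarith
  set S : Set ℝ := {s | s ∈ Icc 0 t ∧ 0 ≤ g s} with hS
  have hneg : ∀ s ∈ Icc 0 t, s ∉ S → g s < 0 := fun s hs hsS ↦ by
    by_contra hcon
    exact hsS ⟨hs, not_lt.1 hcon⟩
  rcases S.eq_empty_or_nonempty with hemp | hne
  · have hpos : 0 ≤ ∫ s in (0 : ℝ)..t, b s :=
      integral_nonneg_of_Ioo ht.1 fun s hs ↦ hsign s ⟨hs.1.le, hs.2.trans_le ht.2⟩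
        (hneg s ⟨hs.1.le, hs.2.le⟩ (by simp [hemp]))
    have := abs_le.1 (hg t ht)
    linarith
  · have hbdd : BddAbove S := ⟨t, fun s hs ↦ hs.1.2⟩
    obtain ⟨s₀, hs₀⟩ := hne
    have hσ0 : 0 ≤ sSup S := hs₀.1.1.trans (le_csSup hbdd hs₀)
    have hσt : sSup S ≤ t := csSup_le ⟨s₀, hs₀⟩ fun s hs ↦ hs.1.2
    have hpos : 0 ≤ ∫ s in (sSup S)..t, b s := by
      refine integral_nonneg_of_Ioo hσt fun s hs ↦ hsign s ⟨hσ0.trans hs.1.le,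
        hs.2.trans_le ht.2⟩ (hneg s ⟨hσ0.trans hs.1.le, hs.2.le⟩ fun hsS ↦ ?_)
      exact absurd (le_csSup hbdd hsS) (not_le.2 hs.1)
    have hcont : Continuous fun u ↦ ∫ s in (sSup S)..u, b s :=
      intervalIntegral.continuous_primitive hb _
    -- As `g` may jump, the supremum of `S` need not lie in `S`. The comparison is made with a point
    -- of `S` close to it, at the cost `δ`. The error `ε` enters twice, at that point and at `t`.
    have hclose : ∀ δ > 0, -2 * ε ≤ g t + δ := by
      intro δ hδ
      have hnhds : {u | (∫ s in (sSup S)..u, b s) < δ} ∈ 𝓝 (sSup S) :=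
        (isOpen_lt hcont continuous_const).mem_nhds (by simpa using hδ)
      obtain ⟨s, hs1, hs2⟩ := mem_closure_iff_nhds.1 (csSup_mem_closure ⟨s₀, hs₀⟩ hbdd) _ hnhds
      have e1 := abs_le.1 (hg t ht)
      have e2 := abs_le.1 (hg s ⟨hs2.1.1, hs2.1.2.trans ht.2⟩)
      have e3 := intervalIntegral.integral_add_adjacent_intervals (hb 0 (sSup S)) (hb (sSup S) t)
      have e4 := intervalIntegral.integral_add_adjacent_intervals (hb 0 (sSup S)) (hb (sSup S) s)
      have e5 := hs2.2
      have hs3 : (∫ s in (sSup S)..s, b s) < δ := hs1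
      linarith [e1.1, e2.2]
    have := le_of_forall_pos_le_add hclose
    linarith

end

section

/-! ### The generator as a sum over transitions -/

/-- The rates of the eight transitions out of `x`. -/
def rate (R : Rates) (S : Scale) (x : State) : Fin 8 → ℝ :=
  ![S.lam1, S.lam2, R.theta1 * x.q1, R.theta2 * x.q2, R.mu11 * x.z11, R.mu21 * x.z21,
    R.mu12 * x.z12, R.mu22 * x.z22]

/-- The targets of the eight transitions out of `x`. -/
def target (R : Rates) (S : Scale) (x : State) : Fin 8 → State :=
  ![arrive1 S x, arrive2 S x, { x with q1 := x.q1 - 1 }, { x with q2 := x.q2 - 1 },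
    assign1 R S x { x with z11 := x.z11 - 1 }, assign1 R S x { x with z21 := x.z21 - 1 },
    assign2 R S x { x with z12 := x.z12 - 1 }, assign2 R S x { x with z22 := x.z22 - 1 }]

variable {R : Rates} {S : Scale}

lemma generator_eq_sum (f : State → ℝ) (x : State) :
    generator R S f x = ∑ i, rate R S x i * (f (target R S x i) - f x) := by
  simp [Fin.sum_univ_eight, generator, rate, target]

lemma le_queue_target (x : State) (i : Fin 8) :
    x.q1 + x.q2 ≤ (target R S x i).q1 + (target R S x i).q2 + 1 := by
  fin_cases i <;> simp [target, arrive1, arrive2, assign1, assign2] <;>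
    (try split_ifs) <;> (try dsimp only) <;> omega

lemma queue_target_le (x : State) (i : Fin 8) :
    (target R S x i).q1 + (target R S x i).q2 ≤ x.q1 + x.q2 + 1 := by
  fin_cases i <;> simp [target, arrive1, arrive2, assign1, assign2] <;>
    (try split_ifs) <;> (try dsimp only) <;> omega

/-- No pool has more busy servers than it has servers. -/
def InBox (S : Scale) (x : State) : Prop := x.z11 + x.z21 ≤ S.m1 ∧ x.z12 + x.z22 ≤ S.m2

/-- A rate of zero must be excluded: with `z11 = 0` the truncated subtraction removes nobody, and
the assignment that follows could overfill the pool. -/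
lemma inBox_target {x : State} (hx : InBox S x) (i : Fin 8) (hi : rate R S x i ≠ 0) :
    InBox S (target R S x i) := by
  obtain ⟨h1, h2⟩ := hx
  fin_cases i <;> simp [target, arrive1, arrive2, assign1, assign2, InBox, rate] at hi ⊢ <;>
    (try split_ifs) <;> (try dsimp only) <;> omega

/-- The carré du champ operator of the chain. -/
def gamma (R : Rates) (S : Scale) (f : State → ℝ) (x : State) : ℝ :=
  generator R S (fun y ↦ f y ^ 2) x - 2 * f x * generator R S f x

/-- Termwise this is `(b² - a²) - 2a(b - a) = (b - a)²`. -/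
lemma gamma_eq_sum (f : State → ℝ) (x : State) :
    gamma R S f x = ∑ i, rate R S x i * (f (target R S x i) - f x) ^ 2 := by
  rw [gamma, generator_eq_sum, generator_eq_sum, Finset.mul_sum, ← Finset.sum_sub_distrib]
  exact Finset.sum_congr rfl fun i _ ↦ by ring

lemma finite_inBox (S : Scale) (N : ℕ) : {x : State | InBox S x ∧ x.q1 + x.q2 ≤ N}.Finite := by
  let e : State → ℕ × ℕ × ℕ × ℕ × ℕ × ℕ := fun x ↦ (x.q1, x.q2, x.z11, x.z12, x.z21, x.z22)
  have he : Function.Injective e := fun x y hxy ↦ by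
    simp only [e, Prod.mk.injEq] at hxy
    ext <;> simp [hxy]
  refine Set.Finite.of_finite_image (f := e) (Set.Finite.subset (Set.finite_Iic
    ((N, N, S.m1, S.m2, S.m1, S.m2) : ℕ × ℕ × ℕ × ℕ × ℕ × ℕ)) ?_) he.injOn
  rintro _ ⟨x, ⟨⟨h1, h2⟩, h3⟩, rfl⟩
  simp only [e, mem_Iic, Prod.mk_le_mk]
  omega

lemma inBox_of_mem {x : State} (hx : x ∈ stateSpace S) : InBox S x := ⟨hx.1, hx.2.1⟩

/-- The generator maps finitely supported functions to functions that are bounded on the state space. -/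
lemma exists_generator_bound {f : State → ℝ} (hf : (Function.support f).Finite) :
    ∃ C, ∀ x ∈ stateSpace S, |generator R S f x| ≤ C := by
  obtain ⟨N, hN⟩ := (hf.image fun x ↦ x.q1 + x.q2).bddAbove
  have h0 : ∀ x : State, N < x.q1 + x.q2 → f x = 0 := fun x hx ↦ by
    by_contra hne
    exact absurd (hN ⟨x, hne, rfl⟩) (not_le.2 hx)
  obtain ⟨C, hC⟩ := ((finite_inBox S (N + 1)).image fun x ↦ |generator R S f x|).bddAbove
  refine ⟨max C 0, fun x hx ↦ ?_⟩
  by_cases hq : x.q1 + x.q2 ≤ N + 1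
  · exact (hC ⟨x, ⟨inBox_of_mem hx, hq⟩, rfl⟩).trans (le_max_left _ _)
  · rw [generator_eq_sum, Finset.sum_eq_zero, abs_zero]
    · exact le_max_right _ _
    intro i _
    have := le_queue_target (R := R) (S := S) x i
    rw [h0 _ (by omega), h0 _ (by omega)]
    simp

/-! ### Truncation -/

/-- The distance of the total queue length to the level `N`, or zero above that level. -/
def room (N : ℕ) (x : State) : ℝ := max 0 ((N : ℝ) - x.q1 - x.q2)

open Classical in
/-- The function `f`, cut off at `± room N`, inside the box. -/
def trunc (S : Scale) (N : ℕ) (f : State → ℝ) (x : State) : ℝ :=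
  if InBox S x then max (-room N x) (min (f x) (room N x)) else 0

lemma room_nonneg (N : ℕ) (x : State) : 0 ≤ room N x := le_max_left _ _

lemma room_eq_zero {N : ℕ} {x : State} (h : N ≤ x.q1 + x.q2) : room N x = 0 := by
  have : (N : ℝ) ≤ x.q1 + x.q2 := by exact_mod_cast h
  exact max_eq_left (by linarith)

lemma trunc_eq_zero {N : ℕ} {x : State} (f : State → ℝ) (h : N ≤ x.q1 + x.q2) :
    trunc S N f x = 0 := by
  simp [trunc, room_eq_zero h]

lemma trunc_eq {N : ℕ} {x : State} {f : State → ℝ} (hx : InBox S x) (h : |f x| ≤ room N x) :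
    trunc S N f x = f x := by
  have := abs_le.1 h
  rw [trunc, if_pos hx, min_eq_left this.2, max_eq_right this.1]

lemma finite_support_trunc (S : Scale) (N : ℕ) (f : State → ℝ) :
    (Function.support (trunc S N f)).Finite := by
  refine (finite_inBox S N).subset fun x hx ↦ ?_
  by_contra hcon
  apply hx
  by_cases hb : InBox S x
  · exact trunc_eq_zero f (by by_contra h; exact hcon ⟨hb, by omega⟩)
  · simp [trunc, hb]

lemma abs_room_sub_le (N : ℕ) (x : State) (i : Fin 8) :
    |room N (target R S x i) - room N x| ≤ 1 := by
  have h1 : (x.q1 + x.q2 : ℝ) ≤ (target R S x i).q1 + (target R S x i).q2 + 1 := by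
    exact_mod_cast le_queue_target x i
  have h2 : ((target R S x i).q1 + (target R S x i).q2 : ℝ) ≤ x.q1 + x.q2 + 1 := by
    exact_mod_cast queue_target_le x i
  unfold room
  refine (abs_max_sub_max_le_max _ _ _ _).trans (max_le (by simp) ?_)
  rw [abs_le]
  constructor <;> linarith

/-- Clipping is nonexpansive in the function and in the clipping level, measured by the larger of
the two changes. Both change by at most one, so the cut-off creates no large jump at the edge of its
support. -/
lemma abs_trunc_sub_le {f : State → ℝ} {x : State} (N : ℕ) (hx : InBox S x) (i : Fin 8)
    (hi : rate R S x i ≠ 0) (hf : |f (target R S x i) - f x| ≤ 1) :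
    |trunc S N f (target R S x i) - trunc S N f x| ≤ 1 := by
  have hr := abs_room_sub_le (R := R) (S := S) N x i
  rw [trunc, trunc, if_pos hx, if_pos (inBox_target hx i hi)]
  refine (abs_max_sub_max_le_max _ _ _ _).trans (max_le ?_ ?_)
  · rw [← abs_neg]; convert! hr using 2; ring
  · exact (abs_min_sub_min_le_max _ _ _ _).trans (max_le hf hr)

/-- Bound of the total transition rate where the total queue length is at most `N`. -/
def rateBound (R : Rates) (S : Scale) (N : ℕ) : ℝ :=
  S.lam1 + S.lam2 + (R.theta1 + R.theta2) * N + (R.mu11 + R.mu21) * S.m1 + (R.mu12 + R.mu22) * S.m2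

/-- Positive rates. -/
structure Rates.Pos (R : Rates) : Prop where
  mu11 : 0 < R.mu11
  mu12 : 0 < R.mu12
  mu21 : 0 < R.mu21
  mu22 : 0 < R.mu22
  theta1 : 0 < R.theta1
  theta2 : 0 < R.theta2

lemma rate_nonneg (hR : R.Pos) (h1 : 0 ≤ S.lam1) (h2 : 0 ≤ S.lam2) (x : State) (i : Fin 8) :
    0 ≤ rate R S x i := by
  have := hR.mu11.le
  have := hR.mu12.le
  have := hR.mu21.le
  have := hR.mu22.le
  have := hR.theta1.le
  have := hR.theta2.le
  fin_cases i <;> simp [rate] <;> first | assumption | positivity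

lemma sum_rate_le (hR : R.Pos) {x : State} (hx : InBox S x) {N : ℕ}
    (hN : x.q1 + x.q2 ≤ N) : ∑ i, rate R S x i ≤ rateBound R S N := by
  have a1 : (x.q1 : ℝ) ≤ N := by exact_mod_cast (by omega : x.q1 ≤ N)
  have a2 : (x.q2 : ℝ) ≤ N := by exact_mod_cast (by omega : x.q2 ≤ N)
  have a3 : (x.z11 : ℝ) ≤ S.m1 := by exact_mod_cast (by have := hx.1; omega : x.z11 ≤ S.m1)
  have a4 : (x.z21 : ℝ) ≤ S.m1 := by exact_mod_cast (by have := hx.1; omega : x.z21 ≤ S.m1)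
  have a5 : (x.z12 : ℝ) ≤ S.m2 := by exact_mod_cast (by have := hx.2; omega : x.z12 ≤ S.m2)
  have a6 : (x.z22 : ℝ) ≤ S.m2 := by exact_mod_cast (by have := hx.2; omega : x.z22 ≤ S.m2)
  simp only [Fin.sum_univ_eight, rate, rateBound]
  simp
  have := mul_le_mul_of_nonneg_left a1 hR.theta1.le
  have := mul_le_mul_of_nonneg_left a2 hR.theta2.le
  have := mul_le_mul_of_nonneg_left a3 hR.mu11.le
  have := mul_le_mul_of_nonneg_left a4 hR.mu21.le
  have := mul_le_mul_of_nonneg_left a5 hR.mu12.le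
  have := mul_le_mul_of_nonneg_left a6 hR.mu22.le
  linarith

lemma rateBound_nonneg (hR : R.Pos) (h1 : 0 ≤ S.lam1) (h2 : 0 ≤ S.lam2) (N : ℕ) :
    0 ≤ rateBound R S N := by
  have := hR.mu11.le
  have := hR.mu12.le
  have := hR.mu21.le
  have := hR.mu22.le
  have := hR.theta1.le
  have := hR.theta2.le
  unfold rateBound
  positivity

/-- All jumps of `f` along transitions of positive rate are at most one. -/
def UnitJumps (R : Rates) (S : Scale) (f : State → ℝ) : Prop :=
  ∀ x, InBox S x → ∀ i, rate R S x i ≠ 0 → |f (target R S x i) - f x| ≤ 1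

/-- Squared jumps are at most one, so the total rate is a bound. Above the level `N + 1` a state and
all its targets lie where the truncation vanishes. -/
lemma gamma_trunc_le (hR : R.Pos) (h1 : 0 ≤ S.lam1) (h2 : 0 ≤ S.lam2) {f : State → ℝ}
    (hf : UnitJumps R S f) (N : ℕ) {x : State} (hx : InBox S x) :
    gamma R S (trunc S N f) x ≤ rateBound R S (N + 1) := by
  rw [gamma_eq_sum]
  by_cases hq : x.q1 + x.q2 ≤ N + 1
  · refine le_trans (Finset.sum_le_sum fun i _ ↦ ?_) (sum_rate_le hR hx hq)
    by_cases hi : rate R S x i = 0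
    · simp [hi]
    · have := (sq_le_one_iff_abs_le_one _).2 (abs_trunc_sub_le N hx i hi (hf x hx i hi))
      exact mul_le_of_le_one_right (rate_nonneg hR h1 h2 x i) this
  · rw [Finset.sum_eq_zero]
    · exact rateBound_nonneg hR h1 h2 _
    intro i _
    have := le_queue_target (R := R) (S := S) x i
    rw [trunc_eq_zero f (by omega), trunc_eq_zero f (by omega)]
    simp

/-- The margin `2` is one for the change of `f` and one for the change of `room`; it keeps the
clipping inactive at `x` and at every target of nonzero rate. -/
lemma generator_trunc_eq {N : ℕ} {f : State → ℝ} (hf : UnitJumps R S f) {x : State}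
    (hx : InBox S x) (h : |f x| + 2 ≤ room N x) :
    generator R S (trunc S N f) x = generator R S f x := by
  rw [generator_eq_sum, generator_eq_sum]
  refine Finset.sum_congr rfl fun i _ ↦ ?_
  by_cases hi : rate R S x i = 0
  · simp [hi]
  rw [trunc_eq hx (by linarith), trunc_eq (inBox_target hx i hi)]
  have h1 := abs_le.1 (abs_room_sub_le (R := R) (S := S) N x i)
  have h2 := abs_sub_abs_le_abs_sub (f (target R S x i)) (f x)
  have h3 := hf x hx i hi
  linarith [h1.1]

/-! ### The fluid coordinates -/

/-- The functions `Q₁ - Z₂₁`, `Q₂ + Z₂₁` and `Z₁₂`. -/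
def coord : Fin 3 → State → ℝ :=
  ![fun x ↦ (x.q1 : ℝ) - x.z21, fun x ↦ (x.q2 : ℝ) + x.z21, fun x ↦ (x.z12 : ℝ)]

lemma unitJumps_coord (j : Fin 3) : UnitJumps R S (coord j) := by
  let c : Fin 3 → State → ℤ :=
    ![fun x ↦ (x.q1 : ℤ) - x.z21, fun x ↦ (x.q2 : ℤ) + x.z21, fun x ↦ (x.z12 : ℤ)]
  have hc : ∀ x, coord j x = (c j x : ℝ) := fun x ↦ by fin_cases j <;> simp [coord, c]
  intro x _ i hi
  rw [hc, hc]
  suffices h : |c j (target R S x i) - c j x| ≤ 1 by exact_mod_cast h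
  rw [abs_le]
  fin_cases j <;> fin_cases i <;>
    simp [target, arrive1, arrive2, assign1, assign2, rate, c] at hi ⊢ <;>
    (try split_ifs) <;> (try dsimp only) <;> omega

/-- States without sharing in the opposite direction in which both queues are positive. -/
def Good (x : State) : Prop := x.z21 = 0 ∧ 0 < x.q1 ∧ 0 < x.q2

/-- The drift of the fluid coordinates in good states. -/
def drift (R : Rates) (S : Scale) (x : State) : Fin 3 → ℝ :=
  ![S.lam1 - R.theta1 * x.q1 - R.mu11 * S.m1
      - (if 0 < diff12 R S x then 1 else 0) * (R.mu12 * x.z12 + R.mu22 * (S.m2 - x.z12)),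
    S.lam2 - R.theta2 * x.q2
      - (if diff12 R S x ≤ 0 then 1 else 0) * (R.mu12 * x.z12 + R.mu22 * (S.m2 - x.z12)),
    (if 0 < diff12 R S x then 1 else 0) * (R.mu22 * (S.m2 - x.z12))
      - (if diff12 R S x ≤ 0 then 1 else 0) * (R.mu12 * x.z12)]

/-- This explains the terms in `Z₂₁`. When a class-1 service in pool 1 ends, the server takes either
a class-1 customer, which lowers `Q₁`, or a class-2 customer, which lowers `Q₂` and raises `Z₂₁`.
The pair `Q₁ - Z₂₁`, `Q₂ + Z₂₁` changes in the same way in both cases, so the drift formula needs no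
condition on `D₂₁`. -/
lemma generator_coord {x : State} (hx : x ∈ stateSpace S) (hg : Good x) (j : Fin 3) :
    generator R S (coord j) x = drift R S x j := by
  obtain ⟨hz, h1, h2⟩ := hg
  have e1 := hx.2.2.1 h1
  have e2 := hx.2.2.2 h2
  have m1 : (S.m1 : ℝ) = x.z11 := by rw [← e1, hz]; simp
  have m2 : (S.m2 : ℝ) = x.z12 + x.z22 := by rw [← e2]; simp
  have a1 : arrive1 S x = { x with q1 := x.q1 + 1 } := by simp [arrive1, e1]
  have a2 : arrive2 S x = { x with q2 := x.q2 + 1 } := by simp [arrive2, e2]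
  have hq1 : ((x.q1 - 1 : ℕ) : ℝ) = x.q1 - 1 := by rw [Nat.cast_sub h1]; simp
  have hq2 : ((x.q2 - 1 : ℕ) : ℝ) = x.q2 - 1 := by rw [Nat.cast_sub h2]; simp
  have hz12 : (x.z12 : ℝ) * ((x.z12 - 1 : ℕ) : ℝ) = x.z12 * (x.z12 - 1) := by
    rcases Nat.eq_zero_or_pos x.z12 with h | h
    · simp [h]
    · rw [Nat.cast_sub h]; simp
  have hz12' : x.z12 = 0 ∨ ((x.z12 - 1 : ℕ) : ℝ) + 1 - x.z12 = 0 := by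
    rcases Nat.eq_zero_or_pos x.z12 with h | h
    · exact Or.inl h
    · right; rw [Nat.cast_sub h]; simp
  rw [generator, a1, a2]
  by_cases hd : 0 < diff12 R S x <;> by_cases hd' : 0 < diff21 R S x ∧ x.z12 = 0 <;>
    fin_cases j <;>
    simp [coord, drift, assign1, assign2, hz, h1, h2, hd, hd', hq1, hq2, m1, m2, not_le.2,
      not_lt.1] <;> first | ring1 | linear_combination R.mu12 * hz12 | tauto

/-- Only the first branch of `assign1` raises `z21`, and it requires `D₂₁ > 0`. Hence the generator
vanishes at such states on functions supported in `{Z₂₁ > 0}`. -/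
lemma target_z21 {x : State} (hz : x.z21 = 0) (hd : diff21 R S x ≤ 0) (i : Fin 8) :
    (target R S x i).z21 = 0 := by
  have hd' : ¬ 0 < diff21 R S x := not_lt.2 hd
  fin_cases i <;> simp [target, arrive1, arrive2, assign1, assign2, hd'] <;>
    (try split_ifs) <;> (try dsimp only) <;> omega

lemma unitJumps_const (c : ℝ) : UnitJumps R S (fun _ ↦ c) := fun x _ i _ ↦ by simp

end

section

/-! ### Paths of the chain and the martingale problem -/

variable {Ω : Type*} {mΩ : MeasurableSpace Ω} {R : Rates} {S : Scale} {𝓕 : Filtration ℝ≥0 mΩ}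
  {P : Measure Ω} {X : ℝ≥0 → Ω → State}

lemma IsChain.isStepPath (h : IsChain R S 𝓕 P X) (ω : Ω) :
    IsStepPath (fun s : ℝ ↦ X s.toNNReal ω) where
  right s := by
    rcases lt_or_ge s 0 with hs | hs
    · have : ∀ᶠ u in 𝓝[>] s, u < 0 := (eventually_lt_nhds hs).filter_mono nhdsWithin_le_nhds
      filter_upwards [this] with u hu
      rw [Real.toNNReal_of_nonpos hu.le, Real.toNNReal_of_nonpos hs.le]
    · have ht : Tendsto Real.toNNReal (𝓝[>] s) (𝓝[>] s.toNNReal) := by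
        refine tendsto_nhdsWithin_of_tendsto_nhds_of_eventually_within _
          (continuous_real_toNNReal.continuousWithinAt) ?_
        filter_upwards [self_mem_nhdsWithin] with u hu
        exact (Real.toNNReal_lt_toNNReal_iff (hs.trans_lt hu)).2 hu
      exact ht.eventually (h.right_continuous ω s.toNNReal)
  left s := by
    rcases le_or_gt s 0 with hs | hs
    · refine ⟨X 0 ω, ?_⟩
      filter_upwards [self_mem_nhdsWithin] with u hu
      rw [Real.toNNReal_of_nonpos ((mem_Iio.1 hu).le.trans hs)]
    · obtain ⟨x, hx⟩ := h.left_limit ω s.toNNReal (Real.toNNReal_pos.2 hs)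
      have ht : Tendsto Real.toNNReal (𝓝[<] s) (𝓝[<] s.toNNReal) := by
        refine tendsto_nhdsWithin_of_tendsto_nhds_of_eventually_within _
          (continuous_real_toNNReal.continuousWithinAt) ?_
        filter_upwards [self_mem_nhdsWithin] with u hu
        exact (Real.toNNReal_lt_toNNReal_iff hs).2 hu
      exact ⟨x, ht.eventually hx⟩

lemma IsChain.rightRegular (h : IsChain R S 𝓕 P X) (g : State → ℝ) (ω : Ω) :
    RightRegular (fun s : ℝ ↦ g (X s.toNNReal ω)) :=
  RightRegular.of_step ((h.isStepPath ω).comp g)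

lemma IsChain.measurable (h : IsChain R S 𝓕 P X) (t : ℝ≥0) : Measurable (X t) :=
  (h.adapted t).mono (𝓕.le t) le_rfl

lemma measurable_of_state (g : State → ℝ) : Measurable g := fun _ _ ↦ trivial

lemma IsChain.measurable_uncurry (h : IsChain R S 𝓕 P X) (g : State → ℝ) :
    Measurable (fun z : ℝ × Ω ↦ g (X z.1.toNNReal z.2)) :=
  measurable_uncurry_of_right (u := fun s ω ↦ g (X s.toNNReal ω))
    (fun _ ↦ (measurable_of_state g).comp (h.measurable _))
    fun ω s ↦ (h.rightRegular g ω).right s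

/-- The compensated process `f(X_t) - f(X_0) - ∫₀ᵗ L f(X_s) ds`. -/
def comp (R : Rates) (S : Scale) (f : State → ℝ) (p : ℝ≥0 → State) (t : ℝ≥0) : ℝ :=
  f (p t) - f (p 0) - ∫ s in (0 : ℝ)..t, generator R S f (p s.toNNReal)

lemma exists_bound_of_finite_support {f : State → ℝ} (hf : (Function.support f).Finite) :
    ∃ B, ∀ x, |f x| ≤ B := by
  obtain ⟨B, hB⟩ := ((hf.image f).image abs).bddAbove
  refine ⟨max B 0, fun x ↦ ?_⟩
  by_cases hz : f x = 0
  · simp [hz]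
  · exact (hB ⟨_, ⟨_, hz, rfl⟩, rfl⟩).trans (le_max_left _ _)

lemma IsChain.abs_integral_le (h : IsChain R S 𝓕 P X) {g : State → ℝ} {C : ℝ}
    (hC : ∀ x ∈ stateSpace S, |g x| ≤ C) {a b : ℝ} (hab : a ≤ b) (ω : Ω) :
    |∫ s in a..b, g (X s.toNNReal ω)| ≤ C * (b - a) := by
  have := intervalIntegral.norm_integral_le_of_norm_le_const (a := a) (b := b) (C := C)
    (f := fun s ↦ g (X s.toNNReal ω)) (fun s _ ↦ hC _ (h.mem_stateSpace _ ω))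
  rwa [abs_of_nonneg (sub_nonneg.2 hab)] at this

lemma IsChain.rightRegular_comp (h : IsChain R S 𝓕 P X) (f : State → ℝ) (ω : Ω) :
    RightRegular (fun s : ℝ ↦ comp R S f (fun u ↦ X u ω) s.toNNReal) := by
  have h1 := (h.rightRegular f ω).sub (RightRegular.const (f (X 0 ω)))
  have h2 := (h.rightRegular (generator R S f) ω).continuous_integral 0
  exact h1.sub (RightRegular.of_continuous
    (h2.comp (NNReal.continuous_coe.comp continuous_real_toNNReal)))

lemma IsChain.abs_comp_le (h : IsChain R S 𝓕 P X) {f : State → ℝ} {B C : ℝ}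
    (hB : ∀ x, |f x| ≤ B) (hC : ∀ x ∈ stateSpace S, |generator R S f x| ≤ C) (t : ℝ≥0) (ω : Ω) :
    |comp R S f (fun s ↦ X s ω) t| ≤ 2 * B + C * t := by
  have h1 := h.abs_integral_le hC t.2 ω
  have h2 := hB (X t ω)
  have h3 := hB (X 0 ω)
  rw [NNReal.val_eq_coe] at h1
  unfold comp
  rw [abs_le] at *
  constructor <;> linarith [h1.1, h1.2, h2.1, h2.2, h3.1, h3.2]

lemma abs_mul_le_mul {a b A B : ℝ} (ha : |a| ≤ A) (hb : |b| ≤ B) : |a * b| ≤ A * B := by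
  rw [abs_mul]
  exact mul_le_mul ha hb (abs_nonneg _) ((abs_nonneg _).trans ha)

lemma exists_gamma_bound {f : State → ℝ} (hf : (Function.support f).Finite) :
    ∃ C, ∀ x ∈ stateSpace S, |gamma R S f x| ≤ C := by
  have hf2 : (Function.support fun x ↦ f x ^ 2).Finite :=
    hf.subset fun x hx ↦ by simpa using hx
  obtain ⟨B, hB⟩ := exists_bound_of_finite_support hf
  obtain ⟨C, hC⟩ := exists_generator_bound (R := R) (S := S) hf
  obtain ⟨C2, hC2⟩ := exists_generator_bound (R := R) (S := S) hf2
  refine ⟨C2 + 2 * (B * C), fun x hx ↦ ?_⟩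
  have h1 := hC2 x hx
  have h2 := abs_mul_le_mul (hB x) (hC x hx)
  rw [abs_le] at *
  unfold gamma
  constructor <;> linarith [h1.1, h1.2, h2.1, h2.2]

variable [IsProbabilityMeasure P]

lemma IsChain.integrable (h : IsChain R S 𝓕 P X) {f : State → ℝ}
    (hf : (Function.support f).Finite) (t : ℝ≥0) : Integrable (fun ω ↦ f (X t ω)) P := by
  obtain ⟨B, hB⟩ := exists_bound_of_finite_support hf
  exact Integrable.of_bound
    ((measurable_of_state f).comp (h.measurable t)).aestronglyMeasurable B
    (Eventually.of_forall fun ω ↦ hB _)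

lemma IsChain.martingale_comp (h : IsChain R S 𝓕 P X) {f : State → ℝ}
    (hf : (Function.support f).Finite) :
    Martingale (fun t ω ↦ comp R S f (fun s ↦ X s ω) t) 𝓕 P := by
  have h1 := h.martingale f hf
  have h0 : Martingale (fun (_ : ℝ≥0) ω ↦ f (X 0 ω)) 𝓕 P := by
    have hm : StronglyMeasurable[𝓕 0] (fun ω ↦ f (X 0 ω)) :=
      ((measurable_of_state f).comp (h.adapted 0)).stronglyMeasurable
    refine ⟨fun t ↦ hm.mono (𝓕.mono zero_le), fun i j _ ↦ ?_⟩
    rw [condExp_of_stronglyMeasurable (𝓕.le i) (hm.mono (𝓕.mono zero_le))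
      (h.integrable hf 0)]
  have h2 := h1.sub h0
  refine h2.congr (fun t ↦ ?_) (fun t ↦ Eventually.of_forall fun ω ↦ ?_)
  · have := h2.1 t
    convert! this using 2
    simp only [comp, Pi.sub_apply]; ring
  · simp only [comp, Pi.sub_apply]; ring

/-- A martingale does not change its correlation with bounded variables of the past. -/
lemma integral_mul_eq_of_martingale {M : ℝ≥0 → Ω → ℝ} (hM : Martingale M 𝓕 P) {s t : ℝ≥0}
    (hst : s ≤ t) {Z : Ω → ℝ} (hZ : StronglyMeasurable[𝓕 s] Z) {C : ℝ} (hC : ∀ ω, |Z ω| ≤ C) :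
    ∫ ω, Z ω * M t ω ∂P = ∫ ω, Z ω * M s ω ∂P := by
  have h1 := condExp_stronglyMeasurable_mul_of_bound (𝓕.le s) hZ (hM.integrable t) C
    (Eventually.of_forall hC)
  have h2 := integral_condExp (μ := P) (f := Z * M t) (𝓕.le s)
  have h3 : ∫ ω, (Z * M t) ω ∂P = ∫ ω, Z ω * M s ω ∂P := by
    rw [← h2]
    refine integral_congr_ae ?_
    filter_upwards [h1, hM.2 s t hst] with ω e1 e2
    rw [e1, Pi.mul_apply, e2]
  exact h3

lemma integrable_prod_of_bound {G : ℝ × Ω → ℝ} (hG : Measurable G) {t C : ℝ}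
    (hC : ∀ s ∈ Icc 0 t, ∀ ω, |G (s, ω)| ≤ C) :
    Integrable G ((volume.restrict (Ioc 0 t)).prod P) := by
  refine Integrable.of_bound hG.aestronglyMeasurable C ?_
  have : (volume.restrict (Ioc 0 t)).prod P
      = ((volume : Measure ℝ).prod P).restrict (Ioc 0 t ×ˢ univ) := by
    rw [← Measure.prod_restrict, Measure.restrict_univ]
  rw [this]
  refine (ae_restrict_iff' (measurableSet_Ioc.prod MeasurableSet.univ)).2
    (Eventually.of_forall fun z hz ↦ ?_)
  exact hC z.1 (Ioc_subset_Icc_self hz.1) z.2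

lemma integrable_intervalIntegral {G : ℝ × Ω → ℝ} (hG : Measurable G) {t C : ℝ} (ht : 0 ≤ t)
    (hC : ∀ s ∈ Icc 0 t, ∀ ω, |G (s, ω)| ≤ C) :
    Integrable (fun ω ↦ ∫ s in (0 : ℝ)..t, G (s, ω)) P := by
  simp_rw [intervalIntegral.integral_of_le ht]
  exact (integrable_prod_of_bound hG hC).integral_prod_right

lemma integral_intervalIntegral_swap {G : ℝ × Ω → ℝ} (hG : Measurable G) {t C : ℝ} (ht : 0 ≤ t)
    (hC : ∀ s ∈ Icc 0 t, ∀ ω, |G (s, ω)| ≤ C) :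
    ∫ ω, (∫ s in (0 : ℝ)..t, G (s, ω)) ∂P = ∫ s in (0 : ℝ)..t, (∫ ω, G (s, ω) ∂P) := by
  simp_rw [intervalIntegral.integral_of_le ht]
  exact (integral_integral_swap (f := fun s ω ↦ G (s, ω))
    (integrable_prod_of_bound (P := P) hG hC)).symm

/-- The second moment of the compensated process. -/
lemma IsChain.integral_comp_sq (h : IsChain R S 𝓕 P X) {f : State → ℝ}
    (hf : (Function.support f).Finite) (t : ℝ≥0) :
    ∫ ω, comp R S f (fun s ↦ X s ω) t ^ 2 ∂P
      = ∫ ω, (∫ s in (0 : ℝ)..t, gamma R S f (X s.toNNReal ω)) ∂P := by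
  have hf2 : (Function.support fun x ↦ f x ^ 2).Finite :=
    hf.subset fun x hx ↦ by simpa using hx
  obtain ⟨B, hB⟩ := exists_bound_of_finite_support hf
  obtain ⟨C, hC⟩ := exists_generator_bound (R := R) (S := S) hf
  have hMart := h.martingale_comp hf
  have hMart2 := h.martingale_comp hf2
  set N : ℝ≥0 → Ω → ℝ := fun t ω ↦ comp R S f (fun s ↦ X s ω) t with hN
  set N2 : ℝ≥0 → Ω → ℝ := fun t ω ↦ comp R S (fun x ↦ f x ^ 2) (fun s ↦ X s ω) t with hN2
  set L := generator R S f with hL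
  have hB0 : 0 ≤ B := (abs_nonneg _).trans (hB ⟨0, 0, 0, 0, 0, 0⟩)
  have hC0 : 0 ≤ C ∨ IsEmpty Ω := by
    rcases isEmpty_or_nonempty Ω with he | ⟨⟨ω⟩⟩
    · exact Or.inr he
    · exact Or.inl ((abs_nonneg _).trans (hC _ (h.mem_stateSpace 0 ω)))
  rcases hC0 with hC0 | he
  swap
  · simp [integral_of_isEmpty]
  have hNb : ∀ s ≤ t, ∀ ω, |N s ω| ≤ 2 * B + C * t := fun s hs ω ↦
    (h.abs_comp_le hB hC s ω).trans (by gcongr)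
  have hNm : ∀ s, StronglyMeasurable[𝓕 s] (N s) := hMart.1
  have hLm : ∀ s, StronglyMeasurable[𝓕 s] (fun ω ↦ L (X s ω)) := fun s ↦
    ((measurable_of_state L).comp (h.adapted s)).stronglyMeasurable
  -- joint measurability
  have hNu : Measurable (fun z : ℝ × Ω ↦ N z.1.toNNReal z.2) :=
    measurable_uncurry_of_right (u := fun s ω ↦ N s.toNNReal ω)
      (fun s ↦ ((hNm _).mono (𝓕.le _)).measurable) fun ω s ↦ (h.rightRegular_comp f ω).right s
  have hLu := h.measurable_uncurry L
  have hNt : Measurable (fun z : ℝ × Ω ↦ N t z.2) :=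
    ((hNm t).mono (𝓕.le t)).measurable.comp measurable_snd
  have htn : ∀ s ∈ Icc (0 : ℝ) t, s.toNNReal ≤ t := fun s hs ↦
    Real.toNNReal_le_iff_le_coe.2 hs.2
  -- the pathwise identity
  have hpath : ∀ ω, N t ω ^ 2 = N2 t ω + (∫ s in (0 : ℝ)..t, gamma R S f (X s.toNNReal ω))
      - 2 * (f (X 0 ω) * N t ω) - 2 * ((∫ s in (0 : ℝ)..t, N t ω * L (X s.toNNReal ω))
        - ∫ s in (0 : ℝ)..t, N s.toNNReal ω * L (X s.toNNReal ω)) := by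
    intro ω
    have rL := h.rightRegular L ω
    have rf := h.rightRegular f ω
    have r2 := h.rightRegular (generator R S (fun x ↦ f x ^ 2)) ω
    have hprim := rL.integral_mul_primitive t
    have e1 : ∫ s in (0 : ℝ)..t, gamma R S f (X s.toNNReal ω)
        = (∫ s in (0 : ℝ)..t, generator R S (fun x ↦ f x ^ 2) (X s.toNNReal ω))
          - 2 * ∫ s in (0 : ℝ)..t, f (X s.toNNReal ω) * L (X s.toNNReal ω) := by
      rw [← intervalIntegral.integral_const_mul, ← intervalIntegral.integral_sub
        (r2.intervalIntegrable _ _) (((rf.mul rL).intervalIntegrable _ _).const_mul 2)]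
      refine intervalIntegral.integral_congr fun s _ ↦ ?_
      simp only [gamma, hL]; ring
    -- Insert `N_s = f(X_s) - f(X_0) - ∫₀ˢ L f`; the double integral is half a square by
    -- `integral_mul_primitive`.
    have e2 : ∫ s in (0 : ℝ)..t, N s.toNNReal ω * L (X s.toNNReal ω)
        = (∫ s in (0 : ℝ)..t, f (X s.toNNReal ω) * L (X s.toNNReal ω))
          - f (X 0 ω) * (∫ s in (0 : ℝ)..t, L (X s.toNNReal ω))
          - (∫ s in (0 : ℝ)..t, L (X s.toNNReal ω)) ^ 2 / 2 := by
      rw [← hprim, ← intervalIntegral.integral_const_mul, ← intervalIntegral.integral_sub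
        ((rf.mul rL).intervalIntegrable _ _) ((rL.intervalIntegrable _ _).const_mul _),
        ← intervalIntegral.integral_sub (((rf.mul rL).intervalIntegrable _ _).sub
          ((rL.intervalIntegrable _ _).const_mul _))
          (((RightRegular.of_continuous (rL.continuous_integral 0)).mul rL).intervalIntegrable
            _ _)]
      refine intervalIntegral.integral_congr fun s hs ↦ ?_
      rw [uIcc_of_le t.coe_nonneg] at hs
      simp only [hN, comp, Real.coe_toNNReal s hs.1]; ring
    rw [e1, e2, intervalIntegral.integral_const_mul]
    simp only [hN, hN2, comp, ← hL]
    ring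
  obtain ⟨D, hGb⟩ := exists_gamma_bound (R := R) (S := S) hf
  have i1 : Integrable (N2 t) P := hMart2.integrable t
  have i2 : Integrable (fun ω ↦ ∫ s in (0 : ℝ)..t, gamma R S f (X s.toNNReal ω)) P :=
    integrable_intervalIntegral (h.measurable_uncurry (gamma R S f)) t.coe_nonneg
      fun s _ ω ↦ hGb _ (h.mem_stateSpace _ ω)
  have i3 : Integrable (fun ω ↦ f (X 0 ω) * N t ω) P :=
    (hMart.integrable t).bdd_mul (c := B)
      ((measurable_of_state f).comp (h.measurable 0)).aestronglyMeasurable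
      (Eventually.of_forall fun ω ↦ hB _)
  have b4 : ∀ s ∈ Icc (0 : ℝ) t, ∀ ω, |N t ω * L (X s.toNNReal ω)| ≤ (2 * B + C * t) * C :=
    fun s _ ω ↦ abs_mul_le_mul (hNb t le_rfl ω) (hC _ (h.mem_stateSpace _ ω))
  have b5 : ∀ s ∈ Icc (0 : ℝ) t, ∀ ω,
      |N s.toNNReal ω * L (X s.toNNReal ω)| ≤ (2 * B + C * t) * C :=
    fun s hs ω ↦ abs_mul_le_mul (hNb _ (htn s hs) ω) (hC _ (h.mem_stateSpace _ ω))
  have i4 : Integrable (fun ω ↦ ∫ s in (0 : ℝ)..t, N t ω * L (X s.toNNReal ω)) P :=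
    integrable_intervalIntegral (P := P) (G := fun z ↦ N t z.2 * L (X z.1.toNNReal z.2))
    (hNt.mul hLu) t.coe_nonneg b4
  have i5 : Integrable (fun ω ↦ ∫ s in (0 : ℝ)..t, N s.toNNReal ω * L (X s.toNNReal ω)) P :=
    integrable_intervalIntegral (P := P)
    (G := fun z ↦ N z.1.toNNReal z.2 * L (X z.1.toNNReal z.2)) (hNu.mul hLu) t.coe_nonneg b5
  have v1 : ∫ ω, N2 t ω ∂P = 0 := by
    have := integral_mul_eq_of_martingale hMart2 (zero_le : 0 ≤ t) (Z := fun _ ↦ 1)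
      stronglyMeasurable_const (C := 1) (by simp)
    simpa [hN2, comp] using this
  have v3 : ∫ ω, f (X 0 ω) * N t ω ∂P = 0 := by
    have := integral_mul_eq_of_martingale hMart (zero_le : 0 ≤ t) (Z := fun ω ↦ f (X 0 ω))
      ((measurable_of_state f).comp (h.adapted 0)).stronglyMeasurable (fun ω ↦ hB _)
    rw [this]
    simp [hN, comp]
  -- After Fubini, `E[N_t L f(X_s)] = E[N_s L f(X_s)]`, because `L f(X_s)` is a bounded variable of
  -- the past of `s`. With `v1` and `v3`, only the integral of `gamma` survives in the expectation
  -- of `hpath`.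
  have v45 : ∫ ω, (∫ s in (0 : ℝ)..t, N t ω * L (X s.toNNReal ω)) ∂P
      = ∫ ω, (∫ s in (0 : ℝ)..t, N s.toNNReal ω * L (X s.toNNReal ω)) ∂P := by
    have s1 := integral_intervalIntegral_swap (P := P)
      (G := fun z ↦ N t z.2 * L (X z.1.toNNReal z.2)) (hNt.mul hLu) t.coe_nonneg b4
    have s2 := integral_intervalIntegral_swap (P := P)
      (G := fun z ↦ N z.1.toNNReal z.2 * L (X z.1.toNNReal z.2)) (hNu.mul hLu) t.coe_nonneg b5
    refine s1.trans (Eq.trans ?_ s2.symm)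
    refine intervalIntegral.integral_congr fun s hs ↦ ?_
    rw [uIcc_of_le t.coe_nonneg] at hs
    have := integral_mul_eq_of_martingale hMart (htn s hs) (hLm s.toNNReal)
      (fun ω ↦ hC _ (h.mem_stateSpace _ ω))
    simpa only [mul_comm] using this
  have i12 : Integrable (fun ω ↦ N2 t ω + ∫ s in (0 : ℝ)..t, gamma R S f (X s.toNNReal ω)) P :=
    i1.add i2
  have i123 : Integrable (fun ω ↦ N2 t ω + (∫ s in (0 : ℝ)..t, gamma R S f (X s.toNNReal ω))
      - 2 * (f (X 0 ω) * N t ω)) P := i12.sub (i3.const_mul 2)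
  have i45 : Integrable (fun ω ↦ (∫ s in (0 : ℝ)..t, N t ω * L (X s.toNNReal ω))
        - ∫ s in (0 : ℝ)..t, N s.toNNReal ω * L (X s.toNNReal ω)) P := i4.sub i5
  calc ∫ ω, N t ω ^ 2 ∂P = _ := integral_congr_ae (Eventually.of_forall hpath)
    _ = _ := by
      rw [integral_sub i123 (i45.const_mul 2), integral_sub i12 (i3.const_mul 2),
        integral_add i1 i2, integral_const_mul, integral_const_mul, integral_sub i4 i5, v1, v3, v45]
      ring

end

section

variable {Ω : Type*} {mΩ : MeasurableSpace Ω} {R : Rates} {S : Scale} {𝓕 : Filtration ℝ≥0 mΩ}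
  {P : Measure Ω} {X : ℝ≥0 → Ω → State}

/-! ### Maximal inequality -/

/-- If every point of `A` lies in all but finitely many `E j`, then `A` is not larger than most `E j`. -/
lemma measure_le_of_eventually_mem {A : Set Ω} {E : ℕ → Set Ω} (hA : ∀ ω ∈ A, ∀ᶠ j in atTop, ω ∈ E j)
    {c : ℝ≥0∞} (hc : ∀ᶠ j in atTop, P (E j) ≤ c) : P A ≤ c := by
  obtain ⟨J, hJ⟩ := eventually_atTop.1 hc
  have hsub : A ⊆ ⋃ i, ⋂ j ≥ i, E j := fun ω hω ↦ by
    obtain ⟨i, hi⟩ := eventually_atTop.1 (hA ω hω)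
    exact mem_iUnion.2 ⟨i, mem_iInter₂.2 hi⟩
  refine (measure_mono hsub).trans ?_
  rw [Monotone.measure_iUnion (fun i i' hii' ↦
    biInter_subset_biInter_left fun j (hj : i' ≤ j) ↦ hii'.trans hj)]
  refine iSup_le fun i ↦ (measure_mono ?_).trans (hJ (max i J) (le_max_right _ _))
  exact biInter_subset_of_mem (le_max_left i J)

lemma IsChain.forall_le_of_rat (h : IsChain R S 𝓕 P X) {G : Set State} {s : ℝ≥0} {ω : Ω}
    (hG : ∀ q : ℚ, 0 < q → X (min s (Real.toNNReal q)) ω ∈ G) : ∀ u ≤ s, X u ω ∈ G := by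
  intro u hu
  rcases hu.eq_or_lt with rfl | hlt
  · obtain ⟨q, hq⟩ := exists_rat_gt (u : ℝ)
    have := hG q (by exact_mod_cast u.coe_nonneg.trans_lt hq)
    rwa [min_eq_left (NNReal.le_toNNReal_of_coe_le hq.le)] at this
  · have h1 := ((h.isStepPath ω).right (u : ℝ)).and
      ((eventually_lt_nhds (NNReal.coe_lt_coe.2 hlt)).filter_mono nhdsWithin_le_nhds)
    obtain ⟨b, hb, hsub⟩ := mem_nhdsGT_iff_exists_Ioo_subset.1 h1
    obtain ⟨q, hq1, hq2⟩ := exists_rat_btwn (mem_Ioi.1 hb)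
    obtain ⟨e1, e2⟩ := hsub ⟨hq1, hq2⟩
    have := hG q (by exact_mod_cast u.coe_nonneg.trans_lt hq1)
    rw [min_eq_right (Real.toNNReal_le_iff_le_coe.2 e2.le)] at this
    have e1' : X (Real.toNNReal q) ω = X (u : ℝ).toNNReal ω := e1
    rw [Real.toNNReal_coe] at e1'
    rwa [← e1']

variable [IsProbabilityMeasure P]

/-- The filtration along an increasing sequence of times. -/
def filtrationComp (𝓕 : Filtration ℝ≥0 mΩ) {g : ℕ → ℝ≥0} (hg : Monotone g) : Filtration ℕ mΩ where
  seq k := 𝓕 (g k)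
  mono' _ _ hij := 𝓕.mono (hg hij)
  le' k := 𝓕.le (g k)

/-- Integrate `b² ≥ a² + 2a(b - a)` over an event `A` of the past: the cross term is the correlation
of the increment with the bounded variable `1_A a` and vanishes. -/
lemma submartingale_sq {M : ℝ≥0 → Ω → ℝ} (hM : Martingale M 𝓕 P)
    (hb : ∀ t, ∃ B, ∀ ω, |M t ω| ≤ B) {g : ℕ → ℝ≥0} (hg : Monotone g) :
    Submartingale (fun k ω ↦ M (g k) ω ^ 2) (filtrationComp 𝓕 hg) P := by
  have hint : ∀ t, Integrable (fun ω ↦ M t ω ^ 2) P := fun t ↦ by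
    obtain ⟨B, hB⟩ := hb t
    refine Integrable.of_bound (((hM.1 t).mono (𝓕.le t)).pow 2).aestronglyMeasurable (B ^ 2)
      (Eventually.of_forall fun ω ↦ ?_)
    rw [Real.norm_eq_abs, abs_pow]
    exact pow_le_pow_left₀ (abs_nonneg _) (hB ω) 2
  refine submartingale_of_setIntegral_le_succ (fun k ↦ (hM.1 (g k)).pow 2) (fun k ↦ hint _)
    fun k A hA ↦ ?_
  obtain ⟨B, hB⟩ := hb (g k)
  have hA' : MeasurableSet A := 𝓕.le _ _ hA
  have hZ : StronglyMeasurable[𝓕 (g k)] (A.indicator (M (g k))) := (hM.1 (g k)).indicator hA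
  have hZb : ∀ ω, |A.indicator (M (g k)) ω| ≤ B := fun ω ↦ by
    by_cases hω : ω ∈ A
    · rw [indicator_of_mem hω]; exact hB ω
    · rw [indicator_of_notMem hω, abs_zero]; exact (abs_nonneg _).trans (hB ω)
  have heq := integral_mul_eq_of_martingale hM (hg (Nat.le_succ k)) hZ hZb
  have hmul : ∀ t, Integrable (fun ω ↦ A.indicator (M (g k)) ω * M t ω) P := fun t ↦
    (hM.integrable t).bdd_mul (c := B) (hZ.mono (𝓕.le _)).aestronglyMeasurable
      (Eventually.of_forall hZb)
  have hrw : ∀ t, ∫ ω in A, M t ω ^ 2 ∂P = ∫ ω, A.indicator (fun ω ↦ M t ω ^ 2) ω ∂P :=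
    fun t ↦ (integral_indicator hA').symm
  have hle : ∫ ω, (A.indicator (fun ω ↦ M (g k) ω ^ 2) ω
      + 2 * (A.indicator (M (g k)) ω * M (g (k + 1)) ω - A.indicator (M (g k)) ω * M (g k) ω)) ∂P
      ≤ ∫ ω, A.indicator (fun ω ↦ M (g (k + 1)) ω ^ 2) ω ∂P := by
    refine integral_mono (((hint _).indicator hA').add
      (((hmul _).sub (hmul _)).const_mul 2)) ((hint _).indicator hA') fun ω ↦ ?_
    by_cases hω : ω ∈ A
    · simp only [indicator_of_mem hω]
      nlinarith [sq_nonneg (M (g (k + 1)) ω - M (g k) ω)]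
    · simp [indicator_of_notMem hω]
  have hmul2 : Integrable (fun ω ↦ A.indicator (M (g k)) ω * M (g (k + 1)) ω
      - A.indicator (M (g k)) ω * M (g k) ω) P := (hmul _).sub (hmul _)
  rw [integral_add ((hint _).indicator hA') (hmul2.const_mul 2),
    integral_const_mul, integral_sub (hmul _) (hmul _), heq, sub_self, mul_zero, add_zero] at hle
  rw [hrw, hrw]
  exact hle

/-- Kolmogorov's maximal inequality for right-continuous martingales. -/
lemma maximal_inequality {M : ℝ≥0 → Ω → ℝ} (hM : Martingale M 𝓕 P)
    (hb : ∀ t, ∃ B, ∀ ω, |M t ω| ≤ B)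
    (hr : ∀ ω (s : ℝ), ContinuousWithinAt (fun r : ℝ ↦ M r.toNNReal ω) (Ioi s) s)
    {τ : ℝ≥0} {V ε : ℝ} (hε : 0 < ε) (hV : ∫ ω, M τ ω ^ 2 ∂P ≤ V) :
    P {ω | ∃ t ≤ τ, ε < |M t ω|} ≤ ENNReal.ofReal (V / ε ^ 2) := by
  -- Dyadic grids of `[0, τ]` that contain the endpoint. A time `t < τ` is approached through them
  -- from the right, where the strict inequality `ε < |M|` persists.
  let g : ℕ → ℕ → ℝ≥0 := fun j k ↦ τ * (k / 2 ^ j)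
  have hg : ∀ j, Monotone (g j) := fun j k k' hk ↦ by
    simp only [g]
    gcongr
  let E : ℕ → Set Ω := fun j ↦ {ω | ∃ k ≤ 2 ^ j, ε ≤ |M (g j k) ω|}
  have hE : ∀ j, P (E j) ≤ ENNReal.ofReal (V / ε ^ 2) := by
    intro j
    have hmax := maximal_ineq (submartingale_sq hM hb (hg j)) (fun k ω ↦ sq_nonneg _)
      (ε := (ε ^ 2).toNNReal) (2 ^ j)
    have hsub : E j ⊆ {ω | ((ε ^ 2).toNNReal : ℝ) ≤ (Finset.range (2 ^ j + 1)).sup'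
        Finset.nonempty_range_add_one fun k ↦ M (g j k) ω ^ 2} := by
      rintro ω ⟨k, hk, hkε⟩
      refine le_trans ?_ (Finset.le_sup' (fun k ↦ M (g j k) ω ^ 2)
        (Finset.mem_range.2 (Nat.lt_succ_of_le hk)))
      rw [Real.coe_toNNReal _ (sq_nonneg ε), ← sq_abs (M _ ω)]
      exact pow_le_pow_left₀ hε.le hkε 2
    have hgl : g j (2 ^ j) = τ := by simp [g]
    have hint := (submartingale_sq hM hb (hg j)).integrable (2 ^ j)
    have h1 : ENNReal.ofReal (ε ^ 2) * P (E j) ≤ ENNReal.ofReal V := by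
      refine le_trans (mul_le_mul_right (measure_mono hsub) _) (hmax.trans ?_)
      refine ENNReal.ofReal_le_ofReal (le_trans (setIntegral_le_integral hint
        (Eventually.of_forall fun ω ↦ sq_nonneg _)) ?_)
      simpa only [hgl] using hV
    rw [ENNReal.ofReal_div_of_pos (by positivity), ENNReal.le_div_iff_mul_le
      (Or.inl (ENNReal.ofReal_pos.2 (by positivity)).ne') (Or.inl ENNReal.ofReal_ne_top), mul_comm]
    exact h1
  refine measure_le_of_eventually_mem (E := E) ?_ (Eventually.of_forall hE)
  rintro ω ⟨t, ht, htε⟩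
  rcases ht.eq_or_lt with rfl | hlt
  · exact Eventually.of_forall fun j ↦ ⟨2 ^ j, le_rfl, by simpa [g] using htε.le⟩
  have hτ : (0 : ℝ) < τ := lt_of_le_of_lt t.coe_nonneg hlt
  have hx : Tendsto (fun j : ℕ ↦ (τ : ℝ) * (((⌊(2 : ℝ) ^ j * (t / τ)⌋ : ℝ) + 1) / (2 : ℝ) ^ j))
      atTop (𝓝[>] (t : ℝ)) := by
    have h1 := tendsto_floor_add_one_div (a := fun j ↦ (2 : ℝ) ^ j) (fun j ↦ by positivity)
      (tendsto_pow_atTop_atTop_of_one_lt (by norm_num)) (t / τ : ℝ)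
    rw [tendsto_nhdsWithin_iff] at h1 ⊢
    have h2 : (τ : ℝ) * (t / τ) = t := by field_simp
    refine ⟨?_, h1.2.mono fun j hj ↦ ?_⟩
    · have := h1.1.const_mul (τ : ℝ)
      rwa [h2] at this
    · have := mul_lt_mul_of_pos_left hj hτ
      rwa [h2] at this
  have hev : ∀ᶠ r in 𝓝[>] (t : ℝ), ε < |M r.toNNReal ω| := by
    have h1 := (hr ω t).abs
    have h2 : ε < |M (t : ℝ).toNNReal ω| := by simpa using htε
    exact h1.eventually_const_lt h2
  have hlt' : ∀ᶠ r : ℝ in 𝓝[>] (t : ℝ), r < τ :=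
    (eventually_lt_nhds (NNReal.coe_lt_coe.2 hlt)).filter_mono nhdsWithin_le_nhds
  filter_upwards [hx.eventually hev, hx.eventually hlt'] with j hj1 hj2
  have hfl : 0 ≤ ⌊(2 : ℝ) ^ j * (t / τ)⌋ := Int.floor_nonneg.2 (by positivity)
  have hcast : ((⌊(2 : ℝ) ^ j * (t / τ)⌋.toNat : ℕ) : ℝ) = (⌊(2 : ℝ) ^ j * (t / τ)⌋ : ℝ) := by
    exact_mod_cast congrArg (Int.cast (R := ℝ)) (Int.toNat_of_nonneg hfl)
  have hgk : ((g j (⌊(2 : ℝ) ^ j * (t / τ)⌋.toNat + 1) : ℝ≥0) : ℝ)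
      = (τ : ℝ) * (((⌊(2 : ℝ) ^ j * (t / τ)⌋ : ℝ) + 1) / (2 : ℝ) ^ j) := by
    simp only [g]
    push_cast
    rw [hcast]
  refine ⟨⌊(2 : ℝ) ^ j * (t / τ)⌋.toNat + 1, ?_, ?_⟩
  · rw [← hcast] at hj2
    have h3 : (((⌊(2 : ℝ) ^ j * (t / τ)⌋.toNat : ℕ) : ℝ) + 1) / (2 : ℝ) ^ j < 1 := by
      by_contra hcon
      nlinarith [not_lt.1 hcon]
    rw [div_lt_one (by positivity)] at h3
    exact_mod_cast h3.le
  · rw [← hgk, Real.toNNReal_coe] at hj1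
    exact hj1.le

/-- The compensated process of a finitely supported function is small with high probability. -/
lemma IsChain.measure_comp_gt_le (h : IsChain R S 𝓕 P X) {f : State → ℝ}
    (hf : (Function.support f).Finite) {κ : ℝ} (hκ : ∀ x ∈ stateSpace S, gamma R S f x ≤ κ)
    (τ : ℝ≥0) {ε : ℝ} (hε : 0 < ε) :
    P {ω | ∃ t ≤ τ, ε < |comp R S f (fun s ↦ X s ω) t|} ≤ ENNReal.ofReal (κ * τ / ε ^ 2) := by
  obtain ⟨B, hB⟩ := exists_bound_of_finite_support hf
  obtain ⟨C, hC⟩ := exists_generator_bound (R := R) (S := S) hf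
  refine maximal_inequality (h.martingale_comp hf) (fun t ↦ ⟨_, h.abs_comp_le hB hC t⟩)
    (fun ω ↦ (h.rightRegular_comp f ω).right) hε ?_
  rw [h.integral_comp_sq hf τ]
  have hle : ∀ ω, (∫ s in (0 : ℝ)..τ, gamma R S f (X s.toNNReal ω)) ≤ κ * τ := fun ω ↦ by
    refine (intervalIntegral.integral_mono_on τ.coe_nonneg
      ((h.rightRegular (gamma R S f) ω).intervalIntegrable _ _)
      intervalIntegrable_const fun s _ ↦ hκ _ (h.mem_stateSpace _ ω)).trans ?_
    simp [mul_comm]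
  obtain ⟨D, hD⟩ := exists_gamma_bound (R := R) (S := S) hf
  refine (integral_mono (integrable_intervalIntegral (h.measurable_uncurry (gamma R S f))
    τ.coe_nonneg fun s _ ω ↦ hD _ (h.mem_stateSpace _ ω)) (integrable_const _) hle).trans ?_
  simp

/-! ### Jumps out of a set -/

/-- Let `f` vanish together with `L f` on `G`. Then the chain does not jump from `G` to a state where
`f` is positive. -/
lemma IsChain.measure_jump_eq_zero (h : IsChain R S 𝓕 P X) {f : State → ℝ}
    (hf : (Function.support f).Finite) (hf01 : ∀ x, f x = 0 ∨ 1 ≤ f x) {G : Set State}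
    (hfG : ∀ x ∈ G, f x = 0) (hLG : ∀ x ∈ G, generator R S f x = 0) (T : ℕ) :
    P {ω | ∃ t : ℝ≥0, 0 < t ∧ t ≤ T ∧ 1 ≤ f (X t ω) ∧ ∀ s < t, X s ω ∈ G} = 0 := by
  obtain ⟨C, hC⟩ := exists_generator_bound (R := R) (S := S) hf
  let A : ℝ≥0 → Set Ω := fun s ↦ {ω | ∀ u ≤ s, X u ω ∈ G}
  have hAanti : ∀ {s t}, s ≤ t → A t ⊆ A s := fun hst ω hω u hu ↦ hω u (hu.trans hst)
  have hAm : ∀ s, MeasurableSet[𝓕 s] (A s) := by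
    intro s
    have heq : A s = ⋂ q : ℚ, {ω | X (min s (Real.toNNReal q)) ω ∈ G} := by
      ext ω
      simp only [A, mem_iInter, mem_ofPred_eq]
      exact ⟨fun hω q ↦ hω _ (min_le_left _ _), fun hω ↦ h.forall_le_of_rat fun q _ ↦ hω q⟩
    rw [heq]
    refine MeasurableSet.iInter fun q ↦ ?_
    exact 𝓕.mono (min_le_left _ _) _ (h.adapted _ (trivial : MeasurableSet G))
  have hC0 : 0 ≤ C ∨ IsEmpty Ω := by
    rcases isEmpty_or_nonempty Ω with he | ⟨⟨ω⟩⟩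
    · exact Or.inr he
    · exact Or.inl ((abs_nonneg _).trans (hC _ (h.mem_stateSpace 0 ω)))
  rcases hC0 with hC0 | he
  swap
  · simp [Set.eq_empty_of_isEmpty]
  -- Given that the path stayed in `G` up to `s`, the mean of `f(X_t)` is that of `∫ L f` over `[s,
  -- t]`. This integral vanishes unless the path leaves `G` before or at `t`, so there is one factor
  -- for the length of the interval and one for the probability of leaving.
  have hstep : ∀ s t, s ≤ t → P.real (A s ∩ {ω | 1 ≤ f (X t ω)})
      ≤ C * (t - s) * (P.real (A s) - P.real (A t)) := by
    intro s t hst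
    have hst' : (0 : ℝ) ≤ t - s := sub_nonneg.2 (NNReal.coe_le_coe.2 hst)
    have hM := h.martingale_comp hf
    have hAs : MeasurableSet (A s) := 𝓕.le _ _ (hAm s)
    have hAt : MeasurableSet (A t) := 𝓕.le _ _ (hAm t)
    have hm1 : MeasurableSet {ω | 1 ≤ f (X t ω)} :=
      ((measurable_of_state f).comp (h.measurable t)) measurableSet_Ici
    have hpt : ∀ ω ∈ A s, f (X t ω) ≤ comp R S f (fun s ↦ X s ω) t - comp R S f (fun s ↦ X s ω) s
        + C * (t - s) * (A t)ᶜ.indicator (fun _ ↦ 1) ω := by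
      intro ω hω
      have hr := h.rightRegular (generator R S f) ω
      have e1 := intervalIntegral.integral_add_adjacent_intervals
        (hr.intervalIntegrable 0 s) (hr.intervalIntegrable s t)
      have e2 : f (X s ω) = 0 := hfG _ (hω s le_rfl)
      have e3 : ∫ u in (s : ℝ)..t, generator R S f (X u.toNNReal ω)
          ≤ C * (t - s) * (A t)ᶜ.indicator (fun _ ↦ 1) ω := by
        by_cases hωt : ω ∈ A t
        · rw [indicator_of_notMem (by simpa using hωt), mul_zero]
          refine (intervalIntegral.integral_congr (g := fun _ ↦ 0) fun u hu ↦ ?_).trans_le (by simp)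
          rw [uIcc_of_le (NNReal.coe_le_coe.2 hst)] at hu
          exact hLG _ (hωt _ (Real.toNNReal_le_iff_le_coe.2 hu.2))
        · rw [indicator_of_mem hωt, mul_one]
          exact (le_abs_self _).trans (h.abs_integral_le hC (NNReal.coe_le_coe.2 hst) ω)
      simp only [comp]
      linarith
    have hi1 : Integrable (fun ω ↦ f (X t ω)) P := h.integrable hf t
    have hi2 : Integrable (fun ω ↦ comp R S f (fun s ↦ X s ω) t
        - comp R S f (fun s ↦ X s ω) s) P := (hM.integrable t).sub (hM.integrable s)
    have hi3 : Integrable (fun ω ↦ C * (t - s) * (A t)ᶜ.indicator (fun _ ↦ (1 : ℝ)) ω) P :=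
      ((integrable_const 1).indicator hAt.compl).const_mul _
    calc P.real (A s ∩ {ω | 1 ≤ f (X t ω)})
        = ∫ ω in A s, {ω | 1 ≤ f (X t ω)}.indicator (fun _ ↦ (1 : ℝ)) ω ∂P := by
          rw [integral_indicator_const _ hm1, measureReal_restrict_apply hm1, inter_comm]; simp
      _ ≤ ∫ ω in A s, f (X t ω) ∂P := by
          refine integral_mono ((integrable_const 1).indicator hm1) hi1.integrableOn fun ω ↦ ?_
          by_cases hω : 1 ≤ f (X t ω)
          · rw [indicator_of_mem (by exact hω)]; exact hω
          · rw [indicator_of_notMem (by exact hω)]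
            rcases hf01 (X t ω) with h0 | h0
            · exact h0.ge
            · exact absurd h0 hω
      _ ≤ ∫ ω in A s, (comp R S f (fun s ↦ X s ω) t - comp R S f (fun s ↦ X s ω) s
            + C * (t - s) * (A t)ᶜ.indicator (fun _ ↦ 1) ω) ∂P :=
          setIntegral_mono_on hi1.integrableOn (hi2.add hi3).integrableOn hAs hpt
      _ = C * (t - s) * (P.real (A s) - P.real (A t)) := by
          rw [integral_add hi2.integrableOn hi3.integrableOn,
            integral_sub (hM.integrable t).integrableOn (hM.integrable s).integrableOn,
            hM.setIntegral_eq hst (hAm s), sub_self, zero_add, integral_const_mul,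
            integral_indicator_const _ hAt.compl, measureReal_restrict_apply hAt.compl,
            ← measureReal_sdiff (hAanti hst) hAt, inter_comm, sdiff_eq]
          simp
  -- Summing `hstep` over the cells of mesh `2⁻ʲ`, the probabilities of leaving telescope to at most
  -- one, and the factor `C / 2 ^ j` remains.
  let E : ℕ → Set Ω := fun j ↦
    ⋃ k ∈ Finset.range (T * 2 ^ j), (A (k / 2 ^ j) ∩ {ω | 1 ≤ f (X (((k + 1 : ℕ) : ℝ≥0) / 2 ^ j) ω)})
  have hE : ∀ j, P.real (E j) ≤ C / 2 ^ j := by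
    intro j
    refine (measureReal_biUnion_finset_le _ _).trans ?_
    refine (Finset.sum_le_sum fun (k : ℕ) _ ↦ hstep (k / 2 ^ j) (((k + 1 : ℕ) : ℝ≥0) / 2 ^ j) ?_).trans ?_
    · gcongr
      simp
    · have h1 : ∀ k : ℕ, C * (((((k + 1 : ℕ) : ℝ≥0) / 2 ^ j : ℝ≥0) : ℝ) - ((k / 2 ^ j : ℝ≥0) : ℝ))
          = C / 2 ^ j := fun k ↦ by push_cast; field_simp; ring
      simp_rw [h1]
      rw [← Finset.mul_sum, Finset.sum_range_sub' (fun k : ℕ ↦ P.real (A (k / 2 ^ j)))]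
      have h2 : P.real (A (((0 : ℕ) : ℝ≥0) / 2 ^ j)) ≤ 1 := measureReal_le_one
      have h3 : 0 ≤ P.real (A (((T * 2 ^ j : ℕ) : ℝ≥0) / 2 ^ j)) := measureReal_nonneg
      exact mul_le_of_le_one_right (by positivity) (by linarith)
  have hlim : Tendsto (fun j : ℕ ↦ ENNReal.ofReal (C / 2 ^ j)) atTop (𝓝 0) := by
    have : Tendsto (fun j : ℕ ↦ C / 2 ^ j) atTop (𝓝 0) :=
      tendsto_const_nhds.div_atTop (tendsto_pow_atTop_atTop_of_one_lt (by norm_num))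
    simpa using ENNReal.tendsto_ofReal this
  refine le_antisymm (ge_of_tendsto' hlim fun J ↦ measure_le_of_eventually_mem (E := E) ?_
    (eventually_atTop.2 ⟨J, fun j hj ↦ ?_⟩)) zero_le
  · rintro ω ⟨t, ht, htT, hft, hG⟩
    have h1 := (h.isStepPath ω).right (t : ℝ)
    obtain ⟨b, hb, hsub⟩ := mem_nhdsGT_iff_exists_Ioo_subset.1 h1
    have hb' : (0 : ℝ) < b - t := sub_pos.2 hb
    have hpow : Tendsto (fun j : ℕ ↦ (1 / 2 : ℝ) ^ j) atTop (𝓝 0) :=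
      tendsto_pow_atTop_nhds_zero_of_lt_one (by norm_num) (by norm_num)
    filter_upwards [hpow.eventually (eventually_lt_nhds hb')] with j hj
    have h2 : (0 : ℝ) < 2 ^ j := by positivity
    -- The ceiling selects the cell with `k / 2 ^ j < t ≤ (k + 1) / 2 ^ j`: the path is known to be
    -- in `G` only strictly before `t`, and at the right end it still has the value it takes at `t`.
    have hc0 : 0 < ⌈(t : ℝ) * 2 ^ j⌉₊ := Nat.ceil_pos.2 (by positivity)
    obtain ⟨k, hk⟩ := Nat.exists_eq_succ_of_ne_zero hc0.ne'
    have hk1 : (k : ℝ) < t * 2 ^ j := Nat.lt_ceil.1 (by omega)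
    have hk2 : (t : ℝ) * 2 ^ j ≤ (k + 1 : ℕ) := by
      have := Nat.le_ceil ((t : ℝ) * 2 ^ j)
      rwa [hk] at this
    have hk3 : (k : ℝ) < T * 2 ^ j := hk1.trans_le (by gcongr; exact_mod_cast htT)
    refine mem_iUnion₂.2 ⟨k, Finset.mem_range.2 (by exact_mod_cast hk3), fun u hu ↦ hG u ?_, ?_⟩
    · refine lt_of_le_of_lt hu (NNReal.coe_lt_coe.1 ?_)
      push_cast
      rwa [div_lt_iff₀ h2]
    · show 1 ≤ f (X (((k + 1 : ℕ) : ℝ≥0) / 2 ^ j) ω)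
      rcases hk2.eq_or_lt with heq | hlt
      · have : (((k + 1 : ℕ) : ℝ≥0) / 2 ^ j) = t := by
          apply NNReal.coe_injective
          push_cast at heq ⊢
          rw [← heq]; field_simp
        rwa [this]
      · have hcoe : (((((k + 1 : ℕ) : ℝ≥0) / 2 ^ j : ℝ≥0)) : ℝ) = ((k + 1 : ℕ) : ℝ) / 2 ^ j := by
          push_cast; rfl
        have hmem : ((((k + 1 : ℕ) : ℝ≥0) / 2 ^ j : ℝ≥0) : ℝ) ∈ Ioo (t : ℝ) b := by
          rw [hcoe]
          refine ⟨by rwa [lt_div_iff₀ h2], ?_⟩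
          rw [one_div, inv_pow] at hj
          have : ((k + 1 : ℕ) : ℝ) / 2 ^ j = k / 2 ^ j + (2 ^ j)⁻¹ := by push_cast; field_simp
          rw [this]
          have h3 : (k : ℝ) / 2 ^ j < t := by rwa [div_lt_iff₀ h2]
          linarith
        have h4 : X (((((k + 1 : ℕ) : ℝ≥0) / 2 ^ j : ℝ≥0) : ℝ).toNNReal) ω
          = X (t : ℝ).toNNReal ω := hsub hmem
        rw [Real.toNNReal_coe, Real.toNNReal_coe] at h4
        rwa [h4]
  · rw [← ofReal_measureReal (measure_ne_top P _)]
    refine ENNReal.ofReal_le_ofReal ((hE j).trans ?_)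
    gcongr
    norm_num

end

section

/-! ### Bounds that hold with probability tending to one -/

/-- Positive parameters and many-server heavy-traffic scaling. -/
structure Regime (R : Rates) (S : ℕ → Scale) (l : Limits) : Prop where
  pos : R.Pos
  lam1_pos : ∀ n, 1 ≤ n → 0 < (S n).lam1
  lam2_pos : ∀ n, 1 ≤ n → 0 < (S n).lam2
  lam1 : Tendsto (fun n : ℕ ↦ (S n).lam1 / n) atTop (𝓝 l.lam1)
  lam2 : Tendsto (fun n : ℕ ↦ (S n).lam2 / n) atTop (𝓝 l.lam2)
  m1 : Tendsto (fun n : ℕ ↦ ((S n).m1 : ℝ) / n) atTop (𝓝 l.m1)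
  m2 : Tendsto (fun n : ℕ ↦ ((S n).m2 : ℝ) / n) atTop (𝓝 l.m2)

variable {R : Rates} {S : ℕ → Scale} {l : Limits} {Ω : ℕ → Type*} [mΩ : ∀ n, MeasurableSpace (Ω n)]
  {P : ∀ n, Measure (Ω n)} {𝓕 : ∀ n, Filtration ℝ≥0 (mΩ n)} {X : ∀ n, ℝ≥0 → Ω n → State}

/-- The probability of the events `A n` tends to zero. -/
def Vanishing (P : ∀ n, Measure (Ω n)) (A : ∀ n, Set (Ω n)) : Prop :=
  Tendsto (fun n ↦ P n (A n)) atTop (𝓝 0)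

lemma Vanishing.mono {A B : ∀ n, Set (Ω n)} (hB : Vanishing P B)
    (h : ∀ᶠ n in atTop, A n ⊆ B n) : Vanishing P A :=
  tendsto_of_tendsto_of_tendsto_of_le_of_le' tendsto_const_nhds hB
    (Eventually.of_forall fun _ ↦ zero_le) (h.mono fun _ hn ↦ measure_mono hn)

lemma Vanishing.union {A B : ∀ n, Set (Ω n)} (hA : Vanishing P A) (hB : Vanishing P B) :
    Vanishing P (fun n ↦ A n ∪ B n) := by
  have := hA.add hB
  rw [add_zero] at this
  exact tendsto_of_tendsto_of_tendsto_of_le_of_le tendsto_const_nhds this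
    (fun _ ↦ zero_le) fun n ↦ measure_union_le _ _

lemma Vanishing.of_eventually_zero {A : ∀ n, Set (Ω n)} (h : ∀ᶠ n in atTop, P n (A n) = 0) :
    Vanishing P A :=
  tendsto_const_nhds.congr' (h.mono fun _ hn ↦ hn.symm)

lemma Vanishing.iUnion_fin {k : ℕ} {A : Fin k → ∀ n, Set (Ω n)} (h : ∀ j, Vanishing P (A j)) :
    Vanishing P (fun n ↦ ⋃ j, A j n) := by
  have : Tendsto (fun n ↦ ∑ j, P n (A j n)) atTop (𝓝 (∑ _j : Fin k, 0)) :=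
    tendsto_finsetSum _ fun j _ ↦ h j
  rw [Finset.sum_const_zero] at this
  exact tendsto_of_tendsto_of_tendsto_of_le_of_le tendsto_const_nhds this
    (fun _ ↦ zero_le) fun n ↦ measure_iUnion_fintype_le _ _

/-- The `+ 1` matches the level `N + 1` in `gamma_trunc_le`. -/
lemma Regime.exists_rateBound (h : Regime R S l) (K : ℕ) :
    ∃ C, 0 < C ∧ ∀ᶠ n : ℕ in atTop, rateBound R (S n) (K * n + 1) ≤ C * n := by
  have h1 : Tendsto (fun n : ℕ ↦ rateBound R (S n) (K * n + 1) / n) atTop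
      (𝓝 (l.lam1 + l.lam2 + (R.theta1 + R.theta2) * (K + 0) + (R.mu11 + R.mu21) * l.m1
        + (R.mu12 + R.mu22) * l.m2)) := by
    have h0 : Tendsto (fun n : ℕ ↦ (K : ℝ) + 1 / n) atTop (𝓝 (K + 0)) :=
      tendsto_const_nhds.add tendsto_one_div_atTop_nhds_zero_nat
    refine Tendsto.congr' ?_ ((((h.lam1.add h.lam2).add (h0.const_mul _)).add
      (h.m1.const_mul _)).add (h.m2.const_mul _))
    filter_upwards [eventually_ge_atTop 1] with n hn
    have hn' : (n : ℝ) ≠ 0 := by positivity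
    rw [rateBound]
    push_cast
    field_simp
  set v := l.lam1 + l.lam2 + (R.theta1 + R.theta2) * (K + 0) + (R.mu11 + R.mu21) * l.m1
        + (R.mu12 + R.mu22) * l.m2
  refine ⟨|v| + 1, by positivity, ?_⟩
  filter_upwards [eventually_ge_atTop 1, h1.eventually (eventually_lt_nhds
    ((le_abs_self v).trans_lt (lt_add_one _)))] with n hn hlt
  rw [div_lt_iff₀ (by exact_mod_cast hn)] at hlt
  exact hlt.le

/-- The second moment is at most `C n τ`, so the maximal inequality gives `C n τ / eₙ²`, which tends
to zero as `eₙ` exceeds the order `√n`. -/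
lemma Regime.vanishing_comp_trunc [∀ n, IsProbabilityMeasure (P n)] (h : Regime R S l)
    (hX : ∀ n, 1 ≤ n → IsChain R (S n) (𝓕 n) (P n) (X n)) {f : ℕ → State → ℝ}
    (hf : ∀ n, UnitJumps R (S n) (f n)) (K : ℕ) (τ : ℝ≥0) {e : ℕ → ℝ}
    (he : Tendsto (fun n : ℕ ↦ e n / √n) atTop atTop) :
    Vanishing P (fun n ↦ {ω | ∃ t ≤ τ,
      e n < |comp R (S n) (trunc (S n) (K * n) (f n)) (fun s ↦ X n s ω) t|}) := by
  obtain ⟨C, hC0, hC⟩ := h.exists_rateBound K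
  have hlim : Tendsto (fun n : ℕ ↦ ENNReal.ofReal (C * τ / (e n / √n) ^ 2)) atTop (𝓝 0) := by
    have : Tendsto (fun n : ℕ ↦ C * τ / (e n / √n) ^ 2) atTop (𝓝 0) :=
      tendsto_const_nhds.div_atTop ((tendsto_pow_atTop two_ne_zero).comp he)
    simpa using ENNReal.tendsto_ofReal this
  refine tendsto_of_tendsto_of_tendsto_of_le_of_le' tendsto_const_nhds hlim
    (Eventually.of_forall fun _ ↦ zero_le) ?_
  filter_upwards [hC, eventually_ge_atTop 1, he.eventually_gt_atTop 0] with n hCn hn hen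
  have hn' : (0 : ℝ) < n := by exact_mod_cast hn
  have hen' : 0 < e n := by
    have := mul_pos hen (Real.sqrt_pos.2 hn')
    rwa [div_mul_cancel₀ _ (Real.sqrt_pos.2 hn').ne'] at this
  refine ((hX n hn).measure_comp_gt_le (finite_support_trunc _ _ _)
    (fun x hx ↦ gamma_trunc_le h.pos (h.lam1_pos n hn).le (h.lam2_pos n hn).le (hf n) _
      (inBox_of_mem hx)) τ hen').trans (ENNReal.ofReal_le_ofReal ?_)
  rw [div_pow, Real.sq_sqrt hn'.le, div_div_eq_mul_div]
  exact div_le_div_of_nonneg_right (by nlinarith [mul_le_mul_of_nonneg_right hCn τ.coe_nonneg])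
    (sq_nonneg _)

lemma queue_target_le_of_ne {R : Rates} {S : Scale} (x : State) {i : Fin 8} (h0 : i ≠ 0)
    (h1 : i ≠ 1) : (target R S x i).q1 + (target R S x i).q2 ≤ x.q1 + x.q2 := by
  fin_cases i <;> simp [target, assign1, assign2] at h0 h1 ⊢ <;>
    (try split_ifs) <;> (try dsimp only) <;> omega

/-- Thus `room` is itself a truncated function with unit jumps, and its compensated process obeys
the general bound. This is how the total queue is controlled. -/
lemma trunc_const {S : Scale} {N : ℕ} {x : State} (hx : InBox S x) :
    trunc S N (fun _ ↦ (N : ℝ)) x = room N x := by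
  have h1 : room N x ≤ N := by
    have : (0 : ℝ) ≤ x.q1 := by positivity
    have : (0 : ℝ) ≤ x.q2 := by positivity
    exact max_le (by positivity) (by linarith)
  rw [trunc, if_pos hx, min_eq_right h1, max_eq_right]
  linarith [room_nonneg N x]

/-- Only the two arrival transitions can reduce `room`, each by at most one. -/
lemma neg_le_generator_trunc_const {R : Rates} {S : Scale} (hR : R.Pos) (h1 : 0 ≤ S.lam1)
    (h2 : 0 ≤ S.lam2) (N : ℕ) {x : State} (hx : InBox S x) :
    -(S.lam1 + S.lam2) ≤ generator R S (trunc S N fun _ ↦ (N : ℝ)) x := by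
  have hterm : ∀ i, rate R S x i * (if i = 0 ∨ i = 1 then -1 else 0) ≤ rate R S x i *
      (trunc S N (fun _ ↦ (N : ℝ)) (target R S x i) - trunc S N (fun _ ↦ (N : ℝ)) x) := by
    intro i
    by_cases hi : rate R S x i = 0
    · simp [hi]
    refine mul_le_mul_of_nonneg_left ?_ (rate_nonneg hR h1 h2 x i)
    rw [trunc_const hx, trunc_const (inBox_target hx i hi)]
    split_ifs with hi'
    · exact (abs_le.1 (abs_room_sub_le N x i)).1
    · push Not at hi'
      have h3 : (((target R S x i).q1 + (target R S x i).q2 : ℕ) : ℝ) ≤ (x.q1 + x.q2 : ℕ) :=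
        Nat.cast_le.2 (queue_target_le_of_ne x hi'.1 hi'.2)
      push_cast at h3
      rw [sub_nonneg]
      exact max_le_max le_rfl (by linarith)
  rw [generator_eq_sum]
  refine le_trans (le_of_eq ?_) (Finset.sum_le_sum fun i _ ↦ hterm i)
  simp [Fin.sum_univ_eight, rate]
  ring

lemma tendsto_div_sqrt_of_linear {η : ℝ} (hη : 0 < η) :
    Tendsto (fun n : ℕ ↦ η * n / √n) atTop atTop := by
  have : Tendsto (fun n : ℕ ↦ η * √(n : ℝ)) atTop atTop :=
    (Real.tendsto_sqrt_atTop.comp tendsto_natCast_atTop_atTop).const_mul_atTop hη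
  refine this.congr fun n ↦ ?_
  rw [mul_div_assoc, Real.div_sqrt]

/-- The initial fluid-scaled state is close to `x₀` with high probability. -/
def InitClose (P : ∀ n, Measure (Ω n)) (X : ∀ n, ℝ≥0 → Ω n → State) (x₀ : Fin 3 → ℝ) : Prop :=
  ∀ δ > 0, Vanishing P (fun n ↦ {ω | δ ≤ dist (scaled n (X n 0 ω)) x₀})

/-- The total queue length is of order `n`. -/
lemma Regime.exists_containment [∀ n, IsProbabilityMeasure (P n)] (h : Regime R S l)
    (hX : ∀ n, 1 ≤ n → IsChain R (S n) (𝓕 n) (P n) (X n)) {x₀ : Fin 3 → ℝ}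
    (hx₀ : InitClose P X x₀) (τ : ℝ≥0) :
    ∃ K : ℕ, Vanishing P (fun n ↦ {ω | ∃ t ≤ τ, K * n < (X n t ω).q1 + (X n t ω).q2}) := by
  -- In units of `n`: the initial queues are at most `|x₀ 0| + |x₀ 1| + 2`, the arrivals add at most
  -- `(λ₁ + λ₂ + 1) τ`, and the last `1` pays for the fluctuation. A total queue above `K n` would
  -- bring `room` down to zero, which these bounds exclude.
  obtain ⟨K, hK⟩ := exists_nat_gt (|x₀ 0| + |x₀ 1| + 2 + (l.lam1 + l.lam2 + 1) * τ + 1)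
  refine ⟨K, ?_⟩
  have h1 := h.vanishing_comp_trunc (P := P) hX (f := fun n _ ↦ ((K * n : ℕ) : ℝ))
    (fun n ↦ unitJumps_const _) K τ (e := fun n ↦ 1 * n) (tendsto_div_sqrt_of_linear one_pos)
  refine ((hx₀ 1 one_pos).union h1).mono ?_
  filter_upwards [eventually_ge_atTop 1,
    (h.lam1.add h.lam2).eventually (eventually_lt_nhds (lt_add_one _))] with n hn hlam ω hω
  have hn' : (0 : ℝ) < n := by exact_mod_cast hn
  by_contra hcon
  simp only [mem_union, mem_ofPred_eq, not_or, not_le, not_exists, not_and, not_lt] at hcon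
  obtain ⟨hd, hc⟩ := hcon
  obtain ⟨t, ht, hq⟩ := hω
  have hX' := hX n hn
  have hct := hc t ht
  have hL : -((S n).lam1 + (S n).lam2) * t ≤ ∫ s in (0 : ℝ)..t,
      generator R (S n) (trunc (S n) (K * n) fun _ ↦ ((K * n : ℕ) : ℝ)) (X n s.toNNReal ω) := by
    have := intervalIntegral.integral_mono_on t.coe_nonneg intervalIntegrable_const
      ((hX'.rightRegular (generator R (S n) (trunc (S n) (K * n) fun _ ↦ ((K * n : ℕ) : ℝ)))
        ω).intervalIntegrable 0 t) fun s _ ↦ neg_le_generator_trunc_const h.pos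
        (h.lam1_pos n hn).le (h.lam2_pos n hn).le (K * n)
        (inBox_of_mem (hX'.mem_stateSpace s.toNNReal ω))
    rw [intervalIntegral.integral_const, sub_zero, smul_eq_mul] at this
    linarith
  have h0 : trunc (S n) (K * n) (fun _ ↦ ((K * n : ℕ) : ℝ)) (X n t ω) = 0 :=
    trunc_eq_zero _ hq.le
  have h00 := trunc_const (N := K * n) (inBox_of_mem (hX'.mem_stateSpace 0 ω))
  have hroom : ((K * n : ℕ) : ℝ) - (X n 0 ω).q1 - (X n 0 ω).q2 ≤ room (K * n) (X n 0 ω) :=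
    le_max_right _ _
  rw [dist_pi_lt_iff one_pos] at hd
  have d0 := abs_lt.1 (hd 0)
  have d1 := abs_lt.1 (hd 1)
  have a0 := le_abs_self (x₀ 0)
  have a1 := le_abs_self (x₀ 1)
  have e0 : scaled n (X n 0 ω) 0 = (X n 0 ω).q1 / n := rfl
  have e1 : scaled n (X n 0 ω) 1 = (X n 0 ω).q2 / n := rfl
  rw [e0] at d0
  rw [e1] at d1
  have b0 : ((X n 0 ω).q1 : ℝ) < (|x₀ 0| + 1) * n := by
    rw [← div_lt_iff₀ hn']; linarith [d0.2]
  have b1 : ((X n 0 ω).q2 : ℝ) < (|x₀ 1| + 1) * n := by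
    rw [← div_lt_iff₀ hn']; linarith [d1.2]
  have b2 : ((S n).lam1 + (S n).lam2) * t ≤ (l.lam1 + l.lam2 + 1) * τ * n := by
    rw [← add_div, div_lt_iff₀ hn'] at hlam
    have h3 : (0 : ℝ) ≤ (S n).lam1 + (S n).lam2 :=
      add_nonneg (h.lam1_pos n hn).le (h.lam2_pos n hn).le
    calc ((S n).lam1 + (S n).lam2) * t ≤ ((S n).lam1 + (S n).lam2) * τ :=
          mul_le_mul_of_nonneg_left (NNReal.coe_le_coe.2 ht) h3
      _ ≤ (l.lam1 + l.lam2 + 1) * n * τ := mul_le_mul_of_nonneg_right hlam.le τ.coe_nonneg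
      _ = _ := by ring
  have b3 := mul_lt_mul_of_pos_right hK hn'
  have b4 := (abs_le.1 hct).1
  rw [comp, h0, h00] at b4
  push_cast at hroom
  push_cast at b4 hL
  linarith

lemma abs_coord_le {S : Scale} {x : State} (hx : InBox S x) (j : Fin 3) :
    |coord j x| ≤ x.q1 + x.q2 + S.m1 + S.m2 := by
  have a1 : (x.z21 : ℝ) ≤ S.m1 := by exact_mod_cast (by have := hx.1; omega : x.z21 ≤ S.m1)
  have a2 : (x.z12 : ℝ) ≤ S.m2 := by exact_mod_cast (by have := hx.2; omega : x.z12 ≤ S.m2)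
  have p1 : (0 : ℝ) ≤ x.q1 := by positivity
  have p2 : (0 : ℝ) ≤ x.q2 := by positivity
  have p3 : (0 : ℝ) ≤ x.z21 := by positivity
  have p4 : (0 : ℝ) ≤ x.z12 := by positivity
  rw [abs_le]
  fin_cases j <;> simp [coord] <;> constructor <;> linarith

/-- The compensated fluid coordinates are of order `√n`. -/
lemma Regime.vanishing_comp_coord [∀ n, IsProbabilityMeasure (P n)] (h : Regime R S l)
    (hX : ∀ n, 1 ≤ n → IsChain R (S n) (𝓕 n) (P n) (X n)) {x₀ : Fin 3 → ℝ}
    (hx₀ : InitClose P X x₀) (τ : ℝ≥0) {e : ℕ → ℝ}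
    (he : Tendsto (fun n : ℕ ↦ e n / √n) atTop atTop) :
    Vanishing P (fun n ↦ {ω | ∃ j, ∃ t ≤ τ,
      e n < |comp R (S n) (coord j) (fun s ↦ X n s ω) t|}) := by
  obtain ⟨K, hK⟩ := h.exists_containment hX hx₀ τ
  obtain ⟨K', hK'⟩ := exists_nat_gt (l.m1 + l.m2)
  -- While the total queue is at most `K n`, the coordinates are at most `(K + K') n`. The level
  -- leaves room for both and for the margin `2` of `generator_trunc_eq`.
  have h1 := Vanishing.iUnion_fin fun j : Fin 3 ↦ h.vanishing_comp_trunc (P := P) hX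
    (f := fun n ↦ coord j) (fun n ↦ unitJumps_coord j) (2 * K + K' + 2) τ he
  refine (hK.union h1).mono ?_
  filter_upwards [eventually_ge_atTop 1,
    (h.m1.add h.m2).eventually (eventually_lt_nhds hK')] with n hn hm ω hω
  have hn' : (1 : ℝ) ≤ n := by exact_mod_cast hn
  by_contra hcon
  simp only [mem_union, mem_iUnion, mem_ofPred_eq, not_or, not_exists, not_and, not_lt] at hcon
  obtain ⟨hq, hc⟩ := hcon
  obtain ⟨j, t, ht, hlt⟩ := hω
  refine absurd (hc j t ht) (not_le.2 ?_)
  have hbox : ∀ s, InBox (S n) (X n s ω) := fun s ↦ inBox_of_mem ((hX n hn).mem_stateSpace s ω)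
  have hroom : ∀ s ≤ τ, |coord j (X n s ω)| + 2 ≤ room ((2 * K + K' + 2) * n) (X n s ω) := by
    intro s hs
    have h2 : (((X n s ω).q1 + (X n s ω).q2 : ℕ) : ℝ) ≤ (K * n : ℕ) := Nat.cast_le.2 (hq s hs)
    have h3 := abs_coord_le (hbox s) j
    rw [← add_div, div_lt_iff₀ (by linarith)] at hm
    refine le_trans ?_ (le_max_right _ _)
    push_cast at h2 ⊢
    nlinarith
  have hgen : ∫ s in (0 : ℝ)..t, generator R (S n) (trunc (S n) ((2 * K + K' + 2) * n) (coord j))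
      (X n s.toNNReal ω) = ∫ s in (0 : ℝ)..t, generator R (S n) (coord j) (X n s.toNNReal ω) := by
    refine intervalIntegral.integral_congr fun s hs ↦ ?_
    rw [uIcc_of_le t.coe_nonneg] at hs
    exact generator_trunc_eq (unitJumps_coord j) (hbox _)
      (hroom _ ((Real.toNNReal_le_iff_le_coe.2 hs.2).trans ht))
  have htr : ∀ s ≤ τ, trunc (S n) ((2 * K + K' + 2) * n) (coord j) (X n s ω)
      = coord j (X n s ω) := fun s hs ↦ trunc_eq (hbox s) (by linarith [hroom s hs])
  rw [comp, htr t ht, htr 0 zero_le, hgen]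
  exact hlt

end

section

/-! ### The integral representation -/

/-- The integrand of the integral representation in the state `x` of the chain. -/
def field (R : Rates) (S : Scale) (n : ℕ) (x : State) (y : Fin 3 → ℝ) : Fin 3 → ℝ :=
  ![S.lam1 / n - R.mu11 * (S.m1 / n) - R.mu12 * ((if 0 < diff12 R S x then 1 else 0) * y 2)
      - R.mu22 * ((if 0 < diff12 R S x then 1 else 0) * (S.m2 / n - y 2)) - R.theta1 * y 0,
    S.lam2 / n - R.mu22 * ((if diff12 R S x ≤ 0 then 1 else 0) * (S.m2 / n - y 2))
      - R.mu12 * ((if diff12 R S x ≤ 0 then 1 else 0) * y 2) - R.theta2 * y 1,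
    R.mu22 * ((if 0 < diff12 R S x then 1 else 0) * (S.m2 / n - y 2))
      - R.mu12 * ((if diff12 R S x ≤ 0 then 1 else 0) * y 2)]

lemma drift_div {R : Rates} {S : Scale} (n : ℕ) (x : State) (j : Fin 3) :
    drift R S x j / n = field R S n x (scaled n x) j := by
  fin_cases j <;> simp [drift, field, scaled] <;> split_ifs <;> ring

/-- A Lipschitz constant of the integrand. -/
def lipConst (R : Rates) : ℝ := R.mu12 + R.mu22 + R.theta1 + R.theta2

lemma lipConst_pos {R : Rates} (hR : R.Pos) : 0 < lipConst R := by
  have := hR.mu12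
  have := hR.mu22
  have := hR.theta1
  have := hR.theta2
  unfold lipConst
  positivity

lemma abs_field_sub_le {R : Rates} {S : Scale} (hR : R.Pos) (n : ℕ) (x : State)
    (y y' : Fin 3 → ℝ) (j : Fin 3) :
    |field R S n x y j - field R S n x y' j| ≤ lipConst R * dist y y' := by
  have h0 : |y 0 - y' 0| ≤ dist y y' := dist_le_pi_dist y y' 0
  have h1 : |y 1 - y' 1| ≤ dist y y' := dist_le_pi_dist y y' 1
  have h2 : |y 2 - y' 2| ≤ dist y y' := dist_le_pi_dist y y' 2
  set d := dist y y'
  have p1 := mul_le_mul_of_nonneg_left h0 hR.theta1.le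
  have p2 := mul_le_mul_of_nonneg_left h1 hR.theta2.le
  have p3 := mul_le_mul_of_nonneg_left h2 hR.mu12.le
  have p4 := mul_le_mul_of_nonneg_left h2 hR.mu22.le
  have q1 := abs_nonneg (y 0 - y' 0)
  have q2 := abs_nonneg (y 1 - y' 1)
  have q3 := abs_nonneg (y 2 - y' 2)
  have r1 := mul_nonneg hR.theta1.le q1
  have r2 := mul_nonneg hR.theta2.le q2
  have r3 := mul_nonneg hR.mu12.le q3
  have r4 := mul_nonneg hR.mu22.le q3
  have s1 : |R.theta1 * (y 0 - y' 0)| = R.theta1 * |y 0 - y' 0| := by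
    rw [abs_mul, abs_of_pos hR.theta1]
  have s2 : |R.theta2 * (y 1 - y' 1)| = R.theta2 * |y 1 - y' 1| := by
    rw [abs_mul, abs_of_pos hR.theta2]
  have s3 : |R.mu12 * (y 2 - y' 2)| = R.mu12 * |y 2 - y' 2| := by
    rw [abs_mul, abs_of_pos hR.mu12]
  have s4 : |R.mu22 * (y 2 - y' 2)| = R.mu22 * |y 2 - y' 2| := by
    rw [abs_mul, abs_of_pos hR.mu22]
  have t1 := abs_le.1 s1.le
  have t2 := abs_le.1 s2.le
  have t3 := abs_le.1 s3.le
  have t4 := abs_le.1 s4.le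
  rw [abs_le, lipConst]
  by_cases hd : 0 < diff12 R S x
  · have hd' : ¬ diff12 R S x ≤ 0 := not_le.2 hd
    fin_cases j <;> simp [field, hd, hd'] <;> constructor <;>
      linarith [t1.1, t1.2, t2.1, t2.2, t3.1, t3.2, t4.1, t4.2]
  · have hd' : diff12 R S x ≤ 0 := not_lt.1 hd
    fin_cases j <;> simp [field, hd, hd'] <;> constructor <;>
      linarith [t1.1, t1.2, t2.1, t2.2, t3.1, t3.2, t4.1, t4.2]

variable {Ω : Type*} {mΩ : MeasurableSpace Ω} {R : Rates} {S : Scale} {𝓕 : Filtration ℝ≥0 mΩ}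
  {P : Measure Ω} {X : ℝ≥0 → Ω → State}

lemma IsChain.rightRegular_indPos (h : IsChain R S 𝓕 P X) (ω : Ω) :
    RightRegular (fun s : ℝ ↦ indPos R S (fun s ↦ X s ω) s.toNNReal) :=
  h.rightRegular (fun x ↦ if 0 < diff12 R S x then 1 else 0) ω

lemma IsChain.rightRegular_indNonpos (h : IsChain R S 𝓕 P X) (ω : Ω) :
    RightRegular (fun s : ℝ ↦ indNonpos R S (fun s ↦ X s ω) s.toNNReal) :=
  h.rightRegular (fun x ↦ if diff12 R S x ≤ 0 then 1 else 0) ω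

lemma IsChain.rightRegular_field (h : IsChain R S 𝓕 P X) (n : ℕ) (ω : Ω) {y : ℝ≥0 → Fin 3 → ℝ}
    (hy : ∀ j, RightRegular (fun s : ℝ ↦ y s.toNNReal j)) (j : Fin 3) :
    RightRegular (fun s : ℝ ↦ field R S n (X s.toNNReal ω) (y s.toNNReal) j) := by
  have hp := h.rightRegular_indPos ω
  have hm := h.rightRegular_indNonpos ω
  have c := RightRegular.const
  fin_cases j
  · exact ((((c _).sub (c _)).sub ((c _).mul (hp.mul (hy 2)))).sub
      ((c _).mul (hp.mul ((c _).sub (hy 2))))).sub ((c _).mul (hy 0))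
  · exact (((c _).sub ((c _).mul (hm.mul ((c _).sub (hy 2))))).sub
      ((c _).mul (hm.mul (hy 2)))).sub ((c _).mul (hy 1))
  · exact ((c _).mul (hp.mul ((c _).sub (hy 2)))).sub ((c _).mul (hm.mul (hy 2)))

lemma IsChain.integralMap_eq (h : IsChain R S 𝓕 P X) (n : ℕ) (ω : Ω) {y : ℝ≥0 → Fin 3 → ℝ}
    (hy : ∀ j, RightRegular (fun s : ℝ ↦ y s.toNNReal j)) (t : ℝ≥0) (j : Fin 3) :
    integralMap R S n (fun s ↦ X s ω) y t j = scaled n (X 0 ω) j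
      + ∫ s in (0 : ℝ)..t, field R S n (X s.toNNReal ω) (y s.toNNReal) j := by
  have hp := h.rightRegular_indPos ω
  have hm := h.rightRegular_indNonpos ω
  have c := RightRegular.const
  have i0 := (hy 0).intervalIntegrable 0 t
  have i1 := (hy 1).intervalIntegrable 0 t
  have p1 := (hp.mul (hy 2)).intervalIntegrable 0 t
  have p2 := (hp.mul ((c (S.m2 / n)).sub (hy 2))).intervalIntegrable 0 t
  have m1 := (hm.mul (hy 2)).intervalIntegrable 0 t
  have m2 := (hm.mul ((c (S.m2 / n)).sub (hy 2))).intervalIntegrable 0 t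
  fin_cases j
  · have e : ∫ s in (0 : ℝ)..t, field R S n (X s.toNNReal ω) (y s.toNNReal) 0
        = ∫ s in (0 : ℝ)..t, (S.lam1 / n - R.mu11 * (S.m1 / n)
          - R.mu12 * (indPos R S (fun s ↦ X s ω) s.toNNReal * y s.toNNReal 2)
          - R.mu22 * (indPos R S (fun s ↦ X s ω) s.toNNReal * (S.m2 / n - y s.toNNReal 2))
          - R.theta1 * y s.toNNReal 0) := rfl
    show integralMap R S n (fun s ↦ X s ω) y t 0 = scaled n (X 0 ω) 0 + ∫ s in (0 : ℝ)..t,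
      field R S n (X s.toNNReal ω) (y s.toNNReal) 0
    rw [e, intervalIntegral.integral_sub (((intervalIntegrable_const.sub (p1.const_mul _))).sub
        (p2.const_mul _)) (i0.const_mul _), intervalIntegral.integral_sub
        (intervalIntegrable_const.sub (p1.const_mul _)) (p2.const_mul _),
      intervalIntegral.integral_sub intervalIntegrable_const (p1.const_mul _)]
    simp only [intervalIntegral.integral_const_mul, intervalIntegral.integral_const, integralMap]
    simp
    ring
  · have e : ∫ s in (0 : ℝ)..t, field R S n (X s.toNNReal ω) (y s.toNNReal) 1
        = ∫ s in (0 : ℝ)..t, (S.lam2 / n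
          - R.mu22 * (indNonpos R S (fun s ↦ X s ω) s.toNNReal * (S.m2 / n - y s.toNNReal 2))
          - R.mu12 * (indNonpos R S (fun s ↦ X s ω) s.toNNReal * y s.toNNReal 2)
          - R.theta2 * y s.toNNReal 1) := rfl
    show integralMap R S n (fun s ↦ X s ω) y t 1 = scaled n (X 0 ω) 1 + ∫ s in (0 : ℝ)..t,
      field R S n (X s.toNNReal ω) (y s.toNNReal) 1
    rw [e, intervalIntegral.integral_sub (((intervalIntegrable_const.sub (m2.const_mul _))).sub
        (m1.const_mul _)) (i1.const_mul _), intervalIntegral.integral_sub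
        (intervalIntegrable_const.sub (m2.const_mul _)) (m1.const_mul _),
      intervalIntegral.integral_sub intervalIntegrable_const (m2.const_mul _)]
    simp only [intervalIntegral.integral_const_mul, intervalIntegral.integral_const, integralMap]
    simp
    ring
  · have e : ∫ s in (0 : ℝ)..t, field R S n (X s.toNNReal ω) (y s.toNNReal) 2
        = ∫ s in (0 : ℝ)..t, (
          R.mu22 * (indPos R S (fun s ↦ X s ω) s.toNNReal * (S.m2 / n - y s.toNNReal 2))
          - R.mu12 * (indNonpos R S (fun s ↦ X s ω) s.toNNReal * y s.toNNReal 2)) := rfl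
    show integralMap R S n (fun s ↦ X s ω) y t 2 = scaled n (X 0 ω) 2 + ∫ s in (0 : ℝ)..t,
      field R S n (X s.toNNReal ω) (y s.toNNReal) 2
    rw [e, intervalIntegral.integral_sub (p2.const_mul _) (m1.const_mul _)]
    simp only [intervalIntegral.integral_const_mul, integralMap]
    simp
    ring

/-- The system of integral equations is solvable. -/
lemma IsChain.exists_solvesOn (h : IsChain R S 𝓕 P X) (n : ℕ) (τ : ℝ≥0) (ω : Ω) :
    ∃ y, SolvesOn R S n (fun s ↦ X s ω) τ y := by
  have hp := h.rightRegular_indPos ω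
  have hm := h.rightRegular_indNonpos ω
  have c := RightRegular.const
  -- The system is triangular: the equation for `Z₁₂` is a closed linear equation, and its solution
  -- then enters the two queue equations as a known forcing term.
  obtain ⟨y2, hc2, h2⟩ := RightRegular.exists_linear_solution
    (((c R.mu22).mul hp).add ((c R.mu12).mul hm)) ((c R.mu22).mul (hp.mul (c (S.m2 / n))))
    (scaled n (X 0 ω) 2)
  have r2 := RightRegular.of_continuous hc2
  obtain ⟨y0, hc0, h0⟩ := RightRegular.exists_linear_solution (c R.theta1)
    ((((c (S.lam1 / n)).sub (c (R.mu11 * (S.m1 / n)))).sub ((c R.mu12).mul (hp.mul r2))).sub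
      ((c R.mu22).mul (hp.mul ((c (S.m2 / n)).sub r2)))) (scaled n (X 0 ω) 0)
  obtain ⟨y1, hc1, h1⟩ := RightRegular.exists_linear_solution (c R.theta2)
    (((c (S.lam2 / n)).sub ((c R.mu22).mul (hm.mul ((c (S.m2 / n)).sub r2)))).sub
      ((c R.mu12).mul (hm.mul r2))) (scaled n (X 0 ω) 1)
  let y : ℝ≥0 → Fin 3 → ℝ := fun t ↦ ![y0 t, y1 t, y2 t]
  have hyc : Continuous y := by
    refine continuous_pi fun j ↦ ?_
    fin_cases j
    · exact hc0.comp NNReal.continuous_coe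
    · exact hc1.comp NNReal.continuous_coe
    · exact hc2.comp NNReal.continuous_coe
  have hyr : ∀ j, RightRegular (fun s : ℝ ↦ y s.toNNReal j) := fun j ↦
    RightRegular.of_continuous ((continuous_apply j).comp (hyc.comp continuous_real_toNNReal))
  refine ⟨y, hyc.continuousOn, fun t _ ↦ ?_⟩
  funext j
  rw [h.integralMap_eq n ω hyr t j]
  have hcoe : ∀ s ∈ uIcc (0 : ℝ) t, ((s.toNNReal : ℝ≥0) : ℝ) = s := fun s hs ↦ by
    rw [uIcc_of_le t.coe_nonneg] at hs
    exact Real.coe_toNNReal s hs.1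
  fin_cases j
  · show y0 t = _
    rw [h0 t]
    refine congrArg _ (intervalIntegral.integral_congr fun s hs ↦ ?_)
    simp [field, y, hcoe s hs, indPos]
  · show y1 t = _
    rw [h1 t]
    refine congrArg _ (intervalIntegral.integral_congr fun s hs ↦ ?_)
    simp [field, y, hcoe s hs, indNonpos]
  · show y2 t = _
    rw [h2 t]
    refine congrArg _ (intervalIntegral.integral_congr fun s hs ↦ ?_)
    simp [field, y, hcoe s hs, indNonpos, indPos]
    split_ifs <;> ring1

lemma IsChain.rightRegular_scaled (h : IsChain R S 𝓕 P X) (n : ℕ) (ω : Ω) (j : Fin 3) :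
    RightRegular (fun s : ℝ ↦ scaled n (X s.toNNReal ω) j) :=
  h.rightRegular (fun x ↦ scaled n x j) ω

lemma coord_div_of_good {x : State} (hx : Good x) (n : ℕ) (j : Fin 3) :
    coord j x / n = scaled n x j := by
  fin_cases j <;> simp [coord, scaled, hx.1]

/-- On good paths the distance of the scaled chain to the integral representation is a compensated
process. -/
lemma IsChain.dist_integralMap_le (h : IsChain R S 𝓕 P X) {n : ℕ} (hn : 1 ≤ n) {ω : Ω} {τ : ℝ≥0}
    {η : ℝ} (hgood : ∀ t ≤ τ, Good (X t ω))
    (hc : ∀ j, ∀ t ≤ τ, |comp R S (coord j) (fun s ↦ X s ω) t| ≤ η * n) (t : ℝ≥0) (ht : t ≤ τ) :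
    dist (scaled n (X t ω)) (integralMap R S n (fun s ↦ X s ω) (fun s ↦ scaled n (X s ω)) t)
      ≤ η := by
  have hn' : (0 : ℝ) < n := by exact_mod_cast hn
  have hη : 0 ≤ η := by
    have := (abs_nonneg _).trans (hc 0 t ht)
    exact nonneg_of_mul_nonneg_left this hn'
  refine (dist_pi_le_iff hη).2 fun j ↦ ?_
  rw [h.integralMap_eq n ω (y := fun s ↦ scaled n (X s ω)) (h.rightRegular_scaled n ω) t j, Real.dist_eq]
  have e : ∫ s in (0 : ℝ)..t, field R S n (X s.toNNReal ω) (scaled n (X s.toNNReal ω)) j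
      = (∫ s in (0 : ℝ)..t, generator R S (coord j) (X s.toNNReal ω)) / n := by
    rw [← intervalIntegral.integral_div]
    refine intervalIntegral.integral_congr fun s hs ↦ ?_
    rw [uIcc_of_le t.coe_nonneg] at hs
    show field R S n (X s.toNNReal ω) (scaled n (X s.toNNReal ω)) j
      = generator R S (coord j) (X s.toNNReal ω) / n
    rw [generator_coord (h.mem_stateSpace _ ω)
      (hgood _ ((Real.toNNReal_le_iff_le_coe.2 hs.2).trans ht)), drift_div]
  rw [e, ← coord_div_of_good (hgood t ht), ← coord_div_of_good (hgood 0 zero_le)]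
  have := hc j t ht
  rw [comp] at this
  rw [← add_div, ← sub_div, abs_div, abs_of_pos hn', div_le_iff₀ hn', ← sub_sub]
  exact this

/-- A solution of the system of integral equations, stopped at `τ`, solves the integrated equation. -/
lemma IsChain.solution_eq (h : IsChain R S 𝓕 P X) {n : ℕ} {ω : Ω} {τ : ℝ≥0}
    {y : ℝ≥0 → Fin 3 → ℝ} (hy : SolvesOn R S n (fun s ↦ X s ω) τ y) :
    Continuous (fun t ↦ y (min t τ)) ∧ ∀ t ≤ τ, ∀ j, y t j = scaled n (X 0 ω) j
      + ∫ s in (0 : ℝ)..t, field R S n (X s.toNNReal ω) (y (min s.toNNReal τ)) j := by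
  have hy'c : Continuous (fun t ↦ y (min t τ)) :=
    hy.1.comp_continuous (by fun_prop) fun t ↦ ⟨zero_le, min_le_right _ _⟩
  have hy'r : ∀ j, RightRegular (fun s : ℝ ↦ y (min s.toNNReal τ) j) := fun j ↦
    RightRegular.of_continuous ((continuous_apply j).comp (hy'c.comp continuous_real_toNNReal))
  refine ⟨hy'c, fun t ht j ↦ ?_⟩
  rw [← h.integralMap_eq n ω (y := fun t ↦ y (min t τ)) hy'r t j, hy.2 t ⟨zero_le, ht⟩]
  have hcongr : ∀ F : ℝ → (Fin 3 → ℝ) → ℝ, ∫ s in (0 : ℝ)..t, F s (y s.toNNReal)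
      = ∫ s in (0 : ℝ)..t, F s (y (min s.toNNReal τ)) := fun F ↦ by
    refine intervalIntegral.integral_congr fun s hs ↦ ?_
    rw [uIcc_of_le t.coe_nonneg] at hs
    show F s _ = F s _
    rw [min_eq_left ((Real.toNNReal_le_iff_le_coe.2 hs.2).trans ht)]
  have e1 := hcongr fun s v ↦ indPos R S (fun s ↦ X s ω) s.toNNReal * v 2
  have e2 := hcongr fun s v ↦ indPos R S (fun s ↦ X s ω) s.toNNReal * (S.m2 / n - v 2)
  have e3 := hcongr fun s v ↦ indNonpos R S (fun s ↦ X s ω) s.toNNReal * v 2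
  have e4 := hcongr fun s v ↦ indNonpos R S (fun s ↦ X s ω) s.toNNReal * (S.m2 / n - v 2)
  have e5 := hcongr fun _ v ↦ v 0
  have e6 := hcongr fun _ v ↦ v 1
  unfold integralMap
  rw [e1, e2, e3, e4, e5, e6]

/-- On good paths the solutions of the system of integral equations are close to the scaled chain. -/
lemma IsChain.dist_solution_le (h : IsChain R S 𝓕 P X) (hR : R.Pos) {n : ℕ} (hn : 1 ≤ n) {ω : Ω}
    {τ : ℝ≥0} {η : ℝ} (hgood : ∀ t ≤ τ, Good (X t ω))
    (hc : ∀ j, ∀ t ≤ τ, |comp R S (coord j) (fun s ↦ X s ω) t| ≤ η * n)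
    {y : ℝ≥0 → Fin 3 → ℝ} (hy : SolvesOn R S n (fun s ↦ X s ω) τ y) (t : ℝ≥0) (ht : t ≤ τ) :
    dist (scaled n (X t ω)) (y t) ≤ η + η * Real.exp (lipConst R * τ) := by
  have hn' : (0 : ℝ) < n := by exact_mod_cast hn
  have hη : 0 ≤ η := nonneg_of_mul_nonneg_left ((abs_nonneg _).trans (hc 0 t ht)) hn'
  have hL := lipConst_pos hR
  obtain ⟨hy'c, hsol'⟩ := h.solution_eq hy
  obtain ⟨y', hy'⟩ : ∃ y' : ℝ≥0 → Fin 3 → ℝ, y' = fun t ↦ y (min t τ) := ⟨_, rfl⟩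
  rw [← hy'] at hy'c
  have hy'r : ∀ j, RightRegular (fun s : ℝ ↦ y' s.toNNReal j) := fun j ↦
    RightRegular.of_continuous ((continuous_apply j).comp (hy'c.comp continuous_real_toNNReal))
  have hxr := h.rightRegular_scaled n ω
  have hy'eq : ∀ t ≤ τ, y' t = y t := fun t ht ↦ by simp only [hy', min_eq_left ht]
  have hsol : ∀ t ≤ τ, ∀ j, y' t j = scaled n (X 0 ω) j
      + ∫ s in (0 : ℝ)..t, field R S n (X s.toNNReal ω) (y' s.toNNReal) j := fun t ht j ↦ by
    rw [hy'eq t ht, hsol' t ht j, hy']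
  -- `W` is the representation with the chain under the integrals. Unlike the chain it is
  -- continuous, so Grönwall's inequality applies to its distance from the solution.
  obtain ⟨W, hWd⟩ : ∃ W : ℝ → Fin 3 → ℝ, ∀ t j, W t j = scaled n (X 0 ω) j
      + ∫ s in (0 : ℝ)..t, field R S n (X s.toNNReal ω) (scaled n (X s.toNNReal ω)) j :=
    ⟨fun t j ↦ _, fun t j ↦ rfl⟩
  have hWc : Continuous W := continuous_pi fun j ↦ by
    simp_rw [hWd]
    exact continuous_const.add ((h.rightRegular_field n ω (y := fun s ↦ scaled n (X s ω)) hxr j).continuous_integral 0)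
  have hW : ∀ t ≤ τ, dist (scaled n (X t ω)) (W t) ≤ η := by
    intro t ht
    have e : integralMap R S n (fun s ↦ X s ω) (fun s ↦ scaled n (X s ω)) t = W t :=
      funext fun j ↦ (h.integralMap_eq n ω (y := fun s ↦ scaled n (X s ω)) hxr t j).trans (hWd t j).symm
    rw [← e]
    exact h.dist_integralMap_le hn hgood hc t ht
  obtain ⟨u, hud⟩ : ∃ u : ℝ → ℝ, u = fun s ↦ dist (W s) (y' s.toNNReal) := ⟨_, rfl⟩
  have hu0 : ∀ s, 0 ≤ u s := fun s ↦ by rw [hud]; exact dist_nonneg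
  have huc : Continuous u := by
    rw [hud]
    exact hWc.dist (hy'c.comp continuous_real_toNNReal)
  have hu : ∀ t ∈ Icc (0 : ℝ) τ, u t ≤ ∫ s in (0 : ℝ)..t, lipConst R * (η + u s) := by
    intro t ht
    have hcont : Continuous fun s ↦ lipConst R * (η + u s) := by fun_prop
    have hpos : 0 ≤ ∫ s in (0 : ℝ)..t, lipConst R * (η + u s) :=
      intervalIntegral.integral_nonneg ht.1 fun s _ ↦
        mul_nonneg hL.le (add_nonneg hη (hu0 s))
    rw [show u t = dist (W t) (y' t.toNNReal) by rw [hud]]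
    refine (dist_pi_le_iff hpos).2 fun j ↦ ?_
    have htt : (t.toNNReal : ℝ) = t := Real.coe_toNNReal t ht.1
    have htτ : t.toNNReal ≤ τ := Real.toNNReal_le_iff_le_coe.2 ht.2
    have f1 := (h.rightRegular_field n ω (y := fun s ↦ scaled n (X s ω)) hxr j).intervalIntegrable 0 t
    have f2 := (h.rightRegular_field n ω hy'r j).intervalIntegrable 0 t
    have e := hsol t.toNNReal htτ j
    rw [htt] at e
    rw [e, Real.dist_eq, hWd, add_sub_add_left_eq_sub, ← intervalIntegral.integral_sub f1 f2]
    refine (intervalIntegral.abs_integral_le_integral_abs ht.1).trans ?_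
    refine intervalIntegral.integral_mono_on ht.1 (f1.sub f2).abs
      (hcont.intervalIntegrable _ _) fun s hs ↦ ?_
    refine (abs_field_sub_le hR n _ _ _ j).trans (mul_le_mul_of_nonneg_left ?_ hL.le)
    rw [show u s = dist (W s) (y' s.toNNReal) by rw [hud]]
    refine (dist_triangle _ (W s) _).trans (add_le_add_left ?_ _)
    have := hW s.toNNReal ((Real.toNNReal_le_toNNReal hs.2).trans htτ)
    rwa [Real.coe_toNNReal s hs.1] at this
  have hfin := gronwall_integral huc hL hη hu t ⟨t.coe_nonneg, NNReal.coe_le_coe.2 ht⟩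
  rw [← hy'eq t ht]
  refine (dist_triangle _ (W t) _).trans (add_le_add (hW t ht) ?_)
  simp only [hud, Real.toNNReal_coe] at hfin
  exact hfin

/-! ### Asymptotic equivalence -/

/-- The identity is an admissible time change. -/
lemma dJ1_le {τ : ℝ≥0} {x y : ℝ≥0 → Fin 3 → ℝ} {η : ℝ} (h : ∀ t ≤ τ, dist (x t) (y t) ≤ η) :
    dJ1 τ x y ≤ ENNReal.ofReal η := by
  refine (iInf_le _ (OrderIso.refl _)).trans (max_le ?_ ?_)
  · simp
  · refine iSup_le fun t ↦ ?_
    rw [edist_dist]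
    exact ENNReal.ofReal_le_ofReal (h _ t.2.2)

lemma good_of_lt_exitTime {p : ℝ≥0 → State} {τ t : ℝ≥0} (h : (τ : ℝ≥0∞) < exitTime p)
    (h0 : 0 < t) (ht : t ≤ τ) : Good (p t) := by
  have hno : ¬ (0 < (p t).z21 ∨ (p t).q1 = 0 ∨ (p t).q2 = 0) := fun hcon ↦ by
    have h1 : exitTime p ≤ t := sInf_le ⟨t, h0, hcon, rfl⟩
    exact absurd (h.trans_le h1) (not_lt.2 (by exact_mod_cast ht))
  unfold Good
  omega

section Sequences

variable {R : Rates} {S : ℕ → Scale} {l : Limits} {Ω : ℕ → Type*} [mΩ : ∀ n, MeasurableSpace (Ω n)]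
  {P : ∀ n, Measure (Ω n)} [∀ n, IsProbabilityMeasure (P n)]
  {𝓕 : ∀ n, Filtration ℝ≥0 (mΩ n)} {X : ∀ n, ℝ≥0 → Ω n → State}

/-- The exit time tests only positive times; right-continuity at zero gives the initial state as
well. The event `E n` is built from countably many times to be measurable, so that one may pass to
its complement. -/
lemma vanishing_not_good (hX : ∀ n, 1 ≤ n → IsChain R (S n) (𝓕 n) (P n) (X n)) {τ : ℝ≥0}
    (hτ : 0 < τ) (hexit : ExitsAfter P X τ) :
    Vanishing P (fun n ↦ {ω | ∃ t ≤ τ, ¬ Good (X n t ω)}) := by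
  let E : ∀ n, Set (Ω n) := fun n ↦
    ⋂ q : {q : ℚ // 0 < q}, {ω | Good (X n (min τ (Real.toNNReal q)) ω)}
  have hE1 : Tendsto (fun n ↦ P n (E n)) atTop (𝓝 1) := by
    refine tendsto_of_tendsto_of_tendsto_of_le_of_le hexit tendsto_const_nhds
      (fun n ↦ measure_mono fun ω hω ↦ mem_iInter.2 fun q ↦ ?_) fun n ↦ prob_le_one
    refine good_of_lt_exitTime (p := fun t ↦ X n t ω) hω (lt_min hτ ?_) (min_le_left _ _)
    exact Real.toNNReal_pos.2 (by exact_mod_cast q.2)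
  have hE0 : Vanishing P (fun n ↦ (E n)ᶜ) := by
    have h1 : Tendsto (fun n ↦ 1 - P n (E n)) atTop (𝓝 (1 - 1)) :=
      ENNReal.Tendsto.sub tendsto_const_nhds hE1 (by simp)
    rw [tsub_self] at h1
    refine h1.congr' ?_
    filter_upwards [eventually_ge_atTop 1] with n hn
    refine (prob_compl_eq_one_sub (MeasurableSet.iInter fun q ↦ ?_)).symm
    exact measurableSet_preimage ((hX n hn).measurable (min τ (Real.toNNReal q)))
      (show MeasurableSet {x | Good x} from trivial)
  refine hE0.mono ?_
  filter_upwards [eventually_ge_atTop 1] with n hn ω hω hωE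
  obtain ⟨t, ht, hbad⟩ := hω
  exact hbad ((hX n hn).forall_le_of_rat (G := {x | Good x})
    (fun q hq ↦ mem_iInter.1 hωE ⟨q, hq⟩) t ht)

/-- Off the vanishing events of `hvan` all states are good and the compensated coordinates are at
most `η n`. The rest is pathwise, by `IsChain.dist_integralMap_le` and `IsChain.dist_solution_le`.
-/
lemma Regime.asymptoticallyEquivalent (h : Regime R S l)
    (hX : ∀ n, 1 ≤ n → IsChain R (S n) (𝓕 n) (P n) (X n)) {x₀ : Fin 3 → ℝ}
    (hx₀ : InitClose P X x₀) {τ : ℝ≥0} (hτ : 0 < τ) (hexit : ExitsAfter P X τ) :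
    AsymptoticallyEquivalent R S P X τ := by
  have hvan : ∀ η > 0, Vanishing P (fun n ↦ {ω | ∃ t ≤ τ, ¬ Good (X n t ω)} ∪
      {ω | ∃ j, ∃ t ≤ τ, η * n < |comp R (S n) (coord j) (fun s ↦ X n s ω) t|}) := fun η hη ↦
    (vanishing_not_good hX hτ hexit).union
      (h.vanishing_comp_coord hX hx₀ τ (tendsto_div_sqrt_of_linear hη))
  refine ⟨fun ε hε ↦ ?_, fun n hn ω ↦ (hX n hn).exists_solvesOn n τ ω, fun Y hY ε hε ↦ ?_⟩
  · refine (hvan (ε / 2) (by positivity)).mono ?_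
    filter_upwards [eventually_ge_atTop 1] with n hn ω hω
    by_contra hcon
    simp only [mem_union, mem_ofPred_eq, not_or, not_exists, not_and, not_not, not_lt] at hcon
    have := dJ1_le ((hX n hn).dist_integralMap_le hn hcon.1 hcon.2)
    exact absurd (le_trans hω this) (not_le.2 ((ENNReal.ofReal_lt_ofReal_iff hε).2 (by linarith)))
  · set D := 1 + Real.exp (lipConst R * τ) with hD
    have hD0 : 0 < D := by positivity
    have hae : Vanishing P (fun n ↦ {ω | ¬ SolvesOn R (S n) n (fun s ↦ X n s ω) τ
        (fun t ↦ Y n t ω)}) := Vanishing.of_eventually_zero <| by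
      filter_upwards [eventually_ge_atTop 1] with n hn
      exact hY n hn
    -- Grönwall multiplies the error by `D`; this choice leaves `ε / 2`, strictly below `ε`.
    refine (hae.union (hvan (ε / (2 * D)) (by positivity))).mono ?_
    filter_upwards [eventually_ge_atTop 1] with n hn ω hω
    by_contra hcon
    simp only [mem_union, mem_ofPred_eq, not_or, not_exists, not_and, not_not, not_lt] at hcon
    have := dJ1_le ((hX n hn).dist_solution_le h.pos hn hcon.2.1 hcon.2.2 hcon.1)
    refine absurd (le_trans hω this) (not_le.2 ((ENNReal.ofReal_lt_ofReal_iff hε).2 ?_))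
    have : ε / (2 * D) + ε / (2 * D) * Real.exp (lipConst R * τ) = ε / 2 := by
      rw [hD]; field_simp
    linarith

end Sequences

end

section

/-! ### Initial conditions and exit times -/

lemma limsup_measure_preimage_le {E : Type*} [TopologicalSpace E] [MeasurableSpace E]
    [BorelSpace E] [HasOuterApproxClosed E] {Ω : ℕ → Type*} [mΩ : ∀ n, MeasurableSpace (Ω n)]
    {P : ∀ n, Measure (Ω n)} [∀ n, IsProbabilityMeasure (P n)] {Ω' : Type*} [MeasurableSpace Ω']
    {P' : Measure Ω'} [IsProbabilityMeasure P'] {Y : ∀ n, Ω n → E} {Z : Ω' → E}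
    (h : TendstoInDistribution Y atTop Z P P') {F : Set E} (hF : IsClosed F) :
    limsup (fun n ↦ P n (Y n ⁻¹' F)) atTop ≤ P' (Z ⁻¹' F) := by
  have h1 := ProbabilityMeasure.limsup_measure_closed_le_of_tendsto h.tendsto hF
  simp only [ProbabilityMeasure.coe_mk] at h1
  rw [Measure.map_apply_of_aemeasurable h.aemeasurable_limit hF.measurableSet] at h1
  simpa only [Measure.map_apply_of_aemeasurable (h.forall_aemeasurable _) hF.measurableSet] using h1

section Single

variable {Ω : Type*} {mΩ : MeasurableSpace Ω} {R : Rates} {S : Scale} {𝓕 : Filtration ℝ≥0 mΩ}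
  {P : Measure Ω} {X : ℝ≥0 → Ω → State}

/-- If the exit time is at most `τ`, then there is a first state up to time `τ` that is not good. -/
lemma IsChain.exists_first_exit (h : IsChain R S 𝓕 P X) {ω : Ω} {τ : ℝ≥0}
    (hexit : exitTime (fun t ↦ X t ω) ≤ τ) :
    ∃ t ≤ τ, ¬ Good (X t ω) ∧ ∀ s < t, Good (X s ω) := by
  set B : Set ℝ≥0 := {t | ¬ Good (X t ω)} with hB
  have hlt : ∀ τ' > τ, ∃ t ∈ B, t < τ' := by
    intro τ' hτ'
    obtain ⟨_, ⟨t, -, hbad, rfl⟩, ht⟩ := sInf_lt_iff.1 (hexit.trans_lt (ENNReal.coe_lt_coe.2 hτ'))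
    refine ⟨t, ?_, by exact_mod_cast ht⟩
    simp only [hB, Good, mem_ofPred_eq] at hbad ⊢
    omega
  have hne : B.Nonempty := by
    obtain ⟨t, ht, -⟩ := hlt (τ + 1) (lt_add_one _)
    exact ⟨t, ht⟩
  have hbdd : BddBelow B := OrderBot.bddBelow B
  have hbefore : ∀ s < sInf B, Good (X s ω) := fun s hs ↦ by
    by_contra hcon
    exact absurd (csInf_le hbdd hcon) (not_le.2 hs)
  refine ⟨sInf B, ?_, fun hgood ↦ ?_, hbefore⟩
  · refine le_of_forall_gt_imp_ge_of_dense fun τ' hτ' ↦ ?_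
    obtain ⟨t, ht, htτ⟩ := hlt τ' hτ'
    exact (csInf_le hbdd ht).trans htτ.le
  -- If the state at the infimum were good, right-continuity would keep it good for a while
  -- afterwards, against the definition of the infimum.
  · obtain ⟨b, hb, hsub⟩ := mem_nhdsGT_iff_exists_Ioo_subset.1 (h.right_continuous ω (sInf B))
    obtain ⟨t, ht, htb⟩ := exists_lt_of_csInf_lt hne hb
    rcases (csInf_le hbdd ht).eq_or_lt with heq | hlt'
    · exact ht (heq ▸ hgood)
    · have : X t ω = X (sInf B) ω := hsub ⟨hlt', htb⟩
      exact ht (this ▸ hgood)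

/-- Sharing in the opposite direction does not start while `D₂₁ ≤ 0`. -/
lemma IsChain.measure_z21_pos_eq_zero [IsProbabilityMeasure P] (h : IsChain R S 𝓕 P X) :
    P {ω | ∃ t : ℝ≥0, 0 < t ∧ 0 < (X t ω).z21 ∧
      ∀ s < t, (X s ω).z21 = 0 ∧ diff21 R S (X s ω) ≤ 0} = 0 := by
  classical
  -- The indicator of `Z₂₁ > 0`, cut off at total queue `K` for finite support; a union over `K`
  -- recovers all states.
  let f : ℕ → State → ℝ := fun K x ↦
    if (InBox S x ∧ x.q1 + x.q2 ≤ K) ∧ 0 < x.z21 then 1 else 0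
  have hf : ∀ K, (Function.support (f K)).Finite := fun K ↦
    (finite_inBox S K).subset fun x hx ↦ by
      by_contra hcon
      exact hx (if_neg fun hx' ↦ hcon hx'.1)
  let G : Set State := {x | x.z21 = 0 ∧ diff21 R S x ≤ 0}
  have h0 : ∀ K T : ℕ, P {ω | ∃ t : ℝ≥0, 0 < t ∧ t ≤ T ∧ 1 ≤ f K (X t ω) ∧ ∀ s < t, X s ω ∈ G}
      = 0 := fun K T ↦ by
    refine h.measure_jump_eq_zero (hf K) (fun x ↦ ?_) (fun x hx ↦ ?_) (fun x hx ↦ ?_) T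
    · by_cases hx : (InBox S x ∧ x.q1 + x.q2 ≤ K) ∧ 0 < x.z21
      · exact Or.inr (if_pos hx).ge
      · exact Or.inl (if_neg hx)
    · exact if_neg fun hx' ↦ absurd hx.1 hx'.2.ne'
    · have hz : ∀ y : State, y.z21 = 0 → f K y = 0 := fun y hy ↦
        if_neg fun hy' ↦ absurd hy hy'.2.ne'
      rw [generator_eq_sum]
      exact Finset.sum_eq_zero fun i _ ↦ by
        rw [hz _ (target_z21 hx.1 hx.2 i), hz _ hx.1, sub_zero, mul_zero]
  refine measure_mono_null (fun ω hω ↦ ?_)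
    (measure_iUnion_null fun K ↦ measure_iUnion_null fun T ↦ h0 K T)
  obtain ⟨t, ht, hz, hs⟩ := hω
  obtain ⟨T, hT⟩ := exists_nat_ge t
  refine mem_iUnion.2 ⟨(X t ω).q1 + (X t ω).q2, mem_iUnion.2 ⟨T, t, ht, hT, ?_, hs⟩⟩
  exact (if_pos ⟨⟨inBox_of_mem (h.mem_stateSpace t ω), le_rfl⟩, hz⟩).ge

end Single

section Sequences

variable {R : Rates} {S : ℕ → Scale} {Ω : ℕ → Type*} [mΩ : ∀ n, MeasurableSpace (Ω n)]
  {P : ∀ n, Measure (Ω n)} [∀ n, IsProbabilityMeasure (P n)]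
  {𝓕 : ∀ n, Filtration ℝ≥0 (mΩ n)} {X : ∀ n, ℝ≥0 → Ω n → State}
  {Ω' : Type*} [MeasurableSpace Ω'] {P' : Measure Ω'} [IsProbabilityMeasure P']

lemma initClose_of_tendstoInDistribution {x₀ : Fin 3 → ℝ}
    (h : TendstoInDistribution (fun n ω ↦ scaled n (X n 0 ω)) atTop (fun _ ↦ x₀) P P') :
    InitClose P X x₀ := by
  intro δ hδ
  have hF : IsClosed {v : Fin 3 → ℝ | δ ≤ dist v x₀} :=
    isClosed_le continuous_const (continuous_id.dist continuous_const)
  have h1 := limsup_measure_preimage_le h hF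
  have h2 : (fun _ : Ω' ↦ x₀) ⁻¹' {v : Fin 3 → ℝ | δ ≤ dist v x₀} = ∅ := by
    ext
    simpa using hδ
  rw [h2, measure_empty] at h1
  exact tendsto_of_le_liminf_of_limsup_le zero_le h1

/-- Since `L` is finite, `P'(L ≤ -k) → 0`, and `-b n` eventually lies below each fixed `-k`. -/
lemma vanishing_le_neg_of_tendstoInDistribution {Y : ∀ n, Ω n → ℝ} {L : Ω' → ℝ}
    (h : TendstoInDistribution Y atTop L P P') {b : ℕ → ℝ} (hb : Tendsto b atTop atTop) :
    Vanishing P (fun n ↦ {ω | Y n ω ≤ -b n}) := by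
  have htail : Tendsto (fun k : ℕ ↦ P' (L ⁻¹' Iic (-(k : ℝ)))) atTop (𝓝 0) := by
    have hinter : ⋂ k : ℕ, L ⁻¹' Iic (-(k : ℝ)) = ∅ := by
      refine eq_empty_of_forall_notMem fun ω hω ↦ ?_
      obtain ⟨k, hk⟩ := exists_nat_gt (-L ω)
      have : L ω ≤ -(k : ℝ) := mem_iInter.1 hω k
      linarith
    rw [← measure_empty (μ := P'), ← hinter]
    refine tendsto_measure_iInter_atTop
      (fun k ↦ h.aemeasurable_limit.nullMeasurableSet_preimage measurableSet_Iic)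
      (fun i j hij ↦ preimage_mono (Iic_subset_Iic.2 (neg_le_neg (Nat.cast_le.2 hij))))
      ⟨0, measure_ne_top _ _⟩
  refine ENNReal.tendsto_nhds_zero.2 fun ε hε ↦ ?_
  obtain ⟨k, hk⟩ := (htail.eventually_lt_const hε).exists
  have h1 := (limsup_measure_preimage_le h (isClosed_Iic (a := -(k : ℝ)))).trans_lt hk
  filter_upwards [eventually_lt_of_limsup_lt h1, hb.eventually_ge_atTop (k : ℝ)] with n hn hbn
  refine (measure_mono fun ω hω ↦ ?_).trans hn.le
  exact le_trans (show Y n ω ≤ -b n from hω) (neg_le_neg hbn)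

/-- Subadditivity suffices here; the exit event is not claimed to be measurable. -/
lemma exitsAfter_of_vanishing {τ : ℝ≥0}
    (h : Vanishing P (fun n ↦ {ω | exitTime (fun t ↦ X n t ω) ≤ τ})) : ExitsAfter P X τ := by
  have h1 : Tendsto (fun n ↦ 1 - P n {ω | exitTime (fun t ↦ X n t ω) ≤ τ}) atTop (𝓝 (1 - 0)) :=
    ENNReal.Tendsto.sub tendsto_const_nhds h (by simp)
  rw [tsub_zero] at h1
  refine tendsto_of_tendsto_of_tendsto_of_le_of_le h1 tendsto_const_nhds (fun n ↦ ?_)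
    fun n ↦ prob_le_one
  rw [tsub_le_iff_right, ← measure_univ (μ := P n)]
  refine (measure_mono fun ω _ ↦ ?_).trans (measure_union_le _ _)
  exact lt_or_ge (τ : ℝ≥0∞) (exitTime fun t ↦ X n t ω)

lemma noOppositeSharing_of_exitsAfter
    (hX : ∀ n, 1 ≤ n → IsChain R (S n) (𝓕 n) (P n) (X n)) {τ : ℝ≥0}
    (hτ : 0 < τ) (hexit : ExitsAfter P X τ) : NoOppositeSharing P X τ := by
  intro ε hε
  refine (vanishing_not_good hX hτ hexit).mono (Eventually.of_forall fun n ω hω ↦ ?_)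
  by_contra hcon
  simp only [mem_ofPred_eq, not_exists, not_and, not_not] at hcon
  refine absurd (show ENNReal.ofReal ε ≤ _ from hω) (not_le.2 ?_)
  have h0 : ⨆ t ∈ Icc 0 τ, ((X n t ω).z21 : ℝ≥0∞) = 0 := by
    simp only [ENNReal.iSup_eq_zero]
    intro t ht
    rw [(hcon t ht.2).1, Nat.cast_zero]
  rw [h0]
  exact ENNReal.ofReal_pos.2 hε

end Sequences

end

section

/-! ### The chain before the first exit -/

section Single

variable {Ω : Type*} {mΩ : MeasurableSpace Ω} {R : Rates} {S : Scale} {𝓕 : Filtration ℝ≥0 mΩ}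
  {P : Measure Ω} {X : ℝ≥0 → Ω → State} {ω : Ω} {T : ℝ≥0} {e : ℝ}

/-- The generator is replaced by `drift` only at times before `T`. The state at `T` may fail to be
good, but a single time does not affect the integral. -/
lemma IsChain.abs_sub_integral_drift_le (h : IsChain R S 𝓕 P X)
    (hgood : ∀ s < T, Good (X s ω))
    (hc : ∀ j, ∀ t ≤ T, |comp R S (coord j) (fun s ↦ X s ω) t| ≤ e) (α : Fin 3 → ℝ) {t : ℝ≥0}
    (ht : t ≤ T) :
    |∑ j, α j * coord j (X t ω) - ∑ j, α j * coord j (X 0 ω)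
      - ∫ s in (0 : ℝ)..t, ∑ j, α j * drift R S (X s.toNNReal ω) j| ≤ (∑ j, |α j|) * e := by
  have hint : ∀ j, ∫ s in (0 : ℝ)..t, generator R S (coord j) (X s.toNNReal ω)
      = ∫ s in (0 : ℝ)..t, drift R S (X s.toNNReal ω) j := fun j ↦ by
    refine intervalIntegral.integral_congr_Ioo_of_le t.coe_nonneg fun s hs ↦ ?_
    exact generator_coord (h.mem_stateSpace _ ω)
      (hgood _ (((Real.toNNReal_lt_iff_lt_coe hs.1.le).2 hs.2).trans_le ht)) j
  have hr : ∀ j, IntervalIntegrable (fun s : ℝ ↦ drift R S (X s.toNNReal ω) j) volume 0 t :=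
    fun j ↦ (h.rightRegular (fun x ↦ drift R S x j) ω).intervalIntegrable 0 t
  rw [intervalIntegral.integral_finsetSum fun j _ ↦ (hr j).const_mul _]
  simp only [intervalIntegral.integral_const_mul, ← hint]
  have e1 : ∑ j, α j * coord j (X t ω) - ∑ j, α j * coord j (X 0 ω)
      - ∑ j, α j * ∫ s in (0 : ℝ)..t, generator R S (coord j) (X s.toNNReal ω)
      = ∑ j, α j * comp R S (coord j) (fun s ↦ X s ω) t := by
    rw [← Finset.sum_sub_distrib, ← Finset.sum_sub_distrib]
    exact Finset.sum_congr rfl fun j _ ↦ by rw [comp]; ring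
  rw [e1, Finset.sum_mul]
  refine (Finset.abs_sum_le_sum_abs _ _).trans (Finset.sum_le_sum fun j _ ↦ ?_)
  rw [abs_mul]
  exact mul_le_mul_of_nonneg_left (hc j t ht) (abs_nonneg _)

/-- A linear combination of the fluid coordinates whose drift is nonnegative below the level `κ` does
not fall much below that level. -/
lemma IsChain.excursion_lower_bound (h : IsChain R S 𝓕 P X) (hgood : ∀ s < T, Good (X s ω))
    (hc : ∀ j, ∀ t ≤ T, |comp R S (coord j) (fun s ↦ X s ω) t| ≤ e) (α : Fin 3 → ℝ) {κ c : ℝ}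
    (hc0 : 0 ≤ c) (h0 : κ - c ≤ ∑ j, α j * coord j (X 0 ω))
    (hsign : ∀ s < T, ∑ j, α j * coord j (X s ω) < κ → 0 ≤ ∑ j, α j * drift R S (X s ω) j)
    {t : ℝ≥0} (ht : t ≤ T) :
    κ - c - 2 * ((∑ j, |α j|) * e) ≤ ∑ j, α j * coord j (X t ω) := by
  have := excursion_bound (g := fun s : ℝ ↦ ∑ j, α j * coord j (X s.toNNReal ω) - κ)
    (b := fun s : ℝ ↦ ∑ j, α j * drift R S (X s.toNNReal ω) j) (T := T)
    (ε := (∑ j, |α j|) * e) (c := c)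
    (fun x y ↦ (h.rightRegular (fun x ↦ ∑ j, α j * drift R S x j) ω).intervalIntegrable x y)
    (fun s hs ↦ by
      have h1 := h.abs_sub_integral_drift_le hgood hc α (Real.toNNReal_le_iff_le_coe.2 hs.2)
      rw [Real.coe_toNNReal s hs.1] at h1
      simpa using h1)
    (fun s hs hneg ↦ hsign _ ((Real.toNNReal_lt_iff_lt_coe hs.1).2 hs.2) (by simpa using hneg)) hc0
    (by simp only [Real.toNNReal_zero]; linarith) t ⟨t.coe_nonneg, NNReal.coe_le_coe.2 ht⟩
  simp only [Real.toNNReal_coe] at this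
  linarith

lemma abs_drift_le (hR : R.Pos) (h1 : 0 ≤ S.lam1) (h2 : 0 ≤ S.lam2) {N : ℕ} {x : State}
    (hx : InBox S x) (hq : x.q1 + x.q2 ≤ N) (j : Fin 3) : |drift R S x j| ≤ rateBound R S N := by
  have hq' : (x.q1 : ℝ) + x.q2 ≤ N := by exact_mod_cast hq
  have hz : (x.z12 : ℝ) ≤ S.m2 := by exact_mod_cast (by have := hx.2; omega : x.z12 ≤ S.m2)
  have p1 : (0 : ℝ) ≤ x.q1 := by positivity
  have p2 : (0 : ℝ) ≤ x.q2 := by positivity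
  have p4 : (0 : ℝ) ≤ x.z12 := by positivity
  have p5 : (0 : ℝ) ≤ S.m1 := by positivity
  have a1 := mul_le_mul_of_nonneg_left (show (x.q1 : ℝ) ≤ N by linarith) hR.theta1.le
  have a2 := mul_le_mul_of_nonneg_left (show (x.q2 : ℝ) ≤ N by linarith) hR.theta2.le
  have a3 := mul_le_mul_of_nonneg_left hz hR.mu12.le
  have a4 := mul_le_mul_of_nonneg_left hz hR.mu22.le
  have b1 := mul_nonneg hR.theta1.le p1
  have b2 := mul_nonneg hR.theta2.le p2
  have b3 := mul_nonneg hR.mu12.le p4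
  have b4 := mul_nonneg hR.mu22.le p4
  have b5 := mul_nonneg hR.mu11.le p5
  have b6 := mul_nonneg hR.mu21.le p5
  rw [abs_le, rateBound]
  by_cases hd : 0 < diff12 R S x
  · have hd' : ¬ diff12 R S x ≤ 0 := not_le.2 hd
    fin_cases j <;> simp [drift, hd, hd'] <;> constructor <;> linarith
  · have hd' : diff12 R S x ≤ 0 := not_lt.1 hd
    fin_cases j <;> simp [drift, hd, hd'] <;> constructor <;> linarith

/-- The fluid coordinates divided by `n`. -/
def fluid (n : ℕ) (x : State) : Fin 3 → ℝ := fun j ↦ coord j x / n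

lemma fluid_of_z21 {x : State} (hx : x.z21 = 0) (n : ℕ) : fluid n x = scaled n x := by
  funext j
  fin_cases j <;> simp [fluid, coord, scaled, hx]

/-- For a short time the fluid coordinates stay near their initial values. -/
lemma IsChain.dist_fluid_le (h : IsChain R S 𝓕 P X) (hR : R.Pos) (h1 : 0 ≤ S.lam1)
    (h2 : 0 ≤ S.lam2) {n N : ℕ} (hn : 1 ≤ n) (hgood : ∀ s < T, Good (X s ω))
    (hc : ∀ j, ∀ t ≤ T, |comp R S (coord j) (fun s ↦ X s ω) t| ≤ e)
    (hq : ∀ t ≤ T, (X t ω).q1 + (X t ω).q2 ≤ N) {t : ℝ≥0} (ht : t ≤ T) :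
    dist (fluid n (X t ω)) (fluid n (X 0 ω)) ≤ (e + rateBound R S N * T) / n := by
  have hn' : (0 : ℝ) < n := by exact_mod_cast hn
  have hb : ∀ (s : ℝ≥0) (j : Fin 3), s ≤ T → |drift R S (X s ω) j| ≤ rateBound R S N :=
    fun s j hs ↦ abs_drift_le hR h1 h2 (inBox_of_mem (h.mem_stateSpace s ω)) (hq s hs) j
  have hrb : 0 ≤ rateBound R S N := (abs_nonneg _).trans (hb t 0 ht)
  have he : 0 ≤ e := (abs_nonneg _).trans (hc 0 t ht)
  refine (dist_pi_le_iff (by positivity)).2 fun j ↦ ?_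
  rw [Real.dist_eq, fluid, fluid, ← sub_div, abs_div, abs_of_pos hn']
  refine div_le_div_of_nonneg_right ?_ hn'.le
  have h3 := h.abs_sub_integral_drift_le hgood hc (Pi.single j 1) ht
  have h4 : |∫ s in (0 : ℝ)..t, drift R S (X s.toNNReal ω) j| ≤ rateBound R S N * |(t : ℝ) - 0| :=
    intervalIntegral.norm_integral_le_of_norm_le_const
      (f := fun s : ℝ ↦ drift R S (X s.toNNReal ω) j) (C := rateBound R S N) fun s hs ↦ by
        rw [uIoc_of_le t.coe_nonneg] at hs
        exact hb _ j ((Real.toNNReal_le_iff_le_coe.2 hs.2).trans ht)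
  rw [sub_zero, abs_of_nonneg t.coe_nonneg] at h4
  have h5 : rateBound R S N * t ≤ rateBound R S N * T :=
    mul_le_mul_of_nonneg_left (NNReal.coe_le_coe.2 ht) hrb
  have h6 : ∑ i, |(Pi.single j 1 : Fin 3 → ℝ) i| = 1 := by
    rw [Finset.sum_eq_single j (fun i _ hi ↦ by simp [hi]) (by simp)]
    simp
  rw [h6] at h3
  simp only [one_mul, Pi.single_apply, ite_mul, zero_mul, Finset.sum_ite_eq', Finset.mem_univ,
    if_true] at h3
  rw [abs_le] at h3 h4 ⊢
  constructor <;> linarith [h3.1, h3.2, h4.1, h4.2]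

/-- A path of the chain up to a time `T` before which its states are good: the compensated fluid
coordinates are bounded by `e`, and the fluid-scaled coordinates are within `ρ` of `x₀`. -/
structure EarlyPath (R : Rates) (S : Scale) (n : ℕ) (p : ℝ≥0 → State) (x₀ : Fin 3 → ℝ) (ρ e : ℝ)
    (T : ℝ≥0) : Prop where
  good : ∀ s < T, Good (p s)
  comp_le : ∀ j, ∀ t ≤ T, |comp R S (coord j) p t| ≤ e
  near : ∀ t ≤ T, dist (fluid n (p t)) x₀ < ρ

end Single

section Sequences

variable {R : Rates} {S : ℕ → Scale} {l : Limits} {Ω : ℕ → Type*} [mΩ : ∀ n, MeasurableSpace (Ω n)]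
  {P : ∀ n, Measure (Ω n)} [∀ n, IsProbabilityMeasure (P n)]
  {𝓕 : ∀ n, Filtration ℝ≥0 (mΩ n)} {X : ∀ n, ℝ≥0 → Ω n → State}

/-- The exit time is bounded away from zero if, with probability tending to one, the inequalities
`Q₁ > r₁₂ Q₂` and `Q₂ > 0` persist on early paths. -/
lemma Regime.exists_exitsAfter (h : Regime R S l) (hr : R.r21 ≤ R.r12) (hr0 : 0 < R.r12)
    (hk21 : ∀ n, 1 ≤ n → 0 < (S n).k21)
    (hX : ∀ n, 1 ≤ n → IsChain R (S n) (𝓕 n) (P n) (X n)) {x₀ : Fin 3 → ℝ}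
    (hx₀ : InitClose P X x₀) (hz : ∀ n, 1 ≤ n → ∀ᵐ ω ∂(P n), (X n 0 ω).z21 = 0) {e : ℕ → ℝ}
    (he : Tendsto (fun n : ℕ ↦ e n / n) atTop (𝓝 0))
    (he' : Tendsto (fun n : ℕ ↦ e n / √n) atTop atTop) {ρ : ℝ} (hρ : 0 < ρ) {B : ∀ n, Set (Ω n)}
    (hB : Vanishing P B)
    (hpath : ∀ᶠ n in atTop, ∀ ω ∉ B n, ∀ T, EarlyPath R (S n) n (fun t ↦ X n t ω) x₀ ρ (e n) T →
      (∀ t ≤ T, 0 < coord 0 (X n t ω) - R.r12 * coord 1 (X n t ω)) ∧ 0 < coord 1 (X n T ω)) :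
    ∃ τ : ℝ≥0, 0 < τ ∧ ExitsAfter P X τ := by
  obtain ⟨K, hK⟩ := h.exists_containment hX hx₀ 1
  obtain ⟨C, hC0, hC⟩ := h.exists_rateBound K
  -- Up to `τ` the drift moves the fluid state by at most `C τ ≤ ρ / 4`; the initial error and the
  -- fluctuation take `ρ / 4` each. The bound `1` is the horizon on which the queues were contained,
  -- fixed before `τ` is known.
  obtain ⟨τ, hτ⟩ : ∃ τ : ℝ≥0, τ = min 1 (ρ / (4 * C)).toNNReal := ⟨_, rfl⟩
  have hτ0 : 0 < τ := by
    rw [hτ]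
    exact lt_min one_pos (Real.toNNReal_pos.2 (by positivity))
  have hτ1 : τ ≤ 1 := hτ ▸ min_le_left _ _
  have hτC : C * τ ≤ ρ / 4 := by
    have h1 : (τ : ℝ) ≤ ρ / (4 * C) := by
      rw [← Real.coe_toNNReal (ρ / (4 * C)) (by positivity)]
      exact NNReal.coe_le_coe.2 (hτ ▸ min_le_right _ _)
    calc C * τ ≤ C * (ρ / (4 * C)) := mul_le_mul_of_nonneg_left h1 hC0.le
      _ = ρ / 4 := by field_simp
  refine ⟨τ, hτ0, exitsAfter_of_vanishing ?_⟩
  have hnull : Vanishing P (fun n ↦ {ω | ¬ (X n 0 ω).z21 = 0} ∪ {ω | ∃ t : ℝ≥0, 0 < t ∧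
      0 < (X n t ω).z21 ∧ ∀ s < t, (X n s ω).z21 = 0 ∧ diff21 R (S n) (X n s ω) ≤ 0}) :=
    Vanishing.of_eventually_zero <| by
      filter_upwards [eventually_ge_atTop 1] with n hn
      exact measure_union_null (hz n hn) (hX n hn).measure_z21_pos_eq_zero
  refine (((hnull.union hB).union (hK.union (hx₀ (ρ / 4) (by positivity)))).union
    (h.vanishing_comp_coord hX hx₀ τ he')).mono ?_
  filter_upwards [eventually_ge_atTop 1, hC, hpath,
    he.eventually_lt_const (show 0 < ρ / 4 by positivity)] with n hn hCn hpn hen ω hω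
  have hn' : (0 : ℝ) < n := by exact_mod_cast hn
  by_contra hcon
  simp only [mem_union, mem_ofPred_eq, not_or, not_exists, not_and, not_lt, not_le, not_not] at hcon
  obtain ⟨⟨⟨⟨hz0, hjump⟩, hωB⟩, hqK, hd⟩, hcomp⟩ := hcon
  obtain ⟨T, hTτ, hbad, hgood⟩ := (hX n hn).exists_first_exit hω
  have hrate : rateBound R (S n) (K * n) ≤ C * n := by
    refine le_trans ?_ hCn
    rw [rateBound, rateBound]
    push_cast
    have := h.pos.theta1
    have := h.pos.theta2
    linarith
  have hearly : EarlyPath R (S n) n (fun t ↦ X n t ω) x₀ ρ (e n) T := by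
    refine ⟨hgood, fun j t ht ↦ hcomp j t (ht.trans hTτ), fun t ht ↦ ?_⟩
    have h1 := (hX n hn).dist_fluid_le h.pos (h.lam1_pos n hn).le (h.lam2_pos n hn).le hn hgood
      (fun j t ht ↦ hcomp j t (ht.trans hTτ)) (fun t ht ↦ hqK t ((ht.trans hTτ).trans hτ1)) ht
    have h2 : (e n + rateBound R (S n) (K * n) * T) / n ≤ e n / n + C * τ := by
      rw [add_div]
      refine add_le_add_right ?_ _
      rw [div_le_iff₀ hn']
      calc rateBound R (S n) (K * n) * T ≤ C * n * τ :=
            mul_le_mul hrate (NNReal.coe_le_coe.2 hTτ) T.coe_nonneg (by positivity)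
        _ = C * τ * n := by ring
    rw [← fluid_of_z21 hz0] at hd
    have := dist_triangle (fluid n (X n t ω)) (fluid n (X n 0 ω)) x₀
    linarith
  obtain ⟨horder, hpos⟩ := hpn ω hωB T hearly
  -- Before `T` one has `Q₁ > r₁₂ Q₂ ≥ r₂₁ Q₂`, hence `D₂₁ < 0`, and off the null event `Z₂₁` does
  -- not jump at `T`.
  have hzT : (X n T ω).z21 = 0 := by
    rcases eq_or_ne T 0 with rfl | hT
    · exact hz0
    by_contra hzT
    refine hjump T (pos_iff_ne_zero.2 hT) (Nat.pos_of_ne_zero hzT) fun s hs ↦ ?_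
    have hg := hgood s hs
    refine ⟨hg.1, ?_⟩
    have h1 := horder s hs.le
    simp only [coord, Matrix.cons_val_zero, Matrix.cons_val_one, hg.1, Nat.cast_zero, sub_zero,
      add_zero] at h1
    have h2 := mul_le_mul_of_nonneg_right hr (Nat.cast_nonneg (α := ℝ) (X n s ω).q2)
    have h3 := hk21 n hn
    rw [diff21]
    linarith
  have hq := horder T le_rfl
  simp only [coord, Matrix.cons_val_zero, Matrix.cons_val_one, hzT, Nat.cast_zero, sub_zero,
      add_zero] at hq hpos
  refine hbad ⟨hzT, ?_, by exact_mod_cast hpos⟩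
  have : 0 < R.r12 * (X n T ω).q2 := mul_pos hr0 hpos
  have h4 : (0 : ℝ) < (X n T ω).q1 := by linarith
  exact_mod_cast h4

end Sequences

end

section

/-! ### Persistence of the queues -/

/-- Joint continuity at `(x₀, p₀)` makes the radius independent of `n`, so a sign of a limiting
drift holds near `x₀` for all large systems at once. -/
lemma exists_ball_pos {E : Type*} [TopologicalSpace E] {F : (Fin 3 → ℝ) × E → ℝ}
    (hF : Continuous F) {p : ℕ → E} {p₀ : E} (hp : Tendsto p atTop (𝓝 p₀)) {x₀ : Fin 3 → ℝ}
    (h0 : 0 < F (x₀, p₀)) :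
    ∃ ρ > 0, ∀ᶠ n in atTop, ∀ γ, dist γ x₀ < ρ → 0 < F (γ, p n) := by
  have h1 : ∀ᶠ z in 𝓝 x₀ ×ˢ 𝓝 p₀, 0 < F z := by
    rw [← nhds_prod_eq]
    exact hF.continuousAt.eventually_const_lt h0
  obtain ⟨pa, ha, pb, hb, hab⟩ := eventually_prod_iff.1 h1
  obtain ⟨ρ, hρ, hball⟩ := Metric.eventually_nhds_iff.1 ha
  exact ⟨ρ, hρ, (hp.eventually hb).mono fun n hn γ hγ ↦ hab (hball hγ) hn⟩

/-- The parameters of the `n`-th system divided by `n`. -/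
def Scale.div (S : Scale) (n : ℕ) : Limits := ⟨S.lam1 / n, S.lam2 / n, S.m1 / n, S.m2 / n⟩

/-- The drift of the total fluid queue. -/
def driftTotal (R : Rates) (l : Limits) (γ : Fin 3 → ℝ) : ℝ :=
  l.lam1 + l.lam2 - R.mu11 * l.m1 - pool2Rate R l γ - R.theta1 * γ 0 - R.theta2 * γ 1

/-- The completions in pool 2 are directed to queue 2 instead of queue 1. As the pool rate is
positive, `δ₊ ≥ 0` forces `δ₋ > 0`, so `𝔸⁺` can be treated together with `𝔸`. -/
lemma driftNeg_eq (R : Rates) (l : Limits) (γ : Fin 3 → ℝ) :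
    driftNeg R l γ = driftPos R l γ + (1 + R.r12) * pool2Rate R l γ := by
  rw [driftNeg, driftPos]
  ring

lemma pool2Rate_pos {R : Rates} (hR : R.Pos) {l : Limits} (hm2 : 0 < l.m2) {γ : Fin 3 → ℝ}
    (hγ : γ ∈ fluidSpace l) : 0 < pool2Rate R l γ := by
  obtain ⟨-, -, h2, h3⟩ := hγ
  rw [pool2Rate]
  have a1 := mul_nonneg hR.mu12.le h2
  have a2 := mul_nonneg hR.mu22.le (sub_nonneg.2 h3)
  rcases h2.eq_or_lt with h | h
  · have := mul_pos hR.mu22 hm2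
    rw [← h]
    linarith
  · have := mul_pos hR.mu12 h
    linarith

section Single

variable {Ω : Type*} {mΩ : MeasurableSpace Ω} {R : Rates} {S : Scale} {𝓕 : Filtration ℝ≥0 mΩ}
  {P : Measure Ω} {X : ℝ≥0 → Ω → State} {ω : Ω} {T : ℝ≥0} {x₀ : Fin 3 → ℝ} {ρ e : ℝ} {n : ℕ}

lemma drift_sub_of_diff12_nonpos {x : State} (hn : 1 ≤ n) (hg : Good x)
    (hd : diff12 R S x ≤ 0) :
    drift R S x 0 - R.r12 * drift R S x 1 = n * driftNeg R (S.div n) (fluid n x) := by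
  have hn' : (n : ℝ) ≠ 0 := by positivity
  have hd' : ¬ 0 < diff12 R S x := not_lt.2 hd
  simp [drift, hd, hd', driftNeg, Scale.div, pool2Rate, fluid, coord, hg.1]
  field_simp
  ring

lemma drift_add {x : State} (hn : 1 ≤ n) (hg : Good x) :
    drift R S x 0 + drift R S x 1 = n * driftTotal R (S.div n) (fluid n x) := by
  have hn' : (n : ℝ) ≠ 0 := by positivity
  by_cases hd : 0 < diff12 R S x
  · have hd' : ¬ diff12 R S x ≤ 0 := not_le.2 hd
    simp [drift, hd, hd', driftTotal, Scale.div, pool2Rate, fluid, coord, hg.1]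
    field_simp
    ring
  · have hd' : diff12 R S x ≤ 0 := not_lt.1 hd
    simp [drift, hd, hd', driftTotal, Scale.div, pool2Rate, fluid, coord, hg.1]
    field_simp
    ring

lemma drift_one_of_diff12_pos {x : State} (hn : 1 ≤ n) (hg : Good x) (hd : 0 < diff12 R S x) :
    drift R S x 1 = n * ((S.div n).lam2 - R.theta2 * fluid n x 1) := by
  have hn' : (n : ℝ) ≠ 0 := by positivity
  have hd' : ¬ diff12 R S x ≤ 0 := not_le.2 hd
  simp [drift, hd', Scale.div, fluid, coord, hg.1]
  field_simp

lemma diff12_of_good {x : State} (hg : Good x) :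
    diff12 R S x = coord 0 x - R.r12 * coord 1 x - S.k12 := by
  simp [diff12, coord, hg.1]
  ring

/-- The queue difference `D₁₂` does not fall much below zero while `δ₋ > 0`. -/
lemma IsChain.le_coord_sub (h : IsChain R S 𝓕 P X) (hr : 0 < R.r12) (hn : 1 ≤ n)
    (hp : EarlyPath R S n (fun t ↦ X t ω) x₀ ρ e T) {c : ℝ} (hc : 0 ≤ c)
    (h0 : S.k12 - c ≤ coord 0 (X 0 ω) - R.r12 * coord 1 (X 0 ω))
    (hpos : ∀ γ, dist γ x₀ < ρ → 0 < driftNeg R (S.div n) γ) {t : ℝ≥0} (ht : t ≤ T) :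
    S.k12 - c - 2 * ((1 + R.r12) * e) ≤ coord 0 (X t ω) - R.r12 * coord 1 (X t ω) := by
  have h1 := h.excursion_lower_bound hp.good hp.comp_le ![1, -R.r12, 0] (κ := S.k12) hc
    (by simp [Fin.sum_univ_three]; linarith) (fun s hs hlt ↦ ?_) ht
  · simp [Fin.sum_univ_three, abs_of_pos hr] at h1
    linarith
  · have hg := hp.good s hs
    simp [Fin.sum_univ_three] at hlt ⊢
    have hd : diff12 R S (X s ω) ≤ 0 := by
      rw [diff12_of_good hg]
      linarith
    have h2 := drift_sub_of_diff12_nonpos hn hg hd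
    have h3 : 0 ≤ n * driftNeg R (S.div n) (fluid n (X s ω)) :=
      mul_nonneg n.cast_nonneg (hpos _ (hp.near s hs.le)).le
    linarith

/-- The total queue does not fall much below its initial value while its drift is positive. -/
lemma IsChain.le_coord_add (h : IsChain R S 𝓕 P X) (hn : 1 ≤ n)
    (hp : EarlyPath R S n (fun t ↦ X t ω) x₀ ρ e T)
    (hpos : ∀ γ, dist γ x₀ < ρ → 0 < driftTotal R (S.div n) γ) {t : ℝ≥0} (ht : t ≤ T) :
    coord 0 (X 0 ω) + coord 1 (X 0 ω) - 4 * e ≤ coord 0 (X t ω) + coord 1 (X t ω) := by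
  have h1 := h.excursion_lower_bound hp.good hp.comp_le ![1, 1, 0]
    (κ := coord 0 (X 0 ω) + coord 1 (X 0 ω)) le_rfl
    (by simp [Fin.sum_univ_three]) (fun s hs _ ↦ ?_) ht
  · simp [Fin.sum_univ_three] at h1
    linarith
  · have h2 := drift_add (R := R) (S := S) hn (hp.good s hs)
    have h3 : 0 ≤ n * driftTotal R (S.div n) (fluid n (X s ω)) :=
      mul_nonneg n.cast_nonneg (hpos _ (hp.near s hs.le)).le
    simp [Fin.sum_univ_three]
    linarith

/-- Queue 2 does not fall much below a level under which class 1 has priority for pool 2. -/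
lemma IsChain.le_coord_one (h : IsChain R S 𝓕 P X) (hn : 1 ≤ n)
    (hp : EarlyPath R S n (fun t ↦ X t ω) x₀ ρ e T) {κ : ℝ} (h0 : κ ≤ coord 1 (X 0 ω))
    (hd : ∀ s < T, coord 1 (X s ω) < κ → 0 < diff12 R S (X s ω))
    (hpos : ∀ γ, dist γ x₀ < ρ → 0 < (S.div n).lam2 - R.theta2 * γ 1) :
    κ - 2 * e ≤ coord 1 (X T ω) := by
  have h1 := h.excursion_lower_bound hp.good hp.comp_le ![0, 1, 0] (κ := κ) le_rfl
    (by simp [Fin.sum_univ_three]; linarith) (fun s hs hlt ↦ ?_) le_rfl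
  · simp [Fin.sum_univ_three] at h1
    linarith
  · simp [Fin.sum_univ_three] at hlt ⊢
    rw [drift_one_of_diff12_pos hn (hp.good s hs) (hd s hs hlt)]
    exact mul_nonneg n.cast_nonneg (hpos _ (hp.near s hs.le)).le

end Single

/-! ### Exit times in the two cases for the initial fluid state -/

section Sequences

/-- Thresholds of the order of `c n`, and initial queue lengths above `a n`, where `a n` is at least of
the order of `c n`. -/
structure Thresholds (S : ℕ → Scale) (c a : ℕ → ℝ) (κ α : ℝ) : Prop where
  c_pos : ∀ n, 1 ≤ n → 0 < c n
  c_div : Tendsto (fun n : ℕ ↦ c n / n) atTop (𝓝 0)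
  c_sqrt : Tendsto (fun n : ℕ ↦ c n / √n) atTop atTop
  k12_pos : ∀ n, 1 ≤ n → 0 < (S n).k12
  k21_pos : ∀ n, 1 ≤ n → 0 < (S n).k21
  k12 : Tendsto (fun n ↦ (S n).k12 / c n) atTop (𝓝 κ)
  κ_pos : 0 < κ
  α_pos : 0 < α
  lt_init : ∀ᶠ n in atTop, α * c n < a n

variable {R : Rates} {S : ℕ → Scale} {l : Limits} {c a : ℕ → ℝ} {κ α : ℝ}

lemma Thresholds.tendsto_c (h : Thresholds S c a κ α) : Tendsto c atTop atTop := by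
  refine (h.c_sqrt.atTop_mul_atTop₀ (Real.tendsto_sqrt_atTop.comp
    tendsto_natCast_atTop_atTop)).congr' ?_
  filter_upwards [eventually_ge_atTop 1] with n hn
  have : (0 : ℝ) < n := by exact_mod_cast hn
  exact div_mul_cancel₀ _ (Real.sqrt_pos.2 this).ne'

lemma Thresholds.tendsto_k12_div (h : Thresholds S c a κ α) :
    Tendsto (fun n : ℕ ↦ (S n).k12 / n) atTop (𝓝 0) := by
  have h1 := h.k12.mul h.c_div
  rw [mul_zero] at h1
  refine h1.congr' ?_
  filter_upwards [eventually_ge_atTop 1] with n hn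
  exact div_mul_div_cancel₀ (h.c_pos n hn).ne'

lemma Regime.tendsto_div (h : Regime R S l) :
    Tendsto (fun n : ℕ ↦ ((S n).lam1 / n, (S n).lam2 / n, ((S n).m1 : ℝ) / n, ((S n).m2 : ℝ) / n))
      atTop (𝓝 (l.lam1, l.lam2, l.m1, l.m2)) :=
  h.lam1.prodMk_nhds (h.lam2.prodMk_nhds (h.m1.prodMk_nhds h.m2))

lemma Regime.exists_ball_driftNeg (h : Regime R S l) {x₀ : Fin 3 → ℝ} (h0 : 0 < driftNeg R l x₀) :
    ∃ ρ > 0, ∀ᶠ n in atTop, ∀ γ, dist γ x₀ < ρ → 0 < driftNeg R ((S n).div n) γ :=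
  exists_ball_pos (F := fun z : (Fin 3 → ℝ) × ℝ × ℝ × ℝ × ℝ ↦
    driftNeg R ⟨z.2.1, z.2.2.1, z.2.2.2.1, z.2.2.2.2⟩ z.1)
    (by unfold driftNeg pool2Rate; fun_prop) h.tendsto_div h0

lemma Regime.exists_ball_driftTotal (h : Regime R S l) {x₀ : Fin 3 → ℝ}
    (h0 : 0 < driftTotal R l x₀) :
    ∃ ρ > 0, ∀ᶠ n in atTop, ∀ γ, dist γ x₀ < ρ → 0 < driftTotal R ((S n).div n) γ :=
  exists_ball_pos (F := fun z : (Fin 3 → ℝ) × ℝ × ℝ × ℝ × ℝ ↦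
    driftTotal R ⟨z.2.1, z.2.2.1, z.2.2.2.1, z.2.2.2.2⟩ z.1)
    (by unfold driftTotal pool2Rate; fun_prop) h.tendsto_div h0

lemma Regime.exists_ball_lam2 (h : Regime R S l) {x₀ : Fin 3 → ℝ}
    (h0 : 0 < l.lam2 - R.theta2 * x₀ 1) :
    ∃ ρ > 0, ∀ᶠ n in atTop, ∀ γ, dist γ x₀ < ρ → 0 < ((S n).div n).lam2 - R.theta2 * γ 1 :=
  exists_ball_pos (F := fun z : (Fin 3 → ℝ) × ℝ × ℝ × ℝ × ℝ ↦ z.2.2.1 - R.theta2 * z.1 1)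
    (by fun_prop) h.tendsto_div h0

lemma exists_ball_one {x₀ : Fin 3 → ℝ} (h0 : 0 < x₀ 1) :
    ∃ ρ > 0, ∀ γ, dist γ x₀ < ρ → 0 < γ 1 :=
  Metric.eventually_nhds_iff.1 ((continuous_apply 1).continuousAt.eventually_const_lt h0)

variable {Ω : ℕ → Type*} [mΩ : ∀ n, MeasurableSpace (Ω n)]
  {P : ∀ n, Measure (Ω n)} [∀ n, IsProbabilityMeasure (P n)]
  {𝓕 : ∀ n, Filtration ℝ≥0 (mΩ n)} {X : ∀ n, ℝ≥0 → Ω n → State} {x₀ : Fin 3 → ℝ}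

/-- Early paths stay good if class 1 has priority for pool 2. -/
lemma Regime.exists_exitsAfter_of_regionSPos (h : Regime R S l) (hr : R.r21 ≤ R.r12)
    (hr0 : 0 < R.r12) (hl2 : 0 < l.lam2) (ht : Thresholds S c a κ α)
    (hX : ∀ n, 1 ≤ n → IsChain R (S n) (𝓕 n) (P n) (X n)) (hclose : InitClose P X x₀)
    (hinit : ∀ n, 1 ≤ n → ∀ᵐ ω ∂(P n),
      (X n 0 ω).z21 = 0 ∧ a n < (X n 0 ω).q1 ∧ a n < (X n 0 ω).q2)
    (hx₀ : x₀ ∈ regionSPos R l) : ∃ τ : ℝ≥0, 0 < τ ∧ ExitsAfter P X τ := by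
  obtain ⟨⟨-, hx1, -, -⟩, hx⟩ := hx₀
  obtain ⟨ρ₁, hρ₁, h1⟩ := exists_ball_pos
    (F := fun z : (Fin 3 → ℝ) × ℝ ↦ z.1 0 - R.r12 * z.1 1 - z.2) (x₀ := x₀) (by fun_prop)
    ht.tendsto_k12_div (by simpa using hx)
  -- Either queue 2 is positive on the fluid scale, or `x₀ 1 = 0` and its drift `λ₂ - θ₂ q₂` is
  -- positive near `x₀`.
  obtain ⟨ρ₂, hρ₂, h2⟩ : ∃ ρ > 0, ∀ᶠ n in atTop, ∀ γ, dist γ x₀ < ρ →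
      0 < γ 1 ∨ ∀ γ, dist γ x₀ < ρ → 0 < ((S n).div n).lam2 - R.theta2 * γ 1 := by
    rcases hx1.eq_or_lt with h0 | h0
    · obtain ⟨ρ, hρ, h2⟩ := h.exists_ball_lam2 (x₀ := x₀) (by rw [← h0]; linarith)
      exact ⟨ρ, hρ, h2.mono fun n hn _ _ ↦ Or.inr hn⟩
    · obtain ⟨ρ, hρ, h2⟩ := exists_ball_one h0
      exact ⟨ρ, hρ, Eventually.of_forall fun n γ hγ ↦ Or.inl (h2 γ hγ)⟩
  have hα : 0 < α / 2 := half_pos ht.α_pos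
  refine h.exists_exitsAfter hr hr0 ht.k21_pos hX hclose
    -- With `e = (α / 2) c`, the loss `2 e = α c` in `IsChain.le_coord_one` stays below the initial
    -- length `a`.
    (fun n hn ↦ (hinit n hn).mono fun ω hω ↦ hω.1) (e := fun n ↦ α / 2 * c n)
    (by simpa [mul_div_assoc] using ht.c_div.const_mul (α / 2))
    (by simpa [mul_div_assoc] using ht.c_sqrt.const_mul_atTop hα) (lt_min hρ₁ hρ₂)
    (B := fun n ↦ {ω | ¬ ((X n 0 ω).z21 = 0 ∧ a n < (X n 0 ω).q1 ∧ a n < (X n 0 ω).q2)})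
    (Vanishing.of_eventually_zero ((eventually_ge_atTop 1).mono hinit)) ?_
  filter_upwards [eventually_ge_atTop 1, h1, h2, ht.lt_init] with n hn h1n h2n han ω hω T hp
  have hn' : (0 : ℝ) < n := by exact_mod_cast hn
  obtain ⟨hz0, -, hq2⟩ := not_not.1 hω
  have horder : ∀ t ≤ T, (S n).k12 < coord 0 (X n t ω) - R.r12 * coord 1 (X n t ω) := by
    intro t ht
    have := h1n _ ((hp.near t ht).trans_le (min_le_left _ _))
    simp only [fluid] at this
    rwa [← mul_div_assoc, ← sub_div, ← sub_div, div_pos_iff_of_pos_right hn', sub_pos] at this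
  refine ⟨fun t ht' ↦ (ht.k12_pos n hn).trans (horder t ht'), ?_⟩
  rcases h2n _ ((hp.near T le_rfl).trans_le (min_le_right _ _)) with h3 | h3
  · exact (div_pos_iff_of_pos_right hn').1 h3
  · have h0 : a n ≤ coord 1 (X n 0 ω) := by
      simpa [coord, hz0] using hq2.le
    have h4 := (hX n hn).le_coord_one hn hp h0
      (fun s hs _ ↦ by
        rw [diff12_of_good (hp.good s hs), sub_pos]
        exact horder s hs.le)
      (fun γ hγ ↦ h3 γ (hγ.trans_le (min_le_right _ _)))
    linarith

/-- Early paths stay good if they start on the boundary `q₁ = r₁₂ q₂` with `δ₋ > 0`. -/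
lemma Regime.exists_exitsAfter_of_regionS0 (h : Regime R S l) (hr : R.r21 ≤ R.r12)
    (hr0 : 0 < R.r12) (hl2 : 0 < l.lam2) (ht : Thresholds S c a κ α)
    (hX : ∀ n, 1 ≤ n → IsChain R (S n) (𝓕 n) (P n) (X n)) (hclose : InitClose P X x₀)
    (hinit : ∀ n, 1 ≤ n → ∀ᵐ ω ∂(P n),
      (X n 0 ω).z21 = 0 ∧ a n < (X n 0 ω).q1 ∧ a n < (X n 0 ω).q2)
    (hdiff : ∀ η > 0, Vanishing P fun n ↦ {ω | diff12 R (S n) (X n 0 ω) ≤ -(η * c n)})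
    (hx₀ : x₀ ∈ regionS0 R l) (hneg : 0 < driftNeg R l x₀)
    (hq : 0 < x₀ 0 ∨ R.mu11 * l.m1 + pool2Rate R l x₀ < l.lam1 + l.lam2) :
    ∃ τ : ℝ≥0, 0 < τ ∧ ExitsAfter P X τ := by
  obtain ⟨⟨-, hx1, -, -⟩, hx⟩ := hx₀
  obtain ⟨ρ₁, hρ₁, h1⟩ := h.exists_ball_driftNeg hneg
  -- If `x₀ 1 = 0`, then also `x₀ 0 = 0` on the boundary, so the second alternative of `hq` holds
  -- and the total queue has positive drift.
  obtain ⟨ρ₂, hρ₂, h2⟩ : ∃ ρ > 0, ∀ᶠ n in atTop, ∀ γ, dist γ x₀ < ρ →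
      0 < γ 1 ∨ ∀ γ, dist γ x₀ < ρ → 0 < ((S n).div n).lam2 - R.theta2 * γ 1 ∧
        0 < driftTotal R ((S n).div n) γ := by
    rcases hx1.eq_or_lt with h0 | h0
    · have h00 : x₀ 0 = 0 := by rw [← h0] at hx; linarith
      obtain ⟨ρ, hρ, h2⟩ := h.exists_ball_lam2 (x₀ := x₀) (by rw [← h0]; linarith)
      obtain ⟨ρ', hρ', h3⟩ := h.exists_ball_driftTotal (x₀ := x₀) (by
        have := hq.resolve_left h00.not_gt
        rw [driftTotal, ← h0, h00]
        linarith)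
      refine ⟨min ρ ρ', lt_min hρ hρ', ?_⟩
      filter_upwards [h2, h3] with n h2n h3n _ _
      exact Or.inr fun γ hγ ↦ ⟨h2n γ (hγ.trans_le (min_le_left _ _)),
        h3n γ (hγ.trans_le (min_le_right _ _))⟩
    · obtain ⟨ρ, hρ, h2⟩ := exists_ball_one h0
      exact ⟨ρ, hρ, Eventually.of_forall fun n γ hγ ↦ Or.inl (h2 γ hγ)⟩
  -- In units of `η c`: the order of the queues loses `1` initially and `2 (1 + r₁₂)` in an
  -- excursion, to be paid by `k₁₂ ≈ κ c`. Queue 2 loses `5 + 2`, to be paid by `a > α c`.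
  obtain ⟨η, hη, hηα, hηκ⟩ : ∃ η > 0, 7 * η < α ∧ (3 + 2 * R.r12) * η < κ := by
    have h0 : 0 < min (α / 8) (κ / (2 * (3 + 2 * R.r12))) :=
      lt_min (by linarith [ht.α_pos]) (div_pos ht.κ_pos (by linarith))
    refine ⟨_, h0, by linarith [min_le_left (α / 8) (κ / (2 * (3 + 2 * R.r12))), ht.α_pos], ?_⟩
    calc _ ≤ (3 + 2 * R.r12) * (κ / (2 * (3 + 2 * R.r12))) :=
          mul_le_mul_of_nonneg_left (min_le_right _ _) (by linarith)
      _ = κ / 2 := by field_simp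
      _ < κ := half_lt_self ht.κ_pos
  refine h.exists_exitsAfter hr hr0 ht.k21_pos hX hclose
    (fun n hn ↦ (hinit n hn).mono fun ω hω ↦ hω.1) (e := fun n ↦ η * c n)
    (by simpa [mul_div_assoc] using ht.c_div.const_mul η)
    (by simpa [mul_div_assoc] using ht.c_sqrt.const_mul_atTop hη) (lt_min hρ₁ hρ₂)
    ((Vanishing.of_eventually_zero (A := fun n ↦ {ω | ¬ ((X n 0 ω).z21 = 0 ∧
      a n < (X n 0 ω).q1 ∧ a n < (X n 0 ω).q2)}) ((eventually_ge_atTop 1).mono hinit)).union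
      (hdiff η hη)) ?_
  filter_upwards [eventually_ge_atTop 1, h1, h2, ht.lt_init,
    ht.k12.eventually_const_lt hηκ] with n hn h1n h2n han hkn ω hω T hp
  have hn' : (0 : ℝ) < n := by exact_mod_cast hn
  have hcn := ht.c_pos n hn
  rw [lt_div_iff₀ hcn] at hkn
  simp only [mem_union, mem_ofPred_eq, not_or, not_le, not_not] at hω
  obtain ⟨⟨hz0, -, hq2⟩, hd0⟩ := hω
  have e0 : coord 0 (X n 0 ω) = (X n 0 ω).q1 := by simp [coord, hz0]
  have e1 : coord 1 (X n 0 ω) = (X n 0 ω).q2 := by simp [coord, hz0]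
  rw [← e1] at hq2
  rw [diff12, ← e0, ← e1] at hd0
  have hlow : ∀ t ≤ T, (S n).k12 - η * c n - 2 * ((1 + R.r12) * (η * c n))
      ≤ coord 0 (X n t ω) - R.r12 * coord 1 (X n t ω) := fun t ht' ↦
    (hX n hn).le_coord_sub hr0 hn hp (by positivity) (by linarith)
      (fun γ hγ ↦ h1n γ (hγ.trans_le (min_le_left _ _))) ht'
  refine ⟨fun t ht' ↦ by linarith [hlow t ht'], ?_⟩
  rcases h2n _ ((hp.near T le_rfl).trans_le (min_le_right _ _)) with h3 | h3
  · exact (div_pos_iff_of_pos_right hn').1 h3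
  · have hηc : 0 < η * c n := mul_pos hη hcn
    have hαc := mul_lt_mul_of_pos_right hηα hcn
    -- The level `5 = 4 + 1` combines the loss of the total queue and the initial deficit of `D₁₂`.
    -- If `Q₂ < a - 5 η c`, writing `D₁₂ = (Q₁ + Q₂) - (1 + r₁₂) Q₂ - k₁₂` gives `D₁₂ > 5 r₁₂ η c >
    -- 0`.
    have h4 := (hX n hn).le_coord_one hn hp (κ := a n - 5 * (η * c n)) (by linarith)
      (fun s hs hlt ↦ by
        by_contra hcon
        rw [diff12_of_good (hp.good s hs)] at hcon
        have h5 := (hX n hn).le_coord_add hn hp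
          (fun γ hγ ↦ (h3 γ (hγ.trans_le (min_le_right _ _))).2) hs.le
        have h6 := mul_lt_mul_of_pos_left hlt (show 0 < 1 + R.r12 by linarith)
        have h7 := mul_lt_mul_of_pos_left hq2 (show 0 < 1 + R.r12 by linarith)
        have h8 := mul_pos hr0 hηc
        linarith)
      (fun γ hγ ↦ (h3 γ (hγ.trans_le (min_le_right _ _))).1)
    linarith

end Sequences

end

end XModel

end

/-! ### The theorem -/

theorem theorem5p4
    (R : XModel.Rates) (S : ℕ → XModel.Scale) (l : XModel.Limits)
    -- service, abandonment and arrival rates, ratio parameters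
    (hmu11 : 0 < R.mu11) (hmu12 : 0 < R.mu12) (hmu21 : 0 < R.mu21) (hmu22 : 0 < R.mu22)
    (htheta1 : 0 < R.theta1) (htheta2 : 0 < R.theta2)
    (hr12 : 0 < R.r12) (hr21 : 0 < R.r21) (hr : R.r21 ≤ R.r12)
    (hr12q : ∃ ρ : ℚ, R.r12 = ρ) (hr21q : ∃ ρ : ℚ, R.r21 = ρ)
    (hlamn1 : ∀ n, 1 ≤ n → 0 < (S n).lam1) (hlamn2 : ∀ n, 1 ≤ n → 0 < (S n).lam2)
    (hkn12 : ∀ n, 1 ≤ n → 0 < (S n).k12) (hkn21 : ∀ n, 1 ≤ n → 0 < (S n).k21)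
    -- many-server heavy-traffic scaling
    (hl1 : 0 < l.lam1) (hl2 : 0 < l.lam2) (hm1 : 0 < l.m1) (hm2 : 0 < l.m2)
    (hlam1 : Tendsto (fun n : ℕ ↦ (S n).lam1 / n) atTop (𝓝 l.lam1))
    (hlam2 : Tendsto (fun n : ℕ ↦ (S n).lam2 / n) atTop (𝓝 l.lam2))
    (hpool1 : Tendsto (fun n : ℕ ↦ ((S n).m1 : ℝ) / n) atTop (𝓝 l.m1))
    (hpool2 : Tendsto (fun n : ℕ ↦ ((S n).m2 : ℝ) / n) atTop (𝓝 l.m2))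
    -- scaled thresholds
    (c : ℕ → ℝ) (k12 k21 : ℝ) (hc : ∀ n, 1 ≤ n → 0 < c n) (hk12 : 0 < k12) (hk21 : 0 < k21)
    (hkc12 : Tendsto (fun n ↦ (S n).k12 / c n) atTop (𝓝 k12))
    (hkc21 : Tendsto (fun n ↦ (S n).k21 / c n) atTop (𝓝 k21))
    (hcn : Tendsto (fun n : ℕ ↦ c n / n) atTop (𝓝 0))
    (hcsqrt : Tendsto (fun n : ℕ ↦ c n / Real.sqrt n) atTop atTop)
    -- system overload, with class 1 more overloaded
    (hA1 : R.mu12 * XModel.sAlone2 R l < R.theta1 * XModel.qAlone1 R l)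
    (hA2 : R.r12 * XModel.qAlone2 R l < XModel.qAlone1 R l)
    -- the Markov chains
    {Ω : ℕ → Type*} [mΩ : ∀ n, MeasurableSpace (Ω n)]
    (P : ∀ n, Measure (Ω n)) [∀ n, IsProbabilityMeasure (P n)]
    (𝓕 : ∀ n, Filtration ℝ≥0 (mΩ n)) (X : ∀ n, ℝ≥0 → Ω n → XModel.State)
    (hX : ∀ n, 1 ≤ n → XModel.IsChain R (S n) (𝓕 n) (P n) (X n))
    -- initial conditions
    (a : ℕ → ℝ) (a' : EReal) (ha' : 0 < a')
    (hac : Tendsto (fun n ↦ ((a n / c n : ℝ) : EReal)) atTop (𝓝 a'))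
    (hinit : ∀ n, 1 ≤ n → ∀ᵐ ω ∂(P n),
      (X n 0 ω).z21 = 0 ∧ a n < (X n 0 ω).q1 ∧ a n < (X n 0 ω).q2)
    (x₀ : Fin 3 → ℝ)
    (hx₀ : x₀ ∈ XModel.regionA R l ∪ XModel.regionAPos R l ∪ XModel.regionSPos R l)
    {Ω' : Type*} [MeasurableSpace Ω'] (P' : Measure Ω') [IsProbabilityMeasure P'] (L : Ω' → ℝ)
    (hX₀ : TendstoInDistribution (fun n ω ↦ XModel.scaled n (X n 0 ω)) atTop (fun _ ↦ x₀) P P')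
    (hD₀ : x₀ ∈ XModel.regionA R l ∪ XModel.regionAPos R l →
      TendstoInDistribution (fun n ω ↦ XModel.diff12 R (S n) (X n 0 ω)) atTop L P P') :
    ((0 < x₀ 0 ∨ R.mu11 * l.m1 + XModel.pool2Rate R l x₀ < l.lam1 + l.lam2) →
      ∃ τ : ℝ≥0, 0 < τ ∧ XModel.NoOppositeSharing P X τ ∧ XModel.ExitsAfter P X τ ∧
        XModel.AsymptoticallyEquivalent R S P X τ) ∧
    (∀ τ : ℝ≥0, 0 < τ → XModel.ExitsAfter P X τ → XModel.AsymptoticallyEquivalent R S P X τ) := by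
  have h : XModel.Regime R S l :=
    ⟨⟨hmu11, hmu12, hmu21, hmu22, htheta1, htheta2⟩, hlamn1, hlamn2, hlam1, hlam2, hpool1, hpool2⟩
  have hclose : XModel.InitClose P X x₀ := XModel.initClose_of_tendstoInDistribution hX₀
  refine ⟨fun hq ↦ ?_, fun τ hτ hexit ↦ h.asymptoticallyEquivalent hX hclose hτ hexit⟩
  suffices hexists : ∃ τ : ℝ≥0, 0 < τ ∧ XModel.ExitsAfter P X τ by
    obtain ⟨τ, hτ, hexit⟩ := hexists
    exact ⟨τ, hτ, XModel.noOppositeSharing_of_exitsAfter hX hτ hexit, hexit,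
      h.asymptoticallyEquivalent hX hclose hτ hexit⟩
  -- A real number strictly between `0` and the limit, which may be infinite; then `α cₙ < aₙ`
  -- eventually.
  obtain ⟨α, hα0, hα⟩ := EReal.lt_iff_exists_real_btwn.1 ha'
  have ht : XModel.Thresholds S c a k12 α := by
    refine ⟨hc, hcn, hcsqrt, hkn12, hkn21, hkc12, hk12, by exact_mod_cast hα0, ?_⟩
    filter_upwards [hac.eventually_const_lt hα, eventually_ge_atTop 1] with n hn hn1
    rw [EReal.coe_lt_coe_iff, lt_div_iff₀ (hc n hn1)] at hn
    exact hn
  rcases hx₀ with hx | hx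
  -- Convergence in distribution makes `D₁₂(0)` tight, so it is bounded below by `-η cₙ` with high
  -- probability because `cₙ → ∞`.
  · have hdiff : ∀ η > 0, XModel.Vanishing P
        fun n ↦ {ω | XModel.diff12 R (S n) (X n 0 ω) ≤ -(η * c n)} := fun η hη ↦
      XModel.vanishing_le_neg_of_tendstoInDistribution (hD₀ hx) (ht.tendsto_c.const_mul_atTop hη)
    have hS0 : x₀ ∈ XModel.regionS0 R l := hx.elim (fun hx ↦ hx.1) fun hx ↦ hx.1
    refine h.exists_exitsAfter_of_regionS0 hr hr12 hl2 ht hX hclose hinit hdiff hS0 ?_ hq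
    rcases hx with hx | hx
    · exact hx.2.1
    · rw [XModel.driftNeg_eq]
      have := mul_pos (show 0 < 1 + R.r12 by linarith) (XModel.pool2Rate_pos h.pos hm2 hS0.1)
      linarith [hx.2]
  · exact h.exists_exitsAfter_of_regionSPos hr hr12 hl2 ht hX hclose hinit hx
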